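/- Let $(G,X)$ be a Shimura datum: $G$ is a connected reductive group over $\mathbb{Q}$ and $X$ is a $G(\mathbb{R})$-conjugacy class of homomorphisms $h:\mathbb{S}\to G_{\mathbb{R}}$ of real algebraic groups, $\mathbb{S}=\mathrm{Res}_{\mathbb{C}/\mathbb{R}}\mathbb{G}_m$, such that for $h\in X$: the Lie algebra of $G$ has Hodge type $\{(-1,1),(0,0),(1,-1)\}$; conjugation by $h(i)$ is a Cartan involution of $G^{\mathrm{ad}}_{\mathbb{R}}$; and $G^{\mathrm{ad}}$ has no nontrivial factor defined over $\mathbb{Q}$ on which the projection of $h$ is trivial. Let $d$ be the complex dimension of $X$. For $h\in X$ put $\mu_h(z)=h_{\mathbb{C}}(z,1)$, where $\mathbb{S}(\mathbb{C})=\mathbb{C}^\times\times\mathbb{C}^\times$ and $\mathbb{S}(\mathbb{R})=\{(z,\bar z)\}$. Fix a maximal torus $T$ of $G_{\mathbb{C}}$ and a system $\Phi^+$ of positive roots of $(G_{\mathbb{C}},T)$ (that is, a Borel subgroup containing $T$). Let $\chi\in X^*(T)$ be the sum of the positive roots, and let $\mu\in X_*(T)$ be antidominant ($\langle\alpha,\mu\rangle\le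 0$ for all $\alpha\in\Phi^+$) and lie in the $G(\mathbb{C})$-conjugacy class of the cocharacters $-\mu_h$, $h\in X$. Then: 1. $\langle\chi,\mu\rangle=-d$. 2. Let $(\widehat G,\widehat T,\widehat\Phi^+)$ be the complex dual group: a connected reductive group over $\mathbb{C}$ with a maximal torus, a system of positive roots and identifications $X^*(\widehat T)=X_*(T)$, $X_*(\widehat T)=X^*(T)$ which respect the pairings and exchange roots with coroots and positive roots with positive coroots. Let $\widehat\mu\in X^*(\widehat T)$ be the weight corresponding to $\mu$, and let $r:\widehat G\to\mathrm{Aut}(V_\mu)$ be an irreducible finite-dimensional algebraic representation with $\widehat\mu$ as an extreme weight. Let $\widehat\chi$ be the sum of the positive coroots of $\widehat G$ and $e=\widehat\chi(-1)$. Then $e$ is central in $\widehat G$ and acts on $V_\mu$ as $(-1)^d$. 3. Let $\Gamma$ be a group acting on $\widehat G$ by algebraic automorphisms that preserve $\widehat T$ and $\widehat\Phi^+$ (for example $\Gamma_E=\mathrm{Gal}(\overline{\mathbb{Q}}/E)$, $E$ the reflex field, with its usual action fixing a pinning), and let $r_L:\Gamma\ltimes\widehat G\to\mathrm{Aut}(V_\mu)$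 be a representation that extends $r$ and for which $\Gamma$ acts trivially on the $\widehat\mu$-weight space. Let $\Gamma$ act on $\widehat G\times\mathbb{C}^\times$ through the first factor. Then $e$ is fixed by $\Gamma$, and on the $C$-group $\Gamma\ltimes\big((\widehat G\times\mathbb{C}^\times)/\langle(e,-1)\rangle\big)$ there is a well defined representation $r_C$ on $V_\mu$ with $$r_C(\gamma,[g,z])=z^{-d}\,r_L(\gamma,g).$$ It is the only representation of the $C$-group on $V_\mu$ whose restriction to the classes of $\widehat G\times\mathbb{C}^\times$ is $(g,z)\mapsto z^{-d}r(g)$ and for which $\Gamma$ acts trivially on the $\widehat\mu$-weight space. -/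

import Mathlib

open scoped MatrixGroups

noncomputable section

namespace ShimuraCGroup

/-! ### Linear algebraic groups over the complex numbers

A linear algebraic group over `ℂ` is a Zariski closed subgroup of some `GL n ℂ`, identified with
its group of complex points. It is defined over `ℚ` if it is cut out by polynomials with rational
coefficients. -/

/-- The subset `S` of `GL n ℂ` is the set of common zeros, in `GL n ℂ`, of a family of polynomials
in the matrix entries with coefficients in `K`. -/
def IsZariskiClosed (K : Type) [CommRing K] [Algebra K ℂ] {n : ℕ} (S : Set (GL (Fin n) ℂ)) : Prop :=
  ∃ F : Set (MvPolynomial (Fin n × Fin n) K),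
    S = {g | ∀ f ∈ F, MvPolynomial.aeval (fun p : Fin n × Fin n => g.1 p.1 p.2) f = 0}

/-- Connectedness in the Zariski topology: `S` is not covered by two Zariski closed sets that are
disjoint on `S`, unless one of them covers `S`. -/
def IsZariskiConnected {n : ℕ} (S : Set (GL (Fin n) ℂ)) : Prop :=
  ∀ Z₁ Z₂ : Set (GL (Fin n) ℂ), IsZariskiClosed ℂ Z₁ → IsZariskiClosed ℂ Z₂ →
    S ⊆ Z₁ ∪ Z₂ → S ∩ Z₁ ∩ Z₂ = ∅ → S ⊆ Z₁ ∨ S ⊆ Z₂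

/-- Every element of `H` is a unipotent matrix. -/
def IsUnipotentGroup {n : ℕ} (H : Subgroup (GL (Fin n) ℂ)) : Prop :=
  ∀ g ∈ H, IsNilpotent ((g : Matrix (Fin n) (Fin n) ℂ) - 1)

/-- A connected reductive group over `ℂ`: a connected linear algebraic group whose unipotent radical
is trivial, that is, in which every closed connected normal unipotent subgroup is trivial. -/
structure IsConnectedReductive {n : ℕ} (G : Subgroup (GL (Fin n) ℂ)) : Prop where
  closed : IsZariskiClosed ℂ (G : Set (GL (Fin n) ℂ))
  connected : IsZariskiConnected (G : Set (GL (Fin n) ℂ))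
  unipotentRadical : ∀ N : Subgroup (GL (Fin n) ℂ), N ≤ G → (N.subgroupOf G).Normal →
    IsZariskiClosed ℂ (N : Set (GL (Fin n) ℂ)) → IsZariskiConnected (N : Set (GL (Fin n) ℂ)) →
    IsUnipotentGroup N → N = ⊥

/-- Regular functions on a linear algebraic group: polynomials in the entries of `g` and `g⁻¹`. -/
def IsRegular {n : ℕ} {H : Subgroup (GL (Fin n) ℂ)} (f : H → ℂ) : Prop :=
  ∃ p : MvPolynomial ((Fin n × Fin n) ⊕ (Fin n × Fin n)) ℂ, ∀ g : H,
    f g = MvPolynomial.eval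
      (Sum.elim (fun q => (g : GL (Fin n) ℂ).1 q.1 q.2)
        (fun q => ((g⁻¹ : H) : GL (Fin n) ℂ).1 q.1 q.2)) p

/-- The Lie algebra of a closed subgroup `K` of `GL n ℂ`, as a set of matrices: all `Y` such that the
one-parameter group `t ↦ exp (t Y)`, `t` real, lies in `K`. If `K` is an algebraic group, this is
the Lie algebra of the algebraic group. -/
def lieAlg {n : ℕ} (K : Subgroup (GL (Fin n) ℂ)) : Set (Matrix (Fin n) (Fin n) ℂ) :=
  {Y | ∀ t : ℝ, ∃ g ∈ K, (g : Matrix (Fin n) (Fin n) ℂ) = NormedSpace.exp (t • Y)}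

/-- The dimension of a closed subgroup of `GL n ℂ` as a real Lie group. -/
def realDim {n : ℕ} (K : Subgroup (GL (Fin n) ℂ)) : ℕ := Set.finrank ℝ (lieAlg K)

/-- The adjoint action of `GL n ℂ` on matrices. -/
def Ad {n : ℕ} (g : GL (Fin n) ℂ) (Y : Matrix (Fin n) (Fin n) ℂ) : Matrix (Fin n) (Fin n) ℂ :=
  g.1 * Y * (g⁻¹).1

/-! ### Tori, characters, cocharacters, roots and coroots -/

/-- A torus in `GL n ℂ`: a closed connected subgroup that can be brought to diagonal form. -/
structure Torus (n : ℕ) where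
  carrier : Subgroup (GL (Fin n) ℂ)
  closed : IsZariskiClosed ℂ (carrier : Set (GL (Fin n) ℂ))
  connected : IsZariskiConnected (carrier : Set (GL (Fin n) ℂ))
  diagonalizable : ∃ P : GL (Fin n) ℂ, ∀ t ∈ carrier, (P * t * P⁻¹).1.IsDiag

theorem Torus.comm {n : ℕ} (T : Torus n) {a b : GL (Fin n) ℂ} (ha : a ∈ T.carrier)
    (hb : b ∈ T.carrier) : a * b = b * a := by
  obtain ⟨P, hP⟩ := T.diagonalizable
  have key : (P * a * P⁻¹) * (P * b * P⁻¹) = (P * b * P⁻¹) * (P * a * P⁻¹) := by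
    apply Units.ext
    have h1 := (hP a ha).diagonal_diag
    have h2 := (hP b hb).diagonal_diag
    rw [Units.val_mul, Units.val_mul (P * b * P⁻¹), ← h1, ← h2, Matrix.diagonal_mul_diagonal,
      Matrix.diagonal_mul_diagonal]
    congr 1
    funext i
    exact mul_comm _ _
  have h3 : P * (a * b) * P⁻¹ = P * (b * a) * P⁻¹ := by
    simpa [mul_assoc] using key
  exact mul_left_cancel (mul_right_cancel h3)

instance {n : ℕ} (T : Torus n) : CommGroup T.carrier :=
  { T.carrier.toGroup with mul_comm := fun a b => Subtype.ext (T.comm a.2 b.2) }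

/-- `T` is a maximal torus of `G`. -/
def IsMaximalTorus {n : ℕ} (G : Subgroup (GL (Fin n) ℂ)) (T : Torus n) : Prop :=
  T.carrier ≤ G ∧ ∀ T' : Torus n, T'.carrier ≤ G → T.carrier ≤ T'.carrier → T'.carrier = T.carrier

theorem IsRegular.const_one {n : ℕ} {H : Subgroup (GL (Fin n) ℂ)} :
    IsRegular (fun _ : H => (1 : ℂ)) :=
  ⟨1, fun g => by simp⟩

theorem IsRegular.mul {n : ℕ} {H : Subgroup (GL (Fin n) ℂ)} {f g : H → ℂ}
    (hf : IsRegular f) (hg : IsRegular g) : IsRegular (fun x => f x * g x) := by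
  obtain ⟨p, hp⟩ := hf
  obtain ⟨q, hq⟩ := hg
  exact ⟨p * q, fun x => by
    change f x * g x = _
    rw [map_mul, hp, hq]⟩

theorem IsRegular.comp_inv {n : ℕ} {H : Subgroup (GL (Fin n) ℂ)} {f : H → ℂ}
    (hf : IsRegular f) : IsRegular (fun x => f x⁻¹) := by
  obtain ⟨p, hp⟩ := hf
  refine ⟨MvPolynomial.rename Sum.swap p, fun x => ?_⟩
  change f x⁻¹ = _
  rw [hp, MvPolynomial.eval_rename]
  congr 2
  funext q
  rcases q with q | q <;> simp

/-- The character group `X^*(T)`: the algebraic homomorphisms `T → ℂˣ` (written multiplicatively). -/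
def charGroup {n : ℕ} (T : Torus n) : Subgroup (T.carrier →* ℂˣ) where
  carrier := {χ | IsRegular (fun t => (χ t : ℂ))}
  one_mem' := by simpa using IsRegular.const_one
  mul_mem' := by
    intro a b ha hb
    simpa using IsRegular.mul ha hb
  inv_mem' := by
    intro a ha
    have h := IsRegular.comp_inv ha
    simpa using h

/-- Regular functions on `ℂˣ`: polynomials in `z` and `z⁻¹`. -/
def IsLaurent (f : ℂˣ → ℂ) : Prop :=
  ∃ p : MvPolynomial (Fin 2) ℂ, ∀ z : ℂˣ, f z = MvPolynomial.eval ![(z : ℂ), ((z⁻¹ : ℂˣ) : ℂ)] p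

theorem IsLaurent.const (c : ℂ) : IsLaurent (fun _ => c) :=
  ⟨MvPolynomial.C c, fun z => by simp⟩

theorem IsLaurent.add {f g : ℂˣ → ℂ} (hf : IsLaurent f) (hg : IsLaurent g) :
    IsLaurent (fun z => f z + g z) := by
  obtain ⟨p, hp⟩ := hf
  obtain ⟨q, hq⟩ := hg
  exact ⟨p + q, fun z => by
    change f z + g z = _
    rw [map_add, hp, hq]⟩

theorem IsLaurent.mul {f g : ℂˣ → ℂ} (hf : IsLaurent f) (hg : IsLaurent g) :
    IsLaurent (fun z => f z * g z) := by
  obtain ⟨p, hp⟩ := hf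
  obtain ⟨q, hq⟩ := hg
  exact ⟨p * q, fun z => by
    change f z * g z = _
    rw [map_mul, hp, hq]⟩

theorem IsLaurent.sum {ι : Type} (s : Finset ι) {f : ι → ℂˣ → ℂ} (hf : ∀ i, IsLaurent (f i)) :
    IsLaurent (fun z => ∑ i ∈ s, f i z) := by
  classical
  induction s using Finset.induction_on with
  | empty => simpa using IsLaurent.const 0
  | insert a s ha ih =>
    simp only [Finset.sum_insert ha]
    exact IsLaurent.add (hf a) ih

theorem IsLaurent.comp_inv {f : ℂˣ → ℂ} (hf : IsLaurent f) : IsLaurent (fun z => f z⁻¹) := by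
  obtain ⟨p, hp⟩ := hf
  refine ⟨MvPolynomial.rename (Equiv.swap 0 1) p, fun z => ?_⟩
  change f z⁻¹ = _
  rw [hp, MvPolynomial.eval_rename]
  congr 2
  funext q
  fin_cases q <;> simp

/-- The cocharacter group `X_*(T)`: the algebraic homomorphisms `ℂˣ → T` (written
multiplicatively). -/
def cocharGroup {n : ℕ} (T : Torus n) : Subgroup (ℂˣ →* T.carrier) where
  carrier := {l | ∀ i j, IsLaurent (fun z => (l z : GL (Fin n) ℂ).1 i j)}
  one_mem' := by
    intro i j
    exact IsLaurent.const ((1 : Matrix (Fin n) (Fin n) ℂ) i j)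
  mul_mem' := by
    intro a b ha hb i j
    have h : (fun z => ((a * b) z : GL (Fin n) ℂ).1 i j) =
        fun z => ∑ k, (a z : GL (Fin n) ℂ).1 i k * (b z : GL (Fin n) ℂ).1 k j := by
      funext z
      exact Matrix.mul_apply
    rw [h]
    exact IsLaurent.sum _ fun k => IsLaurent.mul (ha i k) (hb k j)
  inv_mem' := by
    intro a ha i j
    have h : (fun z => ((a⁻¹) z : GL (Fin n) ℂ).1 i j) =
        fun z => (a z⁻¹ : GL (Fin n) ℂ).1 i j := by
      funext z
      rw [map_inv]
      rfl
    rw [h]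
    exact IsLaurent.comp_inv (ha i j)

/-- `⟨χ, l⟩ = k` for a character `χ` and a cocharacter `l` of `T`: that is, `χ (l z) = z ^ k`. -/
def Pairing {n : ℕ} {T : Torus n} (χ : charGroup T) (l : cocharGroup T) (k : ℤ) : Prop :=
  ∀ z : ℂˣ, χ.1 (l.1 z) = z ^ k

/-- The roots of `G` with respect to `T`: the nontrivial characters through which `T` acts on some
line in the Lie algebra of `G`. -/
def roots {n : ℕ} (G : Subgroup (GL (Fin n) ℂ)) (T : Torus n) : Set (charGroup T) :=
  {α | α ≠ 1 ∧ ∃ Y ∈ lieAlg G, Y ≠ 0 ∧ ∀ t : T.carrier, Ad t Y = ((α.1 t : ℂˣ) : ℂ) • Y}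

/-- `l` is the coroot of the root `α`: the cocharacter with `⟨α, l⟩ = 2` for which the reflection
`x ↦ x - ⟨x, l⟩ α` of `X^*(T)` (on `T` itself: `t ↦ t * l (α t)⁻¹`) belongs to the Weyl group, that
is, is conjugation by an element of `G` normalizing `T`. -/
def IsCoroot {n : ℕ} (G : Subgroup (GL (Fin n) ℂ)) (T : Torus n)
    (α : charGroup T) (l : cocharGroup T) : Prop :=
  α ∈ roots G T ∧ Pairing α l 2 ∧
    ∃ w ∈ G, ∀ t : T.carrier, w * (t : GL (Fin n) ℂ) * w⁻¹ = ((t * (l.1 (α.1 t))⁻¹ : T.carrier) :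
      GL (Fin n) ℂ)

/-- The coroots of `G` with respect to `T`. -/
def coroots {n : ℕ} (G : Subgroup (GL (Fin n) ℂ)) (T : Torus n) : Set (cocharGroup T) :=
  {l | ∃ α, IsCoroot G T α l}

/-- `P` is a system of positive roots: the roots that are positive on some cocharacter that does not
vanish on any root. For a connected reductive group, choosing `P` is the same as choosing a Borel
subgroup containing `T`. -/
def IsPositiveSystem {n : ℕ} (G : Subgroup (GL (Fin n) ℂ)) (T : Torus n)
    (P : Set (charGroup T)) : Prop :=
  ∃ l : cocharGroup T, (∀ α ∈ roots G T, ¬ Pairing α l 0) ∧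
    P = {α | α ∈ roots G T ∧ ∃ k : ℤ, 0 < k ∧ Pairing α l k}

/-- The positive coroots: the coroots of the positive roots. -/
def posCoroots {n : ℕ} (G : Subgroup (GL (Fin n) ℂ)) (T : Torus n) (P : Set (charGroup T)) :
    Set (cocharGroup T) :=
  {l | ∃ α ∈ P, IsCoroot G T α l}

/-- The sum of the positive roots (a finite set), in the multiplicatively written `X^*(T)`. -/
def sumPosRoots {n : ℕ} {T : Torus n} (P : Set (charGroup T)) : charGroup T :=
  ∏ᶠ α ∈ P, α

/-- The sum of the positive coroots (a finite set), in the multiplicatively written `X_*(T)`. -/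
def sumPosCoroots {n : ℕ} (G : Subgroup (GL (Fin n) ℂ)) (T : Torus n) (P : Set (charGroup T)) :
    cocharGroup T :=
  ∏ᶠ l ∈ posCoroots G T P, l

/-- `l` is antidominant: `⟨α, l⟩ ≤ 0` for every positive root `α`. -/
def IsAntidominant {n : ℕ} {T : Torus n} (P : Set (charGroup T)) (l : cocharGroup T) : Prop :=
  ∀ α ∈ P, ∃ k : ℤ, k ≤ 0 ∧ Pairing α l k

/-! ### Shimura data -/

/-- Entrywise complex conjugation on `GL n ℂ`. -/
def conj {n : ℕ} : GL (Fin n) ℂ →* GL (Fin n) ℂ :=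
  Matrix.GeneralLinearGroup.map (starRingEnd ℂ)

/-- The group of real points of a group defined over `ℝ`. -/
def realPoints {n : ℕ} (G : Subgroup (GL (Fin n) ℂ)) : Subgroup (GL (Fin n) ℂ) :=
  G ⊓ MonoidHom.eqLocus conj (MonoidHom.id _)

/-- Homomorphisms of real algebraic groups from the Deligne torus `𝕊` to `G`, given on complex points
`𝕊(ℂ) = ℂˣ × ℂˣ`: they are algebraic (the entries are polynomials in `z, w, z⁻¹, w⁻¹`) and commute
with the complex conjugations, the one of `𝕊(ℂ)` being `(z, w) ↦ (conj w, conj z)`, with real points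
`𝕊(ℝ) = {(z, conj z)}`. -/
structure IsDeligneHom {n : ℕ} (G : Subgroup (GL (Fin n) ℂ)) (h : ℂˣ × ℂˣ →* GL (Fin n) ℂ) :
    Prop where
  mem : ∀ x, h x ∈ G
  algebraic : ∀ i j, ∃ p : MvPolynomial (Fin 4) ℂ, ∀ z w : ℂˣ, (h (z, w)).1 i j =
    MvPolynomial.eval ![(z : ℂ), (w : ℂ), ((z⁻¹ : ℂˣ) : ℂ), ((w⁻¹ : ℂˣ) : ℂ)] p
  real : ∀ z w : ℂˣ, h (star w, star z) = conj (h (z, w))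

/-- The complex unit `i`. -/
def unitI : ℂˣ := Units.mk0 Complex.I Complex.I_ne_zero

/-- The point of `𝕊(ℝ)` that corresponds to `i ∈ ℂˣ`. -/
def deligneI : ℂˣ × ℂˣ := (unitI, star unitI)

/-- The stabilizer of `h` in the group of real points of `G`, acting by conjugation. -/
def stabilizer {n : ℕ} (G : Subgroup (GL (Fin n) ℂ)) (h : ℂˣ × ℂˣ →* GL (Fin n) ℂ) :
    Subgroup (GL (Fin n) ℂ) :=
  realPoints G ⊓ Subgroup.centralizer (Set.range h)

/-- The part of type `(p, q)` of the Lie algebra of `G` for the Hodge structure defined by `h`: there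
`h (z, w)` acts by `z ^ (-p) * w ^ (-q)`. -/
def hodgePart {n : ℕ} (G : Subgroup (GL (Fin n) ℂ)) (h : ℂˣ × ℂˣ →* GL (Fin n) ℂ) (p q : ℤ) :
    Set (Matrix (Fin n) (Fin n) ℂ) :=
  {Y | Y ∈ lieAlg G ∧ ∀ z w : ℂˣ, Ad (h (z, w)) Y = ((z ^ (-p) * w ^ (-q) : ℂˣ) : ℂ) • Y}

/-- `(G, X)` is a Shimura datum: `G` is a connected reductive group over `ℚ` and `X` is a
`G(ℝ)`-conjugacy class of homomorphisms `𝕊 → G_ℝ` satisfying Deligne's axioms. -/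
structure IsShimuraDatum {n : ℕ} (G : Subgroup (GL (Fin n) ℂ))
    (X : Set (ℂˣ × ℂˣ →* GL (Fin n) ℂ)) : Prop where
  rational : IsZariskiClosed ℚ (G : Set (GL (Fin n) ℂ))
  reductive : IsConnectedReductive G
  hom : ∀ h ∈ X, IsDeligneHom G h
  conjClass : ∃ h₀ ∈ X, X = {h | ∃ g ∈ realPoints G, ∀ x, h x = g * h₀ x * g⁻¹}
  /-- the Lie algebra of `G` has type `(-1, 1), (0, 0), (1, -1)` -/
  hodgeType : ∀ h ∈ X, ∀ Y ∈ lieAlg G, ∃ Y₁ ∈ hodgePart G h (-1) 1, ∃ Y₂ ∈ hodgePart G h 0 0,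
    ∃ Y₃ ∈ hodgePart G h 1 (-1), Y = Y₁ + Y₂ + Y₃
  /-- conjugation by `h(i)` is a Cartan involution of the adjoint group: the real form of
  `G(ℂ) ⧸ Z(ℂ)` given by the twisted conjugation `g ↦ h(i) * conj g * h(i)⁻¹` is compact -/
  cartan : ∀ h ∈ X, IsCompact ((fun g : G => (QuotientGroup.mk g : G ⧸ Subgroup.center G)) ''
    {g : G | ∃ c : Subgroup.center G,
      h deligneI * conj (g : GL (Fin n) ℂ) * (h deligneI)⁻¹ = ((g * c : G) : GL (Fin n) ℂ)})
  /-- the adjoint group has no nontrivial factor over `ℚ` on which the projection of `h` is trivial;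
  the kernels of the projections of `G` to the factors over `ℚ` of its adjoint group are the closed
  normal subgroups over `ℚ` that contain the centre -/
  noFactor : ∀ h ∈ X, ∀ N : Subgroup (GL (Fin n) ℂ), N ≤ G → (N.subgroupOf G).Normal →
    IsZariskiClosed ℚ (N : Set (GL (Fin n) ℂ)) → (Subgroup.center G).map G.subtype ≤ N →
    (∀ x, h x ∈ N) → N = G

/-- `X`, which is `G(ℝ)` modulo the stabilizer of any `h ∈ X`, has complex dimension `d`, that is, real
dimension `2 * d`. -/
def HasComplexDim {n : ℕ} (G : Subgroup (GL (Fin n) ℂ)) (X : Set (ℂˣ × ℂˣ →* GL (Fin n) ℂ))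
    (d : ℕ) : Prop :=
  ∀ h ∈ X, 2 * d + realDim (stabilizer G h) = realDim (realPoints G)

/-- `l` lies in the `G(ℂ)`-conjugacy class of the cocharacters `-μ_h`, `h ∈ X`, where
`μ_h (z) = h (z, 1)`. -/
def IsNegHodgeCochar {n : ℕ} (G : Subgroup (GL (Fin n) ℂ)) (X : Set (ℂˣ × ℂˣ →* GL (Fin n) ℂ))
    {T : Torus n} (l : cocharGroup T) : Prop :=
  ∃ h ∈ X, ∃ g ∈ G, ∀ z : ℂˣ, (l.1 z : GL (Fin n) ℂ) = g * (h (z, 1))⁻¹ * g⁻¹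

/-! ### The dual group -/

/-- The data that make `(G', T', P')` the dual group of `(G, T, P)`: an isomorphism from the root
datum of `G'` to the dual of the root datum of `G`, under which the roots in `P'` are the coroots of
the roots in `P`. -/
structure Duality {n m : ℕ} (G : Subgroup (GL (Fin n) ℂ)) (T : Torus n) (P : Set (charGroup T))
    (G' : Subgroup (GL (Fin m) ℂ)) (T' : Torus m) (P' : Set (charGroup T')) where
  /-- `X_*(T) ≃ X^*(T')` -/
  toChar : cocharGroup T ≃* charGroup T'
  /-- `X^*(T) ≃ X_*(T')` -/
  toCochar : charGroup T ≃* cocharGroup T'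
  pairing : ∀ χ l k, Pairing (toChar l) (toCochar χ) k ↔ Pairing χ l k
  roots_iff : ∀ l, toChar l ∈ roots G' T' ↔ l ∈ coroots G T
  coroots_iff : ∀ χ, toCochar χ ∈ coroots G' T' ↔ χ ∈ roots G T
  isCoroot_iff : ∀ χ l, IsCoroot G' T' (toChar l) (toCochar χ) ↔ IsCoroot G T χ l
  pos_iff : ∀ χ l, IsCoroot G T χ l → (toChar l ∈ P' ↔ χ ∈ P)

/-- The element `e = χ̂(-1)`, where `χ̂` is the sum of the positive coroots of `G'`, as an element of
`G'`. -/
def elementE {m : ℕ} (G' : Subgroup (GL (Fin m) ℂ)) (T' : Torus m) (P' : Set (charGroup T'))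
    (hT : T'.carrier ≤ G') : G' :=
  Subgroup.inclusion hT ((sumPosCoroots G' T' P').1 (-1))

/-! ### Representations -/

section Representations

variable {V : Type*} [AddCommGroup V] [Module ℂ V]

/-- A representation of a linear algebraic group is algebraic if its matrix coefficients are regular
functions. -/
def IsAlgebraicRep {m : ℕ} {H : Subgroup (GL (Fin m) ℂ)} (r : Representation ℂ H V) : Prop :=
  ∀ (v : V) (φ : Module.Dual ℂ V), IsRegular (fun g => φ (r g v))

/-- The weight space of the character `ν` of `T` in a representation of `H ≥ T`. -/
def weightSpace {m : ℕ} {H : Subgroup (GL (Fin m) ℂ)} {T : Torus m} (hT : T.carrier ≤ H)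
    (r : Representation ℂ H V) (ν : charGroup T) : Set V :=
  {v | ∀ t : T.carrier, r (Subgroup.inclusion hT t) v = ((ν.1 t : ℂˣ) : ℂ) • v}

/-- `ν` is a weight of `r`. -/
def IsWeight {m : ℕ} {H : Subgroup (GL (Fin m) ℂ)} {T : Torus m} (hT : T.carrier ≤ H)
    (r : Representation ℂ H V) (ν : charGroup T) : Prop :=
  ∃ v ∈ weightSpace hT r ν, v ≠ 0

/-- `ν` is an extreme weight of `r`: a vertex of the convex hull of the weights, that is, a weight at
which some cocharacter attains its minimum over the weights, at this weight only. -/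
def IsExtremeWeight {m : ℕ} {H : Subgroup (GL (Fin m) ℂ)} {T : Torus m} (hT : T.carrier ≤ H)
    (r : Representation ℂ H V) (ν : charGroup T) : Prop :=
  IsWeight hT r ν ∧ ∃ l : cocharGroup T, ∀ ν', IsWeight hT r ν' → ν' ≠ ν →
    ∃ k : ℤ, 0 < k ∧ Pairing (ν' * ν⁻¹) l k

end Representations

/-! ### The `C`-group -/

/-- An action of a group `Γ` on `G'` by algebraic automorphisms that preserve the maximal torus `T'`
and permute the positive roots, such as the Galois action on a dual group. -/
structure IsPinnedAction {m : ℕ} {G' : Subgroup (GL (Fin m) ℂ)} {T' : Torus m}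
    (P' : Set (charGroup T')) (hT : T'.carrier ≤ G') {Γ : Type*} [Group Γ] (act : Γ →* MulAut G') :
    Prop where
  algebraic : ∀ γ i j, IsRegular (fun g : G' => ((act γ g : G') : GL (Fin m) ℂ).1 i j)
  torus : ∀ γ, ∀ t : T'.carrier, ∃ t' : T'.carrier,
    act γ (Subgroup.inclusion hT t) = Subgroup.inclusion hT t'
  positive : ∀ γ, ∀ α ∈ P', ∃ β ∈ P', ∀ t t' : T'.carrier,
    act γ (Subgroup.inclusion hT t) = Subgroup.inclusion hT t' → β.1 t = α.1 t'

/-- The action of `Γ` on `H × ℂˣ` through an action on `H`. -/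
def prodAct {H Γ : Type*} [Group H] [Group Γ] (act : Γ →* MulAut H) : Γ →* MulAut (H × ℂˣ) where
  toFun γ := MulEquiv.prodCongr (act γ) (MulEquiv.refl ℂˣ)
  map_one' := by
    rw [map_one]
    rfl
  map_mul' γ γ' := by
    rw [map_mul]
    rfl

/-- The normal subgroup of `(H × ℂˣ) ⋊ Γ` generated by `(e, -1)`. If `e` is central in `H`, of order at
most `2` and fixed by `Γ`, it consists of `1` and `(e, -1)`. -/
def cKernel {H Γ : Type*} [Group H] [Group Γ] (act : Γ →* MulAut H) (e : H) :
    Subgroup ((H × ℂˣ) ⋊[prodAct act] Γ) :=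
  Subgroup.normalClosure {SemidirectProduct.inl (e, -1)}

instance {H Γ : Type*} [Group H] [Group Γ] (act : Γ →* MulAut H) (e : H) :
    (cKernel act e).Normal :=
  Subgroup.normalClosure_normal

/-- The `C`-group: the quotient of `(H × ℂˣ) ⋊ Γ` by `(e, -1)`, which is the semidirect product of `Γ`
with the quotient of `H × ℂˣ` by `(e, -1)`. Here `H` is the dual group of `G`, and the quotient of
`H × ℂˣ` is the dual group of the canonical extension of `G` by `GL₁`. -/
abbrev CGroup {H Γ : Type*} [Group H] [Group Γ] (act : Γ →* MulAut H) (e : H) : Type _ :=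
  ((H × ℂˣ) ⋊[prodAct act] Γ) ⧸ cKernel act e

/-- The class of `((g, z), γ)` in the `C`-group. -/
def CGroup.mk {H Γ : Type*} [Group H] [Group Γ] (act : Γ →* MulAut H) (e : H) (g : H) (z : ℂˣ)
    (γ : Γ) : CGroup act e :=
  QuotientGroup.mk ⟨(g, z), γ⟩

end ShimuraCGroup

end

/-!
A linear algebraic group `G` is studied through its Lie algebra `lieAlg G`, the set of the velocities
of its one-parameter subgroups. Three facts make this possible: `lieAlg G` is a complex Lie
subalgebra, described by left invariant derivations that preserve the vanishing ideal of `G`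
(`mem_lieAlg_iff_der`); it contains the semisimple and nilpotent parts of its elements
(`exists_jordan`); and a closed subgroup of a connected group with the same Lie algebra is the whole
group (`eq_of_lieAlg_le`), which follows from Krull's intersection theorem at the unit element.

For the group of a Shimura datum, `g ↦ h(i) conj(g) h(i)⁻¹` defines a compact real form of the adjoint
group, on which the Killing form is negative definite. Hence the quotient of the Lie algebra by its
centre has a nondegenerate Killing form (`IsShimuraDatum.isKilling`). The centralizer of a maximal
torus `T` in the Lie algebra is a Cartan subalgebra, whose elements are, by Jordan decomposition and
the maximality of `T`, elements of `Lie T` up to nilpotent ones (`Torus.isToralPair`). So the theory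
of Killing Lie algebras applies to the roots of `(G, T)`: root spaces are lines, the negative of a
root is a root, and proportional roots agree up to sign.

*The pairing of `χ` and `μ`.* The Hodge types show that a root pairs with `μ` to `-1`, `0` or `1`. By
antidominance the roots that pair to `-1` are positive, so `-⟨χ, μ⟩` is their number. As root spaces
are lines, this is the dimension of the subspace of weight `-1` for `μ`, a conjugate of the part
`𝔤^(-1,1)`; and the real Lie algebra of `G` is that of the stabilizer of `h` plus a copy of
`𝔤^(-1,1)`, so that this dimension is `d` (`pair_sumPosRoots_eq`).

*The element `e`.* Under duality the sum of the positive coroots of the dual group is `χ`, and a root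
of the dual group is a coroot `l` of `G`, so its value at `e` is `(-1) ^ ⟨χ, l⟩`. Up to signs, the
reflection that belongs to `l` permutes the positive roots without changing the parity of their
pairings with `l`, and the roots that it fixes up to sign pair evenly with `l`. Hence `⟨χ, l⟩` is even
(`even_pair_sumPosRoots`), all roots are trivial on `e`, and the centralizer of `e` has the full Lie
algebra: `e` is central. By Schur's lemma `e` acts as a scalar, which is its value
`(-1) ^ ⟨χ, μ⟩ = (-1) ^ d` on the weight space of `μ`.

*The `C`-group.* The group `Γ` permutes the positive coroots, so it fixes `e`. The representation
`((g, z), γ) ↦ z ^ (-d) * rL (g, γ)` is trivial on `(e, -1)` and descends to the `C`-group. A second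
extension differs from it, on each element of `Γ`, by an operator that commutes with `r` and fixes a
weight vector of `μ`; by Schur's lemma it is the identity (`rep_CGroup_eq`).
-/

noncomputable section

namespace ShimuraCGroup

attribute [local instance 100] LieRing.ofAssociativeRing

/-! ### Exponentials of matrices and invariant derivations -/

/-- The ring of polynomials in the entries of an `n × n` matrix. -/
abbrev MatPoly (n : ℕ) : Type := MvPolynomial (Fin n × Fin n) ℂ

/-- The value of a polynomial in the entries at a matrix. -/
def ev {n : ℕ} (g : Matrix (Fin n) (Fin n) ℂ) : MatPoly n →ₐ[ℂ] ℂ :=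
  MvPolynomial.aeval (fun p : Fin n × Fin n => g p.1 p.2)

@[simp] theorem ev_X {n : ℕ} (g : Matrix (Fin n) (Fin n) ℂ) (p : Fin n × Fin n) :
    ev g (MvPolynomial.X p) = g p.1 p.2 := by
  simp [ev]

theorem isZariskiClosed_iff {n : ℕ} {S : Set (GL (Fin n) ℂ)} :
    IsZariskiClosed ℂ S ↔ ∃ F : Set (MatPoly n), S = {g | ∀ f ∈ F, ev g.1 f = 0} := Iff.rfl

/-- The derivation of the polynomial ring given by the left invariant vector field `X`, that is,
the derivative along `t ↦ g * exp (t X)`. -/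
def leftInvDer {n : ℕ} (X : Matrix (Fin n) (Fin n) ℂ) : Derivation ℂ (MatPoly n) (MatPoly n) :=
  MvPolynomial.mkDerivation ℂ fun p => ∑ k, X k p.2 • MvPolynomial.X (p.1, k)

@[simp] theorem leftInvDer_X {n : ℕ} (X : Matrix (Fin n) (Fin n) ℂ) (p : Fin n × Fin n) :
    leftInvDer X (MvPolynomial.X p) = ∑ k, X k p.2 • MvPolynomial.X (p.1, k) := by
  simp [leftInvDer]

theorem leftInvDer_add {n : ℕ} (X Y : Matrix (Fin n) (Fin n) ℂ) :
    leftInvDer (X + Y) = leftInvDer X + leftInvDer Y := by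
  apply MvPolynomial.derivation_ext
  intro p
  simp [add_smul, Finset.sum_add_distrib]

theorem leftInvDer_smul {n : ℕ} (c : ℂ) (X : Matrix (Fin n) (Fin n) ℂ) :
    leftInvDer (c • X) = c • leftInvDer X := by
  apply MvPolynomial.derivation_ext
  intro p
  simp [mul_smul, Finset.smul_sum]

/-- `leftInvDer` as a linear map. -/
def leftInvDerₗ (n : ℕ) :
    Matrix (Fin n) (Fin n) ℂ →ₗ[ℂ] Derivation ℂ (MatPoly n) (MatPoly n) where
  toFun := leftInvDer
  map_add' := leftInvDer_add
  map_smul' := leftInvDer_smul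

theorem leftInvDer_comp_X {n : ℕ} (X Y : Matrix (Fin n) (Fin n) ℂ) (p : Fin n × Fin n) :
    leftInvDer X (leftInvDer Y (MvPolynomial.X p)) =
      ∑ k, (X * Y) k p.2 • MvPolynomial.X (p.1, k) := by
  simp only [leftInvDer_X, map_sum, Derivation.map_smul, Matrix.mul_apply, Finset.sum_smul,
    Finset.smul_sum, smul_smul]
  rw [Finset.sum_comm]
  refine Finset.sum_congr rfl fun k _ => Finset.sum_congr rfl fun l _ => ?_
  rw [mul_comm]

theorem leftInvDer_lie {n : ℕ} (X Y : Matrix (Fin n) (Fin n) ℂ) :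
    leftInvDer ⁅X, Y⁆ = ⁅leftInvDer X, leftInvDer Y⁆ := by
  apply MvPolynomial.derivation_ext
  intro p
  rw [Derivation.commutator_apply, leftInvDer_comp_X, leftInvDer_comp_X, leftInvDer_X,
    Ring.lie_def, ← Finset.sum_sub_distrib]
  exact Finset.sum_congr rfl fun k _ => by rw [Matrix.sub_apply, sub_smul]

theorem exp_add_smul {n : ℕ} (X : Matrix (Fin n) (Fin n) ℂ) (s t : ℂ) :
    NormedSpace.exp ((s + t) • X) = NormedSpace.exp (s • X) * NormedSpace.exp (t • X) := by
  rw [add_smul, Matrix.exp_add_of_commute]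
  exact ((Commute.refl X).smul_left s).smul_right t

theorem exp_mul_exp_neg {n : ℕ} (X : Matrix (Fin n) (Fin n) ℂ) :
    NormedSpace.exp X * NormedSpace.exp (-X) = 1 := by
  rw [← Matrix.exp_add_of_commute _ _ (Commute.refl X).neg_right, add_neg_cancel,
    NormedSpace.exp_zero]

/-- The exponential of a matrix as an element of `GL n ℂ`. -/
def expGL {n : ℕ} (X : Matrix (Fin n) (Fin n) ℂ) : GL (Fin n) ℂ where
  val := NormedSpace.exp X
  inv := NormedSpace.exp (-X)
  val_inv := exp_mul_exp_neg X
  inv_val := by simpa using exp_mul_exp_neg (-X)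

@[simp] theorem expGL_val {n : ℕ} (X : Matrix (Fin n) (Fin n) ℂ) :
    (expGL X : Matrix (Fin n) (Fin n) ℂ) = NormedSpace.exp X := rfl

theorem expGL_inv {n : ℕ} (X : Matrix (Fin n) (Fin n) ℂ) : (expGL X)⁻¹ = expGL (-X) :=
  Units.ext rfl

theorem expGL_zero {n : ℕ} : expGL (0 : Matrix (Fin n) (Fin n) ℂ) = 1 :=
  Units.ext (by simp)

theorem expGL_add_smul {n : ℕ} (X : Matrix (Fin n) (Fin n) ℂ) (s t : ℂ) :
    expGL ((s + t) • X) = expGL (s • X) * expGL (t • X) :=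
  Units.ext (exp_add_smul X s t)

theorem hasDerivAt_exp_entry {n : ℕ} (X : Matrix (Fin n) (Fin n) ℂ) (i j : Fin n) (t : ℂ) :
    HasDerivAt (fun t : ℂ => (NormedSpace.exp (t • X) : Matrix (Fin n) (Fin n) ℂ) i j)
      ((NormedSpace.exp (t • X) * X) i j) t := by
  let _ : NormedRing (Matrix (Fin n) (Fin n) ℂ) := Matrix.linftyOpNormedRing
  let _ : NormedAlgebra ℂ (Matrix (Fin n) (Fin n) ℂ) := Matrix.linftyOpNormedAlgebra
  have h := hasDerivAt_exp_smul_const (𝕂 := ℂ) X t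
  have h1 := (LinearMap.toContinuousLinearMap
    (Matrix.entryLinearMap ℂ ℂ i j)).hasFDerivAt.comp_hasDerivAt t h
  exact h1

theorem hasDerivAt_ev_exp {n : ℕ} (X g : Matrix (Fin n) (Fin n) ℂ) (f : MatPoly n) (t : ℂ) :
    HasDerivAt (fun t : ℂ => ev (g * NormedSpace.exp (t • X)) f)
      (ev (g * NormedSpace.exp (t • X)) (leftInvDer X f)) t := by
  induction f using MvPolynomial.induction_on with
  | C a =>
    have : (MvPolynomial.C a : MatPoly n) = algebraMap ℂ _ a := rfl
    simp only [this, AlgHom.commutes, Derivation.map_algebraMap, map_zero]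
    exact hasDerivAt_const t _
  | add p q hp hq =>
    simp only [map_add]
    exact hp.add hq
  | mul_X p q hp =>
    simp only [Derivation.leibniz, map_add, smul_eq_mul, map_mul]
    have h1 : HasDerivAt (fun t : ℂ => ev (g * NormedSpace.exp (t • X)) (MvPolynomial.X q))
        (ev (g * NormedSpace.exp (t • X)) (leftInvDer X (MvPolynomial.X q))) t := by
      simp only [ev_X, leftInvDer_X, map_sum, map_smul, Matrix.mul_apply (M := g)]
      have h2 := HasDerivAt.fun_sum (u := Finset.univ) fun k _ =>
        (hasDerivAt_exp_entry X k q.2 t).const_mul (g q.1 k)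
      refine h2.congr_deriv ?_
      simp only [Matrix.mul_apply (N := X), Finset.mul_sum, smul_eq_mul]
      rw [Finset.sum_comm]
      refine Finset.sum_congr rfl fun k _ => Finset.sum_congr rfl fun l _ => ?_
      ring
    refine (hp.mul h1).congr_deriv ?_
    ring

/-! ### The Lie algebra of a Zariski closed subgroup -/

/-- The ideal of the polynomials in the entries that vanish on `S`. -/
def vanIdeal {n : ℕ} (S : Set (GL (Fin n) ℂ)) : Ideal (MatPoly n) where
  carrier := {f | ∀ g ∈ S, ev g.1 f = 0}
  add_mem' := by
    intro a b ha hb g hg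
    rw [map_add, ha g hg, hb g hg, add_zero]
  zero_mem' := fun g _ => map_zero _
  smul_mem' := by
    intro c f hf g hg
    rw [smul_eq_mul, map_mul, hf g hg, mul_zero]

theorem IsZariskiClosed.mem_iff {n : ℕ} {S : Set (GL (Fin n) ℂ)} (hS : IsZariskiClosed ℂ S)
    {g : GL (Fin n) ℂ} : g ∈ S ↔ ∀ f ∈ vanIdeal S, ev g.1 f = 0 := by
  obtain ⟨F, hF⟩ := isZariskiClosed_iff.1 hS
  refine ⟨fun hg f hf => hf g hg, fun h => ?_⟩
  rw [hF]
  intro f hf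
  refine h f fun g' hg' => ?_
  rw [hF] at hg'
  exact hg' f hf

theorem isZariskiClosed_setOf {n : ℕ} (F : Set (MatPoly n)) :
    IsZariskiClosed ℂ {g : GL (Fin n) ℂ | ∀ f ∈ F, ev g.1 f = 0} := ⟨F, rfl⟩

theorem IsZariskiClosed.inter {n : ℕ} {S S' : Set (GL (Fin n) ℂ)} (hS : IsZariskiClosed ℂ S)
    (hS' : IsZariskiClosed ℂ S') : IsZariskiClosed ℂ (S ∩ S') := by
  obtain ⟨F, rfl⟩ := isZariskiClosed_iff.1 hS
  obtain ⟨F', rfl⟩ := isZariskiClosed_iff.1 hS'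
  refine isZariskiClosed_iff.2 ⟨F ∪ F', ?_⟩
  ext g
  constructor
  · rintro ⟨h1, h2⟩ f (hf | hf)
    exacts [h1 f hf, h2 f hf]
  · intro h
    exact ⟨fun f hf => h f (Or.inl hf), fun f hf => h f (Or.inr hf)⟩

theorem leftInvDer_mem_vanIdeal {n : ℕ} {G : Subgroup (GL (Fin n) ℂ)}
    {X : Matrix (Fin n) (Fin n) ℂ} (hX : X ∈ lieAlg G) {f : MatPoly n}
    (hf : f ∈ vanIdeal (G : Set (GL (Fin n) ℂ))) :
    leftInvDer X f ∈ vanIdeal (G : Set (GL (Fin n) ℂ)) := by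
  intro g hg
  have h1 := (hasDerivAt_ev_exp X g.1 f ((0 : ℝ) : ℂ)).comp_ofReal
  have h2 : (fun t : ℝ => ev (g.1 * NormedSpace.exp ((t : ℂ) • X)) f) = fun _ => 0 := by
    funext t
    obtain ⟨g', hg', h⟩ := hX t
    rw [Complex.coe_smul, ← h, ← Units.val_mul]
    exact hf _ (mul_mem hg hg')
  rw [h2] at h1
  have h3 := h1.unique (hasDerivAt_const _ _)
  simpa using h3

/-- Translation on the polynomial ring: `translate g f` is the function `x ↦ f (g x)`. -/
def translate {n : ℕ} (g : Matrix (Fin n) (Fin n) ℂ) : MatPoly n →ₐ[ℂ] MatPoly n :=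
  MvPolynomial.aeval fun p => ∑ k, g p.1 k • MvPolynomial.X (k, p.2)

theorem ev_translate {n : ℕ} (g x : Matrix (Fin n) (Fin n) ℂ) (f : MatPoly n) :
    ev x (translate g f) = ev (g * x) f := by
  have h : (ev x).comp (translate g) = ev (g * x) := by
    apply MvPolynomial.algHom_ext
    intro p
    simp [translate, Matrix.mul_apply]
  exact DFunLike.congr_fun h f

/-- The Zariski tangent space at `1` is the Lie algebra: infinitesimal vanishing at `1` of the
equations suffices. -/
theorem mem_lieAlg_of_tangent {n : ℕ} {G : Subgroup (GL (Fin n) ℂ)}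
    (hG : IsZariskiClosed ℂ (G : Set (GL (Fin n) ℂ))) {X : Matrix (Fin n) (Fin n) ℂ}
    (hX : ∀ f ∈ vanIdeal (G : Set (GL (Fin n) ℂ)), ev 1 (leftInvDer X f) = 0) :
    ∀ z : ℂ, expGL (z • X) ∈ G := by
  have hD : ∀ f ∈ vanIdeal (G : Set (GL (Fin n) ℂ)),
      leftInvDer X f ∈ vanIdeal (G : Set (GL (Fin n) ℂ)) := by
    intro f hf g hg
    have h1 : translate g.1 f ∈ vanIdeal (G : Set (GL (Fin n) ℂ)) := by
      intro x hx
      rw [ev_translate, ← Units.val_mul]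
      exact hf _ (mul_mem hg hx)
    have h2 := hX _ h1
    have h3 := hasDerivAt_ev_exp X 1 (translate g.1 f) 0
    have h4 := hasDerivAt_ev_exp X g.1 f 0
    simp only [ev_translate, one_mul] at h3
    have h5 := h3.unique h4
    simp only [zero_smul, NormedSpace.exp_zero, mul_one] at h5
    rw [← h5, h2]
  have key : ∀ f : MatPoly n, ∀ k : ℕ,
      iteratedDeriv k (fun t : ℂ => ev (NormedSpace.exp (t • X)) f) =
        fun t : ℂ => ev (NormedSpace.exp (t • X)) ((leftInvDer X)^[k] f) := by
    intro f k
    induction k with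
    | zero => simp
    | succ k ih =>
      rw [iteratedDeriv_succ, ih]
      funext t
      have h := (hasDerivAt_ev_exp X 1 ((leftInvDer X)^[k] f) t).deriv
      simp only [one_mul] at h
      rw [h, Function.iterate_succ_apply']
  intro z
  change _ ∈ (G : Set (GL (Fin n) ℂ))
  rw [hG.mem_iff]
  intro f hf
  have hdiff : Differentiable ℂ (fun t : ℂ => ev (NormedSpace.exp (t • X)) f) := by
    intro t
    have h := (hasDerivAt_ev_exp X 1 f t).differentiableAt
    simpa only [one_mul] using h
  have hT := Complex.taylorSeries_eq_of_entire hdiff 0 z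
  have hmem : ∀ k : ℕ, (leftInvDer X)^[k] f ∈ vanIdeal (G : Set (GL (Fin n) ℂ)) := by
    intro k
    induction k with
    | zero => exact hf
    | succ k ih =>
      rw [Function.iterate_succ_apply']
      exact hD _ ih
  rw [expGL_val, ← hT]
  convert tsum_zero with k
  rw [key]
  have h0 : ev (1 : Matrix (Fin n) (Fin n) ℂ) ((leftInvDer X)^[k] f) = 0 :=
    hmem k 1 (one_mem G)
  simp [h0]

theorem mem_lieAlg_iff_exp {n : ℕ} {G : Subgroup (GL (Fin n) ℂ)} {X : Matrix (Fin n) (Fin n) ℂ} :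
    X ∈ lieAlg G ↔ ∀ t : ℝ, expGL (t • X) ∈ G := by
  refine forall_congr' fun t => ⟨?_, fun h => ⟨_, h, rfl⟩⟩
  rintro ⟨g, hg, h⟩
  have : g = expGL (t • X) := Units.ext h
  exact this ▸ hg

theorem mem_lieAlg_iff_tangent {n : ℕ} {G : Subgroup (GL (Fin n) ℂ)}
    (hG : IsZariskiClosed ℂ (G : Set (GL (Fin n) ℂ))) {X : Matrix (Fin n) (Fin n) ℂ} :
    X ∈ lieAlg G ↔ ∀ f ∈ vanIdeal (G : Set (GL (Fin n) ℂ)), ev 1 (leftInvDer X f) = 0 := by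
  refine ⟨fun h f hf => leftInvDer_mem_vanIdeal h hf 1 (one_mem G), fun h => ?_⟩
  rw [mem_lieAlg_iff_exp]
  intro t
  simpa using mem_lieAlg_of_tangent hG h t

theorem expGL_mem {n : ℕ} {G : Subgroup (GL (Fin n) ℂ)}
    (hG : IsZariskiClosed ℂ (G : Set (GL (Fin n) ℂ))) {X : Matrix (Fin n) (Fin n) ℂ}
    (hX : X ∈ lieAlg G) (z : ℂ) : expGL (z • X) ∈ G :=
  mem_lieAlg_of_tangent hG ((mem_lieAlg_iff_tangent hG).1 hX) z

theorem mem_lieAlg_iff_der {n : ℕ} {G : Subgroup (GL (Fin n) ℂ)}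
    (hG : IsZariskiClosed ℂ (G : Set (GL (Fin n) ℂ))) {X : Matrix (Fin n) (Fin n) ℂ} :
    X ∈ lieAlg G ↔ ∀ f ∈ vanIdeal (G : Set (GL (Fin n) ℂ)),
      leftInvDer X f ∈ vanIdeal (G : Set (GL (Fin n) ℂ)) :=
  ⟨fun h _ hf => leftInvDer_mem_vanIdeal h hf,
    fun h => (mem_lieAlg_iff_tangent hG).2 fun f hf => h f hf 1 (one_mem G)⟩

/-- The Lie algebra of a Zariski closed subgroup of `GL n ℂ`, as a complex Lie subalgebra of the
matrices. -/
def lieSub {n : ℕ} (G : Subgroup (GL (Fin n) ℂ))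
    (hG : IsZariskiClosed ℂ (G : Set (GL (Fin n) ℂ))) :
    LieSubalgebra ℂ (Matrix (Fin n) (Fin n) ℂ) where
  carrier := lieAlg G
  add_mem' := by
    intro X Y hX hY
    rw [mem_lieAlg_iff_der hG] at *
    intro f hf
    rw [leftInvDer_add]
    exact add_mem (hX f hf) (hY f hf)
  zero_mem' := by
    rw [mem_lieAlg_iff_exp]
    intro t
    rw [smul_zero, expGL_zero]
    exact one_mem G
  smul_mem' := by
    intro c X hX
    rw [mem_lieAlg_iff_tangent hG] at *
    intro f hf
    rw [leftInvDer_smul, Derivation.smul_apply, map_smul, hX f hf, smul_zero]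
  lie_mem' := by
    intro X Y hX hY
    rw [mem_lieAlg_iff_der hG]
    intro f hf
    rw [leftInvDer_lie, Derivation.commutator_apply]
    exact sub_mem ((mem_lieAlg_iff_der hG).1 hX _ ((mem_lieAlg_iff_der hG).1 hY f hf))
      ((mem_lieAlg_iff_der hG).1 hY _ ((mem_lieAlg_iff_der hG).1 hX f hf))

theorem conj_expGL {n : ℕ} (g : GL (Fin n) ℂ) (X : Matrix (Fin n) (Fin n) ℂ) :
    g * expGL X * g⁻¹ = expGL (Ad g X) := by
  apply Units.ext
  rw [Units.val_mul, Units.val_mul, expGL_val, expGL_val]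
  exact (Matrix.exp_units_conj g X).symm

theorem Ad_smul {n : ℕ} (g : GL (Fin n) ℂ) (c : ℂ) (X : Matrix (Fin n) (Fin n) ℂ) :
    Ad g (c • X) = c • Ad g X := by
  simp [Ad]

theorem Ad_add {n : ℕ} (g : GL (Fin n) ℂ) (X Y : Matrix (Fin n) (Fin n) ℂ) :
    Ad g (X + Y) = Ad g X + Ad g Y := by
  simp [Ad, mul_add, add_mul]

theorem Ad_mul {n : ℕ} (g g' : GL (Fin n) ℂ) (X : Matrix (Fin n) (Fin n) ℂ) :
    Ad (g * g') X = Ad g (Ad g' X) := by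
  simp [Ad, mul_assoc]

theorem Ad_one {n : ℕ} (X : Matrix (Fin n) (Fin n) ℂ) : Ad 1 X = X := by
  simp [Ad]

/-- `Ad g` as a linear map. -/
def Adₗ {n : ℕ} (g : GL (Fin n) ℂ) :
    Matrix (Fin n) (Fin n) ℂ →ₗ[ℂ] Matrix (Fin n) (Fin n) ℂ where
  toFun := Ad g
  map_add' := Ad_add g
  map_smul' := Ad_smul g

@[simp] theorem Adₗ_apply {n : ℕ} (g : GL (Fin n) ℂ) (X : Matrix (Fin n) (Fin n) ℂ) :
    Adₗ g X = Ad g X := rfl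

theorem Ad_lie {n : ℕ} (g : GL (Fin n) ℂ) (X Y : Matrix (Fin n) (Fin n) ℂ) :
    Ad g ⁅X, Y⁆ = ⁅Ad g X, Ad g Y⁆ := by
  have h : ∀ A B : Matrix (Fin n) (Fin n) ℂ, Ad g (A * B) = Ad g A * Ad g B := by
    intro A B
    simp only [Ad, mul_assoc]
    rw [← mul_assoc (g⁻¹).1 g.1, ← Units.val_mul, inv_mul_cancel, Units.val_one, one_mul]
  rw [Ring.lie_def, Ring.lie_def, ← h, ← h]
  exact map_sub (Adₗ g) _ _

theorem Ad_mem_lieAlg {n : ℕ} {G : Subgroup (GL (Fin n) ℂ)} {g : GL (Fin n) ℂ} (hg : g ∈ G)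
    {X : Matrix (Fin n) (Fin n) ℂ} (hX : X ∈ lieAlg G) : Ad g X ∈ lieAlg G := by
  rw [mem_lieAlg_iff_exp] at *
  intro t
  have h : t • Ad g X = Ad g (t • X) := by
    rw [← Complex.coe_smul, ← Complex.coe_smul, Ad_smul]
  rw [h, ← conj_expGL]
  exact mul_mem (mul_mem hg (hX t)) (inv_mem hg)

/-! ### A connected group is determined by its Lie algebra -/

/-- The ideal of the identity matrix. -/
def idealOne (n : ℕ) : Ideal (MatPoly n) := RingHom.ker (ev (1 : Matrix (Fin n) (Fin n) ℂ))

theorem mem_idealOne {n : ℕ} {f : MatPoly n} : f ∈ idealOne n ↔ ev 1 f = 0 := Iff.rfl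

/-- The entry `p`, shifted so as to vanish at the identity matrix. -/
def entryAtOne {n : ℕ} (p : Fin n × Fin n) : MatPoly n :=
  MvPolynomial.X p - MvPolynomial.C ((1 : Matrix (Fin n) (Fin n) ℂ) p.1 p.2)

theorem ev_C {n : ℕ} (g : Matrix (Fin n) (Fin n) ℂ) (c : ℂ) :
    ev g (MvPolynomial.C c) = c := (ev g).commutes c

theorem entryAtOne_mem {n : ℕ} (p : Fin n × Fin n) : entryAtOne p ∈ idealOne n := by
  rw [mem_idealOne, entryAtOne, map_sub, ev_X, ev_C, sub_self]

theorem sub_C_mem_idealOne {n : ℕ} (f : MatPoly n) :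
    f - MvPolynomial.C (ev 1 f) ∈ idealOne n := by
  rw [mem_idealOne, map_sub, ev_C, sub_self]

/-- The derivative of `f` at the identity matrix, as a linear functional. -/
def derAtOne {n : ℕ} (f : MatPoly n) : Module.Dual ℂ (Matrix (Fin n) (Fin n) ℂ) where
  toFun X := ev 1 (leftInvDer X f)
  map_add' X Y := by rw [leftInvDer_add, Derivation.add_apply, map_add]
  map_smul' c X := by rw [leftInvDer_smul, Derivation.smul_apply, map_smul]; rfl

theorem derAtOne_apply {n : ℕ} (f : MatPoly n) (X : Matrix (Fin n) (Fin n) ℂ) :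
    derAtOne f X = ev 1 (leftInvDer X f) := rfl

theorem derAtOne_X {n : ℕ} (p : Fin n × Fin n) (X : Matrix (Fin n) (Fin n) ℂ) :
    derAtOne (MvPolynomial.X p) X = X p.1 p.2 := by
  rw [derAtOne_apply, leftInvDer_X, map_sum]
  simp [Matrix.one_apply]

/-- The matrix unit with index `p`. -/
def unitMat {n : ℕ} (p : Fin n × Fin n) : Matrix (Fin n) (Fin n) ℂ := Matrix.single p.1 p.2 1

/-- First order Taylor expansion at the identity matrix. -/
theorem taylor_at_one {n : ℕ} (f : MatPoly n) :
    f - MvPolynomial.C (ev 1 f) -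
      ∑ p, entryAtOne p * MvPolynomial.C (derAtOne f (unitMat p)) ∈ idealOne n ^ 2 := by
  induction f using MvPolynomial.induction_on with
  | C a =>
    have h : ∀ X, derAtOne (MvPolynomial.C a : MatPoly n) X = 0 := by
      intro X
      have : (MvPolynomial.C a : MatPoly n) = algebraMap ℂ _ a := rfl
      rw [derAtOne_apply, this, Derivation.map_algebraMap, map_zero]
    simp [h]
  | add f g hf hg =>
    have h : ∀ X, derAtOne (f + g) X = derAtOne f X + derAtOne g X := by
      intro X
      simp only [derAtOne_apply, map_add]
    simp only [h, map_add, mul_add, Finset.sum_add_distrib]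
    convert add_mem hf hg using 1
    ring
  | mul_X f q hf =>
    have h : ∀ X, derAtOne (f * MvPolynomial.X q) X =
        ev 1 f * X q.1 q.2 + (1 : Matrix (Fin n) (Fin n) ℂ) q.1 q.2 * derAtOne f X := by
      intro X
      rw [← derAtOne_X q X]
      simp only [derAtOne_apply, Derivation.leibniz, map_add, smul_eq_mul, map_mul, ev_X]
    have hu : ∀ p : Fin n × Fin n, unitMat p q.1 q.2 = if p = q then 1 else 0 := by
      intro p
      rw [unitMat, Matrix.single_apply]
      simp only [Prod.ext_iff]
    have h2 : ∑ p, entryAtOne p * MvPolynomial.C (derAtOne (f * MvPolynomial.X q) (unitMat p)) =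
        entryAtOne q * MvPolynomial.C (ev 1 f) +
          MvPolynomial.C ((1 : Matrix (Fin n) (Fin n) ℂ) q.1 q.2) *
            ∑ p, entryAtOne p * MvPolynomial.C (derAtOne f (unitMat p)) := by
      simp only [h, hu, map_add, map_mul, mul_add, Finset.sum_add_distrib, Finset.mul_sum]
      congr 1
      · simp
      · exact Finset.sum_congr rfl fun p _ => by ring
    have h3 : (∑ p, entryAtOne p * MvPolynomial.C (derAtOne f (unitMat p))) * entryAtOne q ∈
        idealOne n ^ 2 := by
      rw [pow_two]
      exact Ideal.mul_mem_mul
        (sum_mem fun p _ => Ideal.mul_mem_right _ _ (entryAtOne_mem p)) (entryAtOne_mem q)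
    rw [h2]
    convert add_mem (Ideal.mul_mem_right (MvPolynomial.X q) _ hf) h3 using 1
    simp only [map_mul, ev_X, entryAtOne]
    ring

/-- Since the Lie algebra is the Zariski tangent space, every linear functional that vanishes on it
is the derivative of an equation. -/
theorem exists_derAtOne_eq {n : ℕ} {G : Subgroup (GL (Fin n) ℂ)}
    (hG : IsZariskiClosed ℂ (G : Set (GL (Fin n) ℂ)))
    (φ : Module.Dual ℂ (Matrix (Fin n) (Fin n) ℂ)) (hφ : ∀ X ∈ lieAlg G, φ X = 0) :
    ∃ f ∈ vanIdeal (G : Set (GL (Fin n) ℂ)), derAtOne f = φ := by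
  let Φ : MatPoly n →ₗ[ℂ] Module.Dual ℂ (Matrix (Fin n) (Fin n) ℂ) :=
    { toFun := derAtOne
      map_add' := fun f g => by ext1 X; simp [derAtOne_apply]
      map_smul' := fun c f => by ext1 X; simp [derAtOne_apply] }
  let W := ((vanIdeal (G : Set (GL (Fin n) ℂ))).restrictScalars ℂ).map Φ
  have h1 : φ ∈ W.dualCoannihilator.dualAnnihilator := by
    rw [Submodule.mem_dualAnnihilator]
    intro X hX
    apply hφ
    rw [mem_lieAlg_iff_tangent hG]
    intro f hf
    rw [Submodule.mem_dualCoannihilator] at hX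
    exact hX _ (Submodule.mem_map_of_mem hf)
  rw [Subspace.dualCoannihilator_dualAnnihilator_eq] at h1
  obtain ⟨f, hf, h⟩ := h1
  exact ⟨f, hf, h⟩

/-- An Euler vector field along `G`: a combination of the left invariant derivations in the Lie
algebra of `G` which acts on the cotangent space of `G` at `1` as the identity. -/
theorem exists_euler {n : ℕ} {G : Subgroup (GL (Fin n) ℂ)}
    (hG : IsZariskiClosed ℂ (G : Set (GL (Fin n) ℂ))) :
    ∃ Y : Fin n × Fin n → Matrix (Fin n) (Fin n) ℂ, (∀ p, Y p ∈ lieAlg G) ∧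
      ∀ a ∈ idealOne n, (∑ p, entryAtOne p • leftInvDer (Y p)) a - a ∈
        idealOne n ^ 2 ⊔ vanIdeal (G : Set (GL (Fin n) ℂ)) := by
  obtain ⟨π, hπ⟩ := LinearMap.exists_leftInverse_of_injective
    (lieSub G hG).toSubmodule.subtype (Submodule.ker_subtype _)
  refine ⟨fun p => π (unitMat p), fun p => (π (unitMat p)).2, fun a ha => ?_⟩
  obtain ⟨f, hf, hfa⟩ := exists_derAtOne_eq hG
    (derAtOne a - derAtOne a ∘ₗ (lieSub G hG).toSubmodule.subtype ∘ₗ π) (by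
      intro X hX
      have h : π X = ⟨X, hX⟩ := LinearMap.congr_fun hπ ⟨X, hX⟩
      simp [h])
  have h1 := taylor_at_one a
  have h2 := taylor_at_one f
  rw [mem_idealOne.1 ha, map_zero, sub_zero] at h1
  have hf1 : ev 1 f = 0 := hf 1 (one_mem G)
  rw [hf1, map_zero, sub_zero] at h2
  have h3 : ∑ p, entryAtOne p * (leftInvDer (π (unitMat p) : Matrix (Fin n) (Fin n) ℂ) a -
      MvPolynomial.C (derAtOne a (π (unitMat p)))) ∈ idealOne n ^ 2 := by
    rw [pow_two]
    exact sum_mem fun p _ => Ideal.mul_mem_mul (entryAtOne_mem p) (sub_C_mem_idealOne _)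
  have h4 : ∑ p, entryAtOne p * MvPolynomial.C (derAtOne f (unitMat p)) =
      ∑ p, entryAtOne p * MvPolynomial.C (derAtOne a (unitMat p)) -
      ∑ p, entryAtOne p * MvPolynomial.C (derAtOne a (π (unitMat p))) := by
    rw [← Finset.sum_sub_distrib]
    refine Finset.sum_congr rfl fun p _ => ?_
    rw [← mul_sub, hfa, ← map_sub]
    rfl
  have h5 : (∑ p, entryAtOne p • leftInvDer (π (unitMat p) : Matrix (Fin n) (Fin n) ℂ)) a =
      ∑ p, entryAtOne p * leftInvDer (π (unitMat p) : Matrix (Fin n) (Fin n) ℂ) a := by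
    rw [← Derivation.coeFnAddMonoidHom_apply, map_sum, Finset.sum_apply]
    rfl
  rw [h5]
  simp only [mul_sub, Finset.sum_sub_distrib] at h3
  have h6 := sub_mem (add_mem h3 h2) h1
  convert sub_mem (Ideal.mem_sup_left h6) (Ideal.mem_sup_right hf) using 1
  rw [h4]
  ring

theorem mem_sup_of_mem_sup_mul {A : Type*} [CommRing A] {J K I : Ideal A} {x : A}
    (h : x ∈ J ⊔ K * I) : x ∈ J ⊔ I := by
  have h1 : J ⊔ K * I ≤ J ⊔ I := sup_le_sup le_rfl Ideal.mul_le_right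
  exact h1 h

/-- The Euler vector field acts on the `k`-th power of the ideal of `1` as `k`, modulo the next
power. -/
theorem euler_pow {R A : Type*} [CommRing R] [CommRing A] [Algebra R A] (E : Derivation R A A)
    (m I : Ideal A) (hI : ∀ f ∈ I, E f ∈ I) (hEm : ∀ f, E f ∈ m)
    (hm : ∀ a ∈ m, E a - a ∈ m ^ 2 ⊔ I) (k : ℕ) :
    ∀ f ∈ m ^ k ⊔ I, E f - k * f ∈ m ^ (k + 1) ⊔ I := by
  induction k with
  | zero =>
    intro f _
    rw [Nat.cast_zero, zero_mul, sub_zero, zero_add, pow_one]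
    exact Ideal.mem_sup_left (hEm f)
  | succ k ih =>
    intro f hf
    obtain ⟨u, hu, v, hv, rfl⟩ := Submodule.mem_sup.1 hf
    have hv' : E v - ((k + 1 : ℕ) : A) * v ∈ m ^ (k + 1 + 1) ⊔ I :=
      Ideal.mem_sup_right (sub_mem (hI v hv) (Ideal.mul_mem_left _ _ hv))
    suffices hu' : E u - ((k + 1 : ℕ) : A) * u ∈ m ^ (k + 1 + 1) ⊔ I by
      convert add_mem hu' hv' using 1
      rw [map_add]
      ring
    clear hf
    rw [pow_succ'] at hu
    induction hu using Submodule.mul_induction_on' with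
    | mem_mul_mem a ha b hb =>
      have h1 : a * (E b - k * b) ∈ m ^ (k + 1 + 1) ⊔ I := by
        have h := Ideal.mul_mem_mul ha (ih b (Ideal.mem_sup_left hb))
        rw [Ideal.mul_sup, ← pow_succ'] at h
        exact mem_sup_of_mem_sup_mul h
      have h2 : b * (E a - a) ∈ m ^ (k + 1 + 1) ⊔ I := by
        have h := Ideal.mul_mem_mul hb (hm a ha)
        rw [Ideal.mul_sup, ← pow_add] at h
        exact mem_sup_of_mem_sup_mul h
      convert add_mem h1 h2 using 1
      simp only [Derivation.leibniz, smul_eq_mul]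
      push_cast
      ring
    | add a _ b _ ha hb =>
      convert add_mem ha hb using 1
      rw [map_add]
      ring

/-- If a closed subgroup `K` of `G` contains the Lie algebra of `G`, then its equations lie in all
powers of the ideal of `1` on `G`. -/
theorem vanIdeal_le_pow {n : ℕ} {G K : Subgroup (GL (Fin n) ℂ)}
    (hG : IsZariskiClosed ℂ (G : Set (GL (Fin n) ℂ))) (h : lieAlg G ⊆ lieAlg K) (k : ℕ) :
    vanIdeal (K : Set (GL (Fin n) ℂ)) ≤ idealOne n ^ k ⊔ vanIdeal (G : Set (GL (Fin n) ℂ)) := by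
  obtain ⟨Y, hY, hE⟩ := exists_euler hG
  set E : Derivation ℂ (MatPoly n) (MatPoly n) := ∑ p, entryAtOne p • leftInvDer (Y p) with hEdef
  have hEapp : ∀ f, E f = ∑ p, entryAtOne p * leftInvDer (Y p) f := by
    intro f
    rw [hEdef, ← Derivation.coeFnAddMonoidHom_apply, map_sum, Finset.sum_apply]
    rfl
  have hI : ∀ f ∈ vanIdeal (G : Set (GL (Fin n) ℂ)), E f ∈ vanIdeal (G : Set (GL (Fin n) ℂ)) := by
    intro f hf
    rw [hEapp]
    exact sum_mem fun p _ => Ideal.mul_mem_left _ _ (leftInvDer_mem_vanIdeal (hY p) hf)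
  have hEm : ∀ f, E f ∈ idealOne n := by
    intro f
    rw [hEapp]
    exact sum_mem fun p _ => Ideal.mul_mem_right _ _ (entryAtOne_mem p)
  induction k with
  | zero =>
    rw [pow_zero, Ideal.one_eq_top, top_sup_eq]
    exact le_top
  | succ k ih =>
    intro f hf
    rcases Nat.eq_zero_or_pos k with rfl | hk
    · rw [zero_add, pow_one]
      exact Ideal.mem_sup_left (mem_idealOne.2 (hf 1 (one_mem K)))
    have h1 := euler_pow E _ _ hI hEm hE k f (ih hf)
    have h2 : E f ∈ idealOne n ^ (k + 1) ⊔ vanIdeal (G : Set (GL (Fin n) ℂ)) := by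
      rw [hEapp]
      refine sum_mem fun p _ => ?_
      have h3 := Ideal.mul_mem_mul (entryAtOne_mem p) (ih (leftInvDer_mem_vanIdeal (h (hY p)) hf))
      rw [Ideal.mul_sup, ← pow_succ'] at h3
      exact mem_sup_of_mem_sup_mul h3
    have h4 := sub_mem h2 h1
    rw [sub_sub_cancel] at h4
    have h5 := Ideal.mul_mem_left _ (MvPolynomial.C ((k : ℂ)⁻¹)) h4
    rwa [← mul_assoc, ← map_natCast (MvPolynomial.C : ℂ →+* MatPoly n), ← map_mul,
      inv_mul_cancel₀ (by exact_mod_cast hk.ne'), map_one, one_mul] at h5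

/-- A connected group has no proper closed subgroup with the same Lie algebra. By Krull's
intersection theorem such a subgroup contains a neighbourhood of `1`, so that it is open. -/
theorem eq_of_lieAlg_le {n : ℕ} {G K : Subgroup (GL (Fin n) ℂ)}
    (hG : IsZariskiClosed ℂ (G : Set (GL (Fin n) ℂ)))
    (hconn : IsZariskiConnected (G : Set (GL (Fin n) ℂ)))
    (hK : IsZariskiClosed ℂ (K : Set (GL (Fin n) ℂ))) (hKG : K ≤ G)
    (h : lieAlg G ⊆ lieAlg K) : K = G := by
  refine le_antisymm hKG ?_
  set I := vanIdeal (G : Set (GL (Fin n) ℂ)) with hI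
  set N : Submodule (MatPoly n) (MatPoly n ⧸ I) :=
    Submodule.map (Submodule.mkQ I) (vanIdeal (K : Set (GL (Fin n) ℂ))) with hN
  have hle : N ≤ idealOne n • N := by
    rintro _ ⟨f, hf, rfl⟩
    have h1 : Submodule.mkQ I f ∈ (⨅ i : ℕ, idealOne n ^ i • ⊤ : Submodule (MatPoly n)
        (MatPoly n ⧸ I)) := by
      rw [Submodule.mem_iInf]
      intro k
      obtain ⟨u, hu, v, hv, huv⟩ := Submodule.mem_sup.1 (vanIdeal_le_pow hG h k hf)
      have h2 : Submodule.mkQ I f = u • Submodule.mkQ I 1 := by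
        rw [← map_smul, smul_eq_mul, mul_one, ← huv, map_add, Submodule.mkQ_apply I v,
          (Submodule.Quotient.mk_eq_zero I).2 hv, add_zero]
      rw [h2]
      exact Submodule.smul_mem_smul hu trivial
    obtain ⟨r, hr⟩ := (Ideal.mem_iInf_smul_pow_eq_bot_iff _ _).1 h1
    rw [← hr]
    exact Submodule.smul_mem_smul r.2 (Submodule.mem_map_of_mem hf)
  obtain ⟨r, hr1, hr⟩ := Submodule.exists_sub_one_mem_and_smul_eq_zero_of_fg_of_le_smul
    (idealOne n) N (IsNoetherian.noetherian N) hle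
  have hr1' : ev 1 r = 1 := by
    rw [mem_idealOne, map_sub, map_one] at hr1
    exact sub_eq_zero.1 hr1
  have hopen : ∀ g ∈ G, ev g.1 r ≠ 0 → g ∈ K := by
    intro g hg hne
    change g ∈ (K : Set (GL (Fin n) ℂ))
    rw [hK.mem_iff]
    intro f hf
    have h1 : r * f ∈ I := by
      have h2 := hr _ (Submodule.mem_map_of_mem hf)
      rw [← map_smul, smul_eq_mul] at h2
      exact (Submodule.Quotient.mk_eq_zero I).1 h2
    have h3 := h1 g hg
    rw [map_mul] at h3
    exact (mul_eq_zero.1 h3).resolve_left hne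
  have hZ := hconn K {g | ∀ f ∈ {f | ∃ k ∈ K, f = translate k.1 r}, ev g.1 f = 0} hK
    (isZariskiClosed_setOf _) (by
      intro g hg
      by_cases hgK : g ∈ K
      · exact Or.inl hgK
      · right
        rintro _ ⟨k, hk, rfl⟩
        rw [ev_translate]
        by_contra hne
        exact hgK ((Subgroup.mul_mem_cancel_left K hk).1
          (hopen (k * g) (mul_mem (hKG hk) hg) hne))) (by
      ext g
      simp only [Set.mem_inter_iff, Set.mem_empty_iff_false, iff_false, not_and]
      rintro ⟨-, hgK⟩ hgZ
      have h1 := hgZ _ ⟨g⁻¹, inv_mem hgK, rfl⟩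
      rw [ev_translate, ← Units.val_mul, inv_mul_cancel, Units.val_one, hr1'] at h1
      exact one_ne_zero h1)
  rcases hZ with hZ | hZ
  · exact hZ
  · have h1 := hZ (one_mem G) _ ⟨1, one_mem K, rfl⟩
    rw [ev_translate, Units.val_one, one_mul, hr1'] at h1
    exact absurd h1 one_ne_zero

/-! ### Semisimple endomorphisms -/

theorem span_eigenvectors_eq_top {E : Type*} [AddCommGroup E] [Module ℂ E] [FiniteDimensional ℂ E]
    {f : Module.End ℂ E} (hf : f.IsSemisimple) :
    Submodule.span ℂ {v | ∃ c : ℂ, f v = c • v} = ⊤ := by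
  rw [eq_top_iff, ← hf.iSup_eigenspace_eq_top]
  refine iSup_le fun c v hv => Submodule.subset_span ⟨c, Module.End.mem_eigenspace_iff.1 hv⟩

theorem isSemisimple_of_span_eigenvectors {E : Type*} [AddCommGroup E] [Module ℂ E]
    [FiniteDimensional ℂ E] {f : Module.End ℂ E}
    (hf : Submodule.span ℂ {v | ∃ c : ℂ, f v = c • v} = ⊤) : f.IsSemisimple := by
  classical
  have hfin : {c | f.HasEigenvalue c}.Finite := Module.End.finite_hasEigenvalue f
  refine Module.End.isSemisimple_of_squarefree_aeval_eq_zero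
    (p := ∏ c ∈ hfin.toFinset, (Polynomial.X - Polynomial.C c)) ?_ ?_
  · exact (Polynomial.separable_prod_X_sub_C_iff' (f := id)).2
      (fun x _ y _ h => h) |>.squarefree
  · ext v
    have hv : v ∈ Submodule.span ℂ {v | ∃ c : ℂ, f v = c • v} := hf ▸ Submodule.mem_top
    induction hv using Submodule.span_induction with
    | mem v hv =>
      obtain ⟨c, hc⟩ := hv
      by_cases h0 : v = 0
      · rw [h0, map_zero, map_zero]
      have hmem : c ∈ hfin.toFinset := by
        rw [Set.Finite.mem_toFinset]
        exact Module.End.hasEigenvalue_of_hasEigenvector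
          ⟨Module.End.mem_eigenspace_iff.2 hc, h0⟩
      rw [← Finset.prod_erase_mul _ _ hmem, map_mul, Module.End.mul_apply]
      simp [hc]
    | zero => simp
    | add v w _ _ hv hw => rw [map_add, hv, hw, map_add]
    | smul c v _ hv => rw [map_smul, hv, map_smul]

/-- Commuting semisimple endomorphisms are simultaneously diagonalizable. -/
theorem span_joint_eigenvectors_eq_top {E ι : Type*} [AddCommGroup E] [Module ℂ E]
    [FiniteDimensional ℂ E] (f : ι → Module.End ℂ E) (hf : ∀ i, (f i).IsSemisimple)
    (hcomm : ∀ i j, Commute (f i) (f j)) :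
    Submodule.span ℂ {v | ∀ i, ∃ c : ℂ, f i v = c • v} = ⊤ := by
  have h := Module.End.iSup_iInf_maxGenEigenspace_eq_top_of_iSup_maxGenEigenspace_eq_top_of_commute
    f (fun i j _ => hcomm i j) (fun i => Module.End.iSup_maxGenEigenspace_eq_top (f i))
  rw [eq_top_iff, ← h]
  refine iSup_le fun χ v hv => Submodule.subset_span fun i => ⟨χ i, ?_⟩
  have h1 := (Submodule.mem_iInf _).1 hv i
  rw [(hf i).isFinitelySemisimple.maxGenEigenspace_eq_eigenspace] at h1
  exact Module.End.mem_eigenspace_iff.1 h1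

theorem exists_basis_mem_of_span_eq_top {E : Type*} [AddCommGroup E] [Module ℂ E]
    [FiniteDimensional ℂ E] {s : Set E} (h : Submodule.span ℂ s = ⊤) :
    ∃ b : Module.Basis (Fin (Module.finrank ℂ E)) ℂ E, ∀ i, b i ∈ s := by
  obtain ⟨u, hu, hspan, hli⟩ := exists_linearIndependent ℂ s
  let b₀ : Module.Basis u ℂ E :=
    Module.Basis.mk hli (by rw [Subtype.range_coe_subtype, Set.ofPred_mem_eq, hspan, h])
  have : Fintype u := FiniteDimensional.fintypeBasisIndex b₀
  let e : u ≃ Fin (Module.finrank ℂ E) := Fintype.equivFinOfCardEq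
    (Module.finrank_eq_card_basis b₀).symm
  refine ⟨b₀.reindex e, fun i => ?_⟩
  have h1 : b₀.reindex e i = ((e.symm i : u) : E) := by simp [b₀]
  rw [h1]
  exact hu (e.symm i).2

theorem mem_span_joint_eigenvectors {E ι : Type*} [AddCommGroup E] [Module ℂ E]
    [FiniteDimensional ℂ E] (f : ι → Module.End ℂ E) (hf : ∀ i, (f i).IsSemisimple)
    (hcomm : ∀ i j, Commute (f i) (f j)) (W : Submodule ℂ E) (hW : ∀ i, ∀ w ∈ W, f i w ∈ W)
    {w : E} (hw : w ∈ W) :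
    w ∈ Submodule.span ℂ {v | v ∈ W ∧ ∀ i, ∃ c : ℂ, f i v = c • v} := by
  have h := span_joint_eigenvectors_eq_top (fun i => LinearMap.restrict (f i) (hW i))
    (fun i => (hf i).restrict (hW i)) (fun i j => LinearMap.ext fun v => Subtype.ext
      (LinearMap.congr_fun (hcomm i j).eq (v : E)))
  have hw' : (⟨w, hw⟩ : W) ∈ Submodule.span ℂ {v : W | ∀ i, ∃ c : ℂ,
      LinearMap.restrict (f i) (hW i) v = c • v} := h ▸ Submodule.mem_top
  have h1 := Submodule.mem_map_of_mem (f := W.subtype) hw'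
  rw [Submodule.map_span] at h1
  refine Submodule.span_mono ?_ h1
  rintro _ ⟨v, hv, rfl⟩
  refine ⟨v.2, fun i => ?_⟩
  obtain ⟨c, hc⟩ := hv i
  exact ⟨c, congrArg Subtype.val hc⟩

/-! ### The Jordan decomposition in the Lie algebra of an algebraic group -/

/-- A subspace that is invariant under `D` is invariant under the semisimple part `Ds` of `D`. -/
theorem semisimple_part_mem {E : Type*} [AddCommGroup E] [Module ℂ E] (D Ds : Module.End ℂ E)
    (hspan : ∀ f, f ∈ Submodule.span ℂ
      {w | ∃ (c : ℂ) (k : ℕ), Ds w = c • w ∧ ((D - algebraMap ℂ _ c) ^ k) w = 0})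
    (W : Submodule ℂ E) (hW : ∀ f ∈ W, D f ∈ W) {f : E} (hf : f ∈ W) : Ds f ∈ W := by
  classical
  obtain ⟨m, a, w, rfl⟩ := Submodule.mem_span_set'.1 (hspan f)
  choose c k hc hk using fun i => (w i).2
  set K := Finset.univ.sup k with hK
  obtain ⟨p, hp⟩ := Ideal.exists_forall_sub_mem_ideal (R := Polynomial ℂ)
    (ι := Set.range c)
    (I := fun x => Ideal.span {(Polynomial.X - Polynomial.C (x : ℂ)) ^ K})
    (by
      intro x y hxy
      refine (Ideal.isCoprime_span_singleton_iff _ _).2 (IsCoprime.pow ?_)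
      exact Polynomial.isCoprime_X_sub_C_of_isUnit_sub
        (sub_ne_zero.2 fun h => hxy (Subtype.ext h)).isUnit) (fun x => Polynomial.C (x : ℂ))
  have h1 : ∀ i, Polynomial.aeval D p (w i : E) = c i • (w i : E) := by
    intro i
    obtain ⟨q, hq⟩ := Ideal.mem_span_singleton'.1
      (hp ⟨c i, i, rfl⟩)
    have h2 : ((D - algebraMap ℂ _ (c i)) ^ K) (w i : E) = 0 := by
      obtain ⟨l, hl⟩ := Nat.exists_eq_add_of_le (Finset.le_sup (f := k) (Finset.mem_univ i))
      rw [← hK] at hl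
      rw [hl, add_comm, pow_add, Module.End.mul_apply, hk, map_zero]
    have h3 := congrArg (fun r => Polynomial.aeval D r (w i : E)) hq
    simp only [map_mul, map_pow, map_sub, Polynomial.aeval_X, Polynomial.aeval_C,
      Module.End.mul_apply, h2, map_zero, LinearMap.sub_apply, Module.algebraMap_end_apply] at h3
    exact (sub_eq_zero.1 h3.symm)
  have h4 : Ds (∑ i, a i • (w i : E)) = Polynomial.aeval D p (∑ i, a i • (w i : E)) := by
    simp only [map_sum, map_smul, hc, h1]
  rw [h4, Polynomial.aeval_endomorphism, Polynomial.sum]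
  refine sum_mem fun j hj => W.smul_mem _ ?_
  clear hj
  induction j with
  | zero => simpa using hf
  | succ j ih =>
    rw [pow_succ', Module.End.mul_apply]
    exact hW _ ih

theorem iterate_derivation_mul_eq_zero {A : Type*} [CommRing A] [Algebra ℂ A]
    (D : Derivation ℂ A A) : ∀ (m k l : ℕ) (v w : A), k + l = m → D^[k] v = 0 → D^[l] w = 0 →
      D^[m] (v * w) = 0 := by
  intro m
  induction m with
  | zero =>
    intro k l v w h hv hw
    obtain ⟨rfl, rfl⟩ : k = 0 ∧ l = 0 := by omega
    simp only [Function.iterate_zero, id_eq] at *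
    rw [hv, zero_mul]
  | succ m ih =>
    intro k l v w h hv hw
    have h0 : ∀ i, D^[i] (0 : A) = 0 := fun i => iterate_map_zero D i
    have hadd : ∀ (i : ℕ) (x y : A), D^[i] (x + y) = D^[i] x + D^[i] y :=
      fun i x y => iterate_map_add D i x y
    rw [Function.iterate_succ_apply, Derivation.leibniz, smul_eq_mul, smul_eq_mul, hadd]
    have h1 : D^[m] (v * D w) = 0 := by
      rcases l with _ | l
      · simp only [Function.iterate_zero, id_eq] at hw
        rw [hw, map_zero, mul_zero, h0]
      · exact ih k l _ _ (by omega) hv (by rwa [← Function.iterate_succ_apply])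
    have h2 : D^[m] (w * D v) = 0 := by
      rw [mul_comm]
      rcases k with _ | k
      · simp only [Function.iterate_zero, id_eq] at hv
        rw [hv, map_zero, zero_mul, h0]
      · exact ih k l _ _ (by omega) (by rwa [← Function.iterate_succ_apply]) hw
    rw [h1, h2, add_zero]

/-- The linear form `∑ k, v k * x (i, k)` in the entries of the `i`-th row. -/
def rowForm {n : ℕ} (i : Fin n) : (Fin n → ℂ) →ₗ[ℂ] MatPoly n where
  toFun v := ∑ k, v k • MvPolynomial.X (i, k)
  map_add' v w := by simp [add_smul, Finset.sum_add_distrib]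
  map_smul' c v := by simp [mul_smul, Finset.smul_sum]

theorem rowForm_apply {n : ℕ} (i : Fin n) (v : Fin n → ℂ) :
    rowForm i v = ∑ k, v k • MvPolynomial.X (i, k) := rfl

theorem leftInvDer_rowForm {n : ℕ} (X : Matrix (Fin n) (Fin n) ℂ) (i : Fin n) (v : Fin n → ℂ) :
    leftInvDer X (rowForm i v) = rowForm i (X.mulVec v) := by
  simp only [rowForm_apply, map_sum, Derivation.map_smul, leftInvDer_X, Matrix.mulVec, dotProduct,
    Finset.smul_sum, Finset.sum_smul, smul_smul]
  rw [Finset.sum_comm]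
  refine Finset.sum_congr rfl fun k _ => Finset.sum_congr rfl fun l _ => ?_
  rw [mul_comm]

theorem rowForm_single {n : ℕ} (i j : Fin n) :
    rowForm i (Pi.single j 1) = MvPolynomial.X (i, j) := by
  rw [rowForm_apply, Finset.sum_eq_single j]
  · simp
  · intro k _ hk
    simp [hk]
  · simp

/-- For commuting `S`, `N` with `S` diagonalizable and `N` nilpotent, the derivation of `S` is
diagonalizable and the derivation of `N` is locally nilpotent. -/
theorem mem_span_eigen_nilpotent {n : ℕ} (S N : Matrix (Fin n) (Fin n) ℂ)
    (hS : Submodule.span ℂ {v : Fin n → ℂ | ∃ c : ℂ, S.mulVec v = c • v} = ⊤)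
    (hN : IsNilpotent N) (f : MatPoly n) :
    f ∈ Submodule.span ℂ {w : MatPoly n | ∃ (c : ℂ) (k : ℕ), leftInvDer S w = c • w ∧
      (leftInvDer N)^[k] w = 0} := by
  set Good := {w : MatPoly n | ∃ (c : ℂ) (k : ℕ), leftInvDer S w = c • w ∧
      (leftInvDer N)^[k] w = 0} with hGood
  obtain ⟨k, hk⟩ := hN
  have hrow : ∀ (i : Fin n) (v : Fin n → ℂ), rowForm i v ∈ Submodule.span ℂ Good := by
    intro i v
    have hv : v ∈ Submodule.span ℂ {v : Fin n → ℂ | ∃ c : ℂ, S.mulVec v = c • v} :=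
      hS ▸ Submodule.mem_top
    induction hv using Submodule.span_induction with
    | mem v hv =>
      obtain ⟨c, hc⟩ := hv
      refine Submodule.subset_span ⟨c, k, ?_, ?_⟩
      · rw [leftInvDer_rowForm, hc, map_smul]
      · have h : ∀ j : ℕ, (leftInvDer N)^[j] (rowForm i v) = rowForm i ((N ^ j).mulVec v) := by
          intro j
          induction j with
          | zero => simp
          | succ j ih =>
            rw [Function.iterate_succ_apply', ih, leftInvDer_rowForm, Matrix.mulVec_mulVec,
              pow_succ']
        rw [h, hk, Matrix.zero_mulVec, map_zero]
    | zero => simp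
    | add v w _ _ hv hw =>
      rw [map_add]
      exact add_mem hv hw
    | smul c v _ hv =>
      rw [map_smul]
      exact Submodule.smul_mem _ _ hv
  have hmul : ∀ v ∈ Good, ∀ w ∈ Good, v * w ∈ Good := by
    rintro v ⟨c, k, hv, hv'⟩ w ⟨d, l, hw, hw'⟩
    refine ⟨c + d, k + l, ?_, iterate_derivation_mul_eq_zero _ _ k l v w rfl hv' hw'⟩
    simp only [Derivation.leibniz, hv, hw, smul_eq_mul, add_smul]
    rw [mul_smul_comm, mul_smul_comm, mul_comm w v, add_comm]
  induction f using MvPolynomial.induction_on with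
  | C a =>
    have : (MvPolynomial.C a : MatPoly n) = algebraMap ℂ _ a := rfl
    refine Submodule.subset_span ⟨0, 1, ?_, ?_⟩
    · rw [this, Derivation.map_algebraMap, zero_smul]
    · rw [Function.iterate_one, this, Derivation.map_algebraMap]
  | add p q hp hq => exact add_mem hp hq
  | mul_X p q hp =>
    have hq := hrow q.1 (Pi.single q.2 1)
    rw [rowForm_single] at hq
    have h := Submodule.mul_mem_mul hp hq
    rw [Submodule.span_mul_span] at h
    refine Submodule.span_mono ?_ h
    rintro _ ⟨v, hv, w, hw, rfl⟩
    exact hmul v hv w hw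

/-- The Lie algebra of a closed subgroup contains the semisimple parts of its elements. -/
theorem semisimple_part_mem_lieAlg {n : ℕ} {G : Subgroup (GL (Fin n) ℂ)}
    (hG : IsZariskiClosed ℂ (G : Set (GL (Fin n) ℂ))) (S N : Matrix (Fin n) (Fin n) ℂ)
    (hS : Submodule.span ℂ {v : Fin n → ℂ | ∃ c : ℂ, S.mulVec v = c • v} = ⊤)
    (hN : IsNilpotent N) (hSN : Commute S N) (h : S + N ∈ lieAlg G) : S ∈ lieAlg G := by
  rw [mem_lieAlg_iff_der hG] at *
  intro f hf
  have hcomm : ∀ w, leftInvDer S (leftInvDer N w) = leftInvDer N (leftInvDer S w) := by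
    intro w
    have h1 := leftInvDer_lie S N
    rw [hSN.lie_eq] at h1
    have h2 : leftInvDer (0 : Matrix (Fin n) (Fin n) ℂ) = 0 := map_zero (leftInvDerₗ n)
    rw [h2] at h1
    have h3 := DFunLike.congr_fun h1 w
    rw [Derivation.commutator_apply] at h3
    exact (sub_eq_zero.1 h3.symm)
  refine semisimple_part_mem (leftInvDer (S + N) : MatPoly n →ₗ[ℂ] MatPoly n)
    (leftInvDer S : MatPoly n →ₗ[ℂ] MatPoly n) (fun g => ?_)
    ((vanIdeal (G : Set (GL (Fin n) ℂ))).restrictScalars ℂ) h hf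
  refine Submodule.span_mono ?_ (mem_span_eigen_nilpotent S N hS hN g)
  rintro w ⟨c, k, hw, hk⟩
  refine ⟨c, k, hw, ?_⟩
  have h2 : ∀ j : ℕ, leftInvDer S ((leftInvDer N)^[j] w) = c • (leftInvDer N)^[j] w ∧
      (((leftInvDer (S + N) : MatPoly n →ₗ[ℂ] MatPoly n) - algebraMap ℂ _ c) ^ j) w =
        (leftInvDer N)^[j] w := by
    intro j
    induction j with
    | zero => exact ⟨hw, by simp⟩
    | succ j ih =>
      refine ⟨?_, ?_⟩
      · rw [Function.iterate_succ_apply', hcomm, ih.1, Derivation.map_smul]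
      · rw [pow_succ', Module.End.mul_apply, ih.2, Function.iterate_succ_apply',
          LinearMap.sub_apply, Module.algebraMap_end_apply, Derivation.coeFn_coe, leftInvDer_add,
          Derivation.add_apply, ih.1, add_sub_cancel_left]
  rw [(h2 k).2, hk]

/-- Jordan decomposition of the elements of the Lie algebra of a closed subgroup. -/
theorem exists_jordan {n : ℕ} {G : Subgroup (GL (Fin n) ℂ)}
    (hG : IsZariskiClosed ℂ (G : Set (GL (Fin n) ℂ))) {Y : Matrix (Fin n) (Fin n) ℂ}
    (hY : Y ∈ lieAlg G) :
    ∃ S ∈ lieAlg G, ∃ N, Y = S + N ∧ IsNilpotent N ∧ Module.End.IsSemisimple (Matrix.toLin' S) ∧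
      ∀ A, Commute A Y → Commute A S := by
  obtain ⟨N, hN, S, hS, hNn, hSs, hYSN⟩ :=
    Module.End.exists_isNilpotent_isSemisimple (f := Matrix.toLin' Y)
  have hY' : Y = LinearMap.toMatrix' S + LinearMap.toMatrix' N := by
    rw [← map_add, add_comm, ← hYSN, LinearMap.toMatrix'_toLin']
  have hcomm : ∀ A : Matrix (Fin n) (Fin n) ℂ, Commute A Y →
      Commute A (LinearMap.toMatrix' S) := by
    intro A hA
    have h1 : Commute (Matrix.toLin' A) (Matrix.toLin' Y) := by
      rw [commute_iff_eq, Module.End.mul_eq_comp, Module.End.mul_eq_comp, ← Matrix.toLin'_mul,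
        ← Matrix.toLin'_mul, hA.eq]
    have h2 := Algebra.commute_of_mem_adjoin_singleton_of_commute hS h1
    rw [commute_iff_eq] at h2 ⊢
    have h3 := congrArg LinearMap.toMatrix' h2
    rwa [LinearMap.toMatrix'_mul, LinearMap.toMatrix'_mul, LinearMap.toMatrix'_toLin'] at h3
  have hNil : IsNilpotent (LinearMap.toMatrix' N) := by
    have := hNn.map (LinearMap.toMatrixAlgEquiv' (R := ℂ) (n := Fin n))
    exact this
  have hSN : Commute (LinearMap.toMatrix' S) (LinearMap.toMatrix' N) := by
    have h1 := (hcomm Y (Commute.refl Y)).sub_left (Commute.refl (LinearMap.toMatrix' S))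
    rw [sub_eq_of_eq_add' hY'] at h1
    exact h1.symm
  refine ⟨LinearMap.toMatrix' S, ?_, LinearMap.toMatrix' N, hY', hNil, ?_, hcomm⟩
  · refine semisimple_part_mem_lieAlg hG _ _ ?_ hNil hSN (hY' ▸ hY)
    simpa only [← Matrix.toLin'_apply, Matrix.toLin'_toMatrix'] using
      span_eigenvectors_eq_top hSs
  · rwa [Matrix.toLin'_toMatrix']

/-! ### Regular functions and Zariski closures -/

/-- A regular function becomes a polynomial in the entries after multiplication with a power of the
determinant. -/
theorem IsRegular.exists_det_pow_mul {n : ℕ} {H : Subgroup (GL (Fin n) ℂ)} {f : H → ℂ}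
    (hf : IsRegular f) : ∃ (N : ℕ) (q : MatPoly n), ∀ g : H,
      (g : GL (Fin n) ℂ).1.det ^ N * f g = ev (g : GL (Fin n) ℂ).1 q := by
  obtain ⟨p, hp⟩ := hf
  let D : MatPoly n := (Matrix.of fun i j => MvPolynomial.X (i, j)).det
  have hD : ∀ g : Matrix (Fin n) (Fin n) ℂ, ev g D = g.det := by
    intro g
    have h := (ev g).toRingHom.map_det (Matrix.of fun i j => MvPolynomial.X (i, j))
    refine h.trans (congrArg _ ?_)
    ext i j
    simp
  let A : Fin n × Fin n → MatPoly n := fun q =>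
    (Matrix.of fun i j => (MvPolynomial.X (i, j) : MatPoly n)).adjugate q.1 q.2
  have hA : ∀ (g : GL (Fin n) ℂ) q, ev g.1 (A q) = g.1.det * (g⁻¹).1 q.1 q.2 := by
    intro g q
    have h := congrFun₂ ((ev g.1).toRingHom.map_adjugate
      (Matrix.of fun i j => MvPolynomial.X (i, j))) q.1 q.2
    have h2 : (ev g.1).toRingHom.mapMatrix (Matrix.of fun i j => MvPolynomial.X (i, j)) = g.1 := by
      ext i j
      simp
    rw [h2] at h
    refine h.trans ?_
    have h3 : g.1.adjugate = g.1.det • (g⁻¹).1 := by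
      have h4 := congrArg (· * (g⁻¹).1) (Matrix.adjugate_mul g.1)
      simp only [mul_assoc, ← Units.val_mul, mul_inv_cancel, Units.val_one, mul_one,
        Matrix.smul_mul, one_mul] at h4
      exact h4
    rw [h3]
    rfl
  have hdet : ∀ g : H, (g : GL (Fin n) ℂ).1.det ≠ 0 := fun g =>
    ((Matrix.isUnit_iff_isUnit_det _).1 (g : GL (Fin n) ℂ).isUnit).ne_zero
  suffices h : ∃ (N : ℕ) (q : MatPoly n), ∀ g : H, (g : GL (Fin n) ℂ).1.det ^ N *
      MvPolynomial.eval (Sum.elim (fun q => (g : GL (Fin n) ℂ).1 q.1 q.2)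
        (fun q => ((g⁻¹ : H) : GL (Fin n) ℂ).1 q.1 q.2)) p = ev (g : GL (Fin n) ℂ).1 q by
    simpa only [hp] using h
  clear hp
  induction p using MvPolynomial.induction_on with
  | C a => exact ⟨0, MvPolynomial.C a, fun g => by simp [ev]⟩
  | add p q hp hq =>
    obtain ⟨N, a, ha⟩ := hp
    obtain ⟨M, b, hb⟩ := hq
    refine ⟨N + M, D ^ M * a + D ^ N * b, fun g => ?_⟩
    simp only [map_add, map_mul, map_pow, hD, ← ha, ← hb]
    ring
  | mul_X p q hp =>
    obtain ⟨N, a, ha⟩ := hp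
    rcases q with q | q
    · refine ⟨N, a * MvPolynomial.X q, fun g => ?_⟩
      simp only [map_mul, ← ha, MvPolynomial.eval_X, Sum.elim_inl, ev_X]
      ring
    · refine ⟨N + 1, a * A q, fun g => ?_⟩
      simp only [map_mul, ← ha, MvPolynomial.eval_X, Sum.elim_inr, hA]
      rw [show ((g⁻¹ : H) : GL (Fin n) ℂ) = (g : GL (Fin n) ℂ)⁻¹ from rfl]
      ring

theorem IsRegular.isZariskiClosed_zeros {n : ℕ} {H : Subgroup (GL (Fin n) ℂ)}
    (hH : IsZariskiClosed ℂ (H : Set (GL (Fin n) ℂ))) {f : H → ℂ} (hf : IsRegular f) :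
    IsZariskiClosed ℂ {g : GL (Fin n) ℂ | ∃ hg : g ∈ H, f ⟨g, hg⟩ = 0} := by
  obtain ⟨N, q, hq⟩ := hf.exists_det_pow_mul
  have h : {g : GL (Fin n) ℂ | ∃ hg : g ∈ H, f ⟨g, hg⟩ = 0} =
      (H : Set (GL (Fin n) ℂ)) ∩ {g | ∀ f ∈ ({q} : Set (MatPoly n)), ev g.1 f = 0} := by
    ext g
    simp only [Set.mem_ofPred_eq, Set.mem_inter_iff, SetLike.mem_coe, Set.mem_singleton_iff,
      forall_eq, ← exists_prop]
    refine exists_congr fun hg => ?_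
    have hdet : g.1.det ≠ 0 := ((Matrix.isUnit_iff_isUnit_det _).1 g.isUnit).ne_zero
    rw [← hq ⟨g, hg⟩, mul_eq_zero]
    exact ⟨fun h => Or.inr h, fun h => h.resolve_left (pow_ne_zero _ hdet)⟩
  rw [h]
  exact hH.inter (isZariskiClosed_setOf _)

theorem IsRegular.sub {n : ℕ} {H : Subgroup (GL (Fin n) ℂ)} {f g : H → ℂ}
    (hf : IsRegular f) (hg : IsRegular g) : IsRegular (fun x => f x - g x) := by
  obtain ⟨p, hp⟩ := hf
  obtain ⟨q, hq⟩ := hg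
  exact ⟨p - q, fun x => by
    change f x - g x = _
    rw [map_sub, hp, hq]⟩

/-- The translation `f (x g)` on the polynomial ring. -/
def translateRight {n : ℕ} (g : Matrix (Fin n) (Fin n) ℂ) : MatPoly n →ₐ[ℂ] MatPoly n :=
  MvPolynomial.aeval fun p => ∑ k, g k p.2 • MvPolynomial.X (p.1, k)

theorem ev_translateRight {n : ℕ} (g x : Matrix (Fin n) (Fin n) ℂ) (f : MatPoly n) :
    ev x (translateRight g f) = ev (x * g) f := by
  have h : (ev x).comp (translateRight g) = ev (x * g) := by
    apply MvPolynomial.algHom_ext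
    intro p
    simp [translateRight, Matrix.mul_apply, mul_comm]
  exact DFunLike.congr_fun h f

/-- The Zariski closure of a subgroup, which is a subgroup. -/
def zariskiClosure {n : ℕ} (H : Subgroup (GL (Fin n) ℂ)) : Subgroup (GL (Fin n) ℂ) where
  carrier := {g | ∀ f ∈ vanIdeal (H : Set (GL (Fin n) ℂ)), ev g.1 f = 0}
  one_mem' := fun f hf => hf 1 (one_mem H)
  mul_mem' := by
    intro a b ha hb f hf
    have h1 : ∀ x ∈ H, ev (a.1 * x.1) f = 0 := by
      intro x hx
      have h2 := ha (translateRight x.1 f) (by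
        intro y hy
        rw [ev_translateRight, ← Units.val_mul]
        exact hf _ (mul_mem hy hx))
      rwa [ev_translateRight] at h2
    have h3 := hb (translate a.1 f) (by
      intro y hy
      rw [ev_translate]
      exact h1 y hy)
    rwa [ev_translate] at h3
  inv_mem' := by
    intro a ha f hf
    have hreg : IsRegular (fun g : (⊤ : Subgroup (GL (Fin n) ℂ)) =>
        ev ((g : GL (Fin n) ℂ)⁻¹).1 f) :=
      ⟨MvPolynomial.rename Sum.inr f, fun g => by
        rw [MvPolynomial.eval_rename]
        rfl⟩
    obtain ⟨N, q, hq⟩ := hreg.exists_det_pow_mul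
    have h1 := ha q (by
      intro g hg
      rw [← hq ⟨g, trivial⟩]
      change _ * ev (g⁻¹).1 f = 0
      rw [hf _ (inv_mem hg), mul_zero])
    rw [← hq ⟨a, trivial⟩] at h1
    have hdet : a.1.det ≠ 0 := ((Matrix.isUnit_iff_isUnit_det _).1 a.isUnit).ne_zero
    exact (mul_eq_zero.1 h1).resolve_left (pow_ne_zero _ hdet)

theorem zariskiClosure_isZariskiClosed {n : ℕ} (H : Subgroup (GL (Fin n) ℂ)) :
    IsZariskiClosed ℂ (zariskiClosure H : Set (GL (Fin n) ℂ)) :=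
  ⟨(vanIdeal (H : Set (GL (Fin n) ℂ)) : Set (MatPoly n)), rfl⟩

theorem le_zariskiClosure {n : ℕ} (H : Subgroup (GL (Fin n) ℂ)) : H ≤ zariskiClosure H :=
  fun g hg _ hf => hf g hg

theorem zariskiClosure_subset {n : ℕ} {H : Subgroup (GL (Fin n) ℂ)} {Z : Set (GL (Fin n) ℂ)}
    (hZ : IsZariskiClosed ℂ Z) (h : (H : Set (GL (Fin n) ℂ)) ⊆ Z) :
    (zariskiClosure H : Set (GL (Fin n) ℂ)) ⊆ Z := by
  intro g hg
  rw [hZ.mem_iff]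
  exact fun f hf => hg f fun x hx => hf x (h hx)

theorem zariskiClosure_connected {n : ℕ} {H : Subgroup (GL (Fin n) ℂ)}
    (h : IsZariskiConnected (H : Set (GL (Fin n) ℂ))) :
    IsZariskiConnected (zariskiClosure H : Set (GL (Fin n) ℂ)) := by
  intro Z₁ Z₂ h1 h2 hcov hdisj
  have hle : (H : Set (GL (Fin n) ℂ)) ⊆ zariskiClosure H := le_zariskiClosure H
  rcases h Z₁ Z₂ h1 h2 (hle.trans hcov) (Set.subset_empty_iff.1 (hdisj ▸
    Set.inter_subset_inter_left _ (Set.inter_subset_inter_left _ hle))) with h3 | h3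
  · exact Or.inl (zariskiClosure_subset h1 h3)
  · exact Or.inr (zariskiClosure_subset h2 h3)

/-! ### One-parameter groups and the adjoint action -/

theorem hasDerivAt_Ad_exp {n : ℕ} (X Y : Matrix (Fin n) (Fin n) ℂ) (i j : Fin n) (t : ℂ) :
    HasDerivAt (fun t : ℂ => Ad (expGL (t • X)) Y i j)
      (Ad (expGL (t • X)) ⁅X, Y⁆ i j) t := by
  let _ : NormedRing (Matrix (Fin n) (Fin n) ℂ) := Matrix.linftyOpNormedRing
  let _ : NormedAlgebra ℂ (Matrix (Fin n) (Fin n) ℂ) := Matrix.linftyOpNormedAlgebra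
  have h1 := hasDerivAt_exp_smul_const (𝕂 := ℂ) X t
  have h2 := hasDerivAt_exp_smul_const' (𝕂 := ℂ) (-X) t
  have h3 := ((h1.mul_const Y).mul h2)
  have h4 := (LinearMap.toContinuousLinearMap
    (Matrix.entryLinearMap ℂ ℂ i j)).hasFDerivAt.comp_hasDerivAt t h3
  have h5 : ∀ t : ℂ, Ad (expGL (t • X)) Y =
      NormedSpace.exp (t • X) * Y * NormedSpace.exp (t • -X) := by
    intro t
    rw [Ad, expGL_inv, expGL_val, expGL_val, smul_neg]
  have h6 : Ad (expGL (t • X)) ⁅X, Y⁆ =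
      NormedSpace.exp (t • X) * X * Y * NormedSpace.exp (t • -X) +
        NormedSpace.exp (t • X) * Y * (-X * NormedSpace.exp (t • -X)) := by
    rw [Ad, expGL_inv, expGL_val, expGL_val, smul_neg, Ring.lie_def]
    simp only [mul_sub, sub_mul, neg_mul, mul_neg, mul_assoc]
    rw [sub_eq_add_neg]
  simp only [h5]
  rw [h6]
  exact h4

/-- If `Ad (exp (t X)) Y = exp (t c) Y` then `[X, Y] = c Y`. -/
theorem lie_eq_of_Ad_exp {n : ℕ} {X Y : Matrix (Fin n) (Fin n) ℂ} {c : ℂ}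
    (h : ∀ t : ℝ, Ad (expGL ((t : ℂ) • X)) Y = Complex.exp (t * c) • Y) : ⁅X, Y⁆ = c • Y := by
  ext i j
  have h1 := (hasDerivAt_Ad_exp X Y i j ((0 : ℝ) : ℂ)).comp_ofReal
  have h2 : HasDerivAt (fun t : ℂ => Complex.exp (t * c) * Y i j) (c * Y i j) ((0 : ℝ) : ℂ) := by
    have h3 := (((hasDerivAt_id ((0 : ℝ) : ℂ)).mul_const c).cexp).mul_const (Y i j)
    simpa using h3
  have h4 : (fun t : ℝ => Ad (expGL ((t : ℂ) • X)) Y i j) =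
      fun t : ℝ => Complex.exp (t * c) * Y i j := by
    funext t
    rw [h]
    rfl
  rw [h4] at h1
  have h5 := h1.unique h2.comp_ofReal
  simpa [expGL_zero, Ad_one] using h5

theorem lie_eq_zero_of_Ad_exp {n : ℕ} {X Y : Matrix (Fin n) (Fin n) ℂ}
    (h : ∀ t : ℝ, Ad (expGL ((t : ℂ) • X)) Y = Y) : ⁅X, Y⁆ = 0 := by
  have h1 := lie_eq_of_Ad_exp (X := X) (Y := Y) (c := 0) (by simpa using h)
  simpa using h1

/-- Along `X`, a generalized eigenvector of rank two of `ad X` moves linearly, up to an exponential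
factor. -/
theorem Ad_exp_of_lie {n : ℕ} {X W U : Matrix (Fin n) (Fin n) ℂ} {c : ℂ}
    (hW : ⁅X, W⁆ = c • W + U) (hU : ⁅X, U⁆ = c • U) (t : ℂ) :
    Ad (expGL (t • X)) W = Complex.exp (t * c) • (W + t • U) := by
  -- the two sides agree at `0`, and `Ad (exp (-t X))` of the right hand side is constant
  let F : ℂ → Matrix (Fin n) (Fin n) ℂ := fun t =>
    Ad (expGL (t • -X)) (Complex.exp (t * c) • (W + t • U))
  have hF : ∀ t, F t = W := by
    intro t
    ext i j
    have hconst : ∀ t, HasDerivAt (fun t => F t i j) 0 t := by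
      intro t
      have hW' := hasDerivAt_Ad_exp (-X) W i j t
      have hU' := hasDerivAt_Ad_exp (-X) U i j t
      have he : HasDerivAt (fun t : ℂ => Complex.exp (t * c)) (Complex.exp (t * c) * c) t := by
        have h := ((hasDerivAt_id t).mul_const c).cexp
        simpa using h
      have h := he.mul (hW'.add ((hasDerivAt_id t).mul hU'))
      rw [neg_lie, hW, neg_lie, hU] at h
      have hval : ∀ t, F t i j = Complex.exp (t * c) *
          (Ad (expGL (t • -X)) W i j + t * Ad (expGL (t • -X)) U i j) := by
        intro t
        change Ad _ _ i j = _
        rw [Ad_smul, Ad_add, Ad_smul]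
        rfl
      have h0 : HasDerivAt (fun t => F t i j) _ t :=
        h.congr_of_eventuallyEq (Filter.Eventually.of_forall fun t => (hval t).trans rfl)
      refine h0.congr_deriv ?_
      have hn : ∀ A : Matrix (Fin n) (Fin n) ℂ, ∀ g : GL (Fin n) ℂ, Ad g (-A) = -Ad g A :=
        fun A g => map_neg (Adₗ g) A
      simp only [hn, Ad_add, Ad_smul, Matrix.neg_apply, Matrix.add_apply, Matrix.smul_apply,
        smul_eq_mul, Pi.add_apply, Pi.mul_apply, id_eq]
      ring
    have h := is_const_of_deriv_eq_zero (f := fun t => F t i j)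
      (fun t => (hconst t).differentiableAt) (fun t => (hconst t).deriv) t 0
    rw [h]
    simp [F, expGL_zero, Ad_one]
  have h1 := congrArg (Ad (expGL (t • X))) (hF t)
  change Ad (expGL (t • X)) (Ad (expGL (t • -X)) _) = _ at h1
  rw [← Ad_mul, smul_neg, ← expGL_inv, mul_inv_cancel, Ad_one] at h1
  exact h1.symm

/-! ### Weights of a torus on matrices -/

namespace Torus

variable {n : ℕ} (T : Torus n)

/-- A matrix that brings the torus to diagonal form. -/
def diagonalizer : GL (Fin n) ℂ := T.diagonalizable.choose

theorem diagonalizer_spec {t : GL (Fin n) ℂ} (ht : t ∈ T.carrier) :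
    (T.diagonalizer * t * T.diagonalizer⁻¹).1.IsDiag :=
  T.diagonalizable.choose_spec t ht

/-- The `i`-th diagonal entry of the elements of the torus. -/
def diagHom (i : Fin n) : T.carrier →* ℂ where
  toFun t := (T.diagonalizer * (t : GL (Fin n) ℂ) * T.diagonalizer⁻¹).1 i i
  map_one' := by simp
  map_mul' s t := by
    have h : T.diagonalizer * ((s * t : T.carrier) : GL (Fin n) ℂ) * T.diagonalizer⁻¹ =
        (T.diagonalizer * (s : GL (Fin n) ℂ) * T.diagonalizer⁻¹) *
          (T.diagonalizer * (t : GL (Fin n) ℂ) * T.diagonalizer⁻¹) := by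
      change T.diagonalizer * (s * t) * _ = _
      group
    rw [h, Units.val_mul, Matrix.mul_apply, Finset.sum_eq_single i]
    · intro j _ hj
      rw [T.diagonalizer_spec s.2 hj.symm, zero_mul]
    · simp

/-- The character of the torus given by the `i`-th diagonal entry. -/
def diagChar (i : Fin n) : charGroup T :=
  ⟨(T.diagHom i).toHomUnits, by
    refine ⟨∑ k, ∑ l, MvPolynomial.C (T.diagonalizer.1 i k) * MvPolynomial.X (Sum.inl (k, l)) *
      MvPolynomial.C ((T.diagonalizer⁻¹).1 l i), fun g => ?_⟩
    simp only [map_sum, map_mul, MvPolynomial.eval_C, MvPolynomial.eval_X, Sum.elim_inl]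
    change ((T.diagonalizer * (g : GL (Fin n) ℂ) * T.diagonalizer⁻¹).1) i i = _
    rw [Units.val_mul, Units.val_mul, Matrix.mul_apply, Finset.sum_comm]
    refine Finset.sum_congr rfl fun l _ => ?_
    rw [Matrix.mul_apply, Finset.sum_mul]⟩

theorem diagChar_apply (i : Fin n) (t : T.carrier) :
    ((T.diagChar i).1 t : ℂ) = (T.diagonalizer * (t : GL (Fin n) ℂ) * T.diagonalizer⁻¹).1 i i := rfl

/-- The weight of the matrix unit with index `p` under the adjoint action. -/
def wt (p : Fin n × Fin n) : charGroup T := T.diagChar p.1 * (T.diagChar p.2)⁻¹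

theorem conj_eq_diagonal (t : T.carrier) :
    (T.diagonalizer * (t : GL (Fin n) ℂ) * T.diagonalizer⁻¹).1 =
      Matrix.diagonal fun i => ((T.diagChar i).1 t : ℂ) :=
  ((T.diagonalizer_spec t.2).diagonal_diag).symm

theorem wt_apply (p : Fin n × Fin n) (t : T.carrier) :
    ((T.wt p).1 t : ℂ) = ((T.diagChar p.1).1 t : ℂ) * ((T.diagChar p.2).1 t : ℂ)⁻¹ := by
  simp [wt]

theorem Ad_diagonalizer_apply (t : T.carrier) (Y : Matrix (Fin n) (Fin n) ℂ) (i j : Fin n) :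
    Ad T.diagonalizer (Ad (t : GL (Fin n) ℂ) Y) i j =
      ((T.wt (i, j)).1 t : ℂ) * Ad T.diagonalizer Y i j := by
  have h : Ad T.diagonalizer (Ad (t : GL (Fin n) ℂ) Y) =
      Ad (T.diagonalizer * (t : GL (Fin n) ℂ) * T.diagonalizer⁻¹) (Ad T.diagonalizer Y) := by
    rw [← Ad_mul, ← Ad_mul]
    congr 1
    group
  have hinv : (T.diagonalizer * (t : GL (Fin n) ℂ) * T.diagonalizer⁻¹)⁻¹ =
      T.diagonalizer * ((t⁻¹ : T.carrier) : GL (Fin n) ℂ) * T.diagonalizer⁻¹ := by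
    rw [InvMemClass.coe_inv]
    group
  rw [h, Ad, hinv, conj_eq_diagonal, conj_eq_diagonal, Matrix.mul_diagonal,
    Matrix.diagonal_mul, wt_apply, map_inv, Units.val_inv_eq_inv_val]
  ring

/-- `Y` is a vector of weight `α` under the adjoint action of the torus (possibly zero). -/
def IsWeightVec (α : charGroup T) (Y : Matrix (Fin n) (Fin n) ℂ) : Prop :=
  ∀ t : T.carrier, Ad (t : GL (Fin n) ℂ) Y = ((α.1 t : ℂˣ) : ℂ) • Y

theorem Ad_injective (g : GL (Fin n) ℂ) : Function.Injective (Ad g) := by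
  intro X Y h
  have h1 := congrArg (Ad g⁻¹) h
  rwa [← Ad_mul, ← Ad_mul, inv_mul_cancel, Ad_one, Ad_one] at h1

theorem char_ext {α β : charGroup T} (h : ∀ t, (α.1 t : ℂ) = (β.1 t : ℂ)) : α = β :=
  Subtype.ext (MonoidHom.ext fun t => Units.ext (h t))

theorem IsWeightVec.wt_eq {T : Torus n} {α : charGroup T} {Y : Matrix (Fin n) (Fin n) ℂ}
    (h : T.IsWeightVec α Y) {i j : Fin n} (hij : Ad T.diagonalizer Y i j ≠ 0) :
    T.wt (i, j) = α := by
  refine T.char_ext fun t => ?_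
  have h1 := T.Ad_diagonalizer_apply t Y i j
  rw [h t, Ad_smul, Matrix.smul_apply, smul_eq_mul] at h1
  exact (mul_right_cancel₀ hij h1).symm

open Classical in
/-- The projection of the matrices to the vectors of weight `α`. -/
def wproj (α : charGroup T) : Matrix (Fin n) (Fin n) ℂ →ₗ[ℂ] Matrix (Fin n) (Fin n) ℂ :=
  Adₗ (T.diagonalizer)⁻¹ ∘ₗ
    { toFun := fun Y => Matrix.of fun i j => if T.wt (i, j) = α then Y i j else 0
      map_add' := fun X Y => by
        ext i j
        simp only [Matrix.of_apply, Matrix.add_apply]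
        split_ifs <;> simp
      map_smul' := fun c Y => by
        ext i j
        simp } ∘ₗ Adₗ T.diagonalizer

open Classical in
theorem Ad_wproj (α : charGroup T) (Y : Matrix (Fin n) (Fin n) ℂ) (i j : Fin n) :
    Ad T.diagonalizer (T.wproj α Y) i j =
      if T.wt (i, j) = α then Ad T.diagonalizer Y i j else 0 := by
  simp [wproj, ← Ad_mul, Ad_one]

theorem ext_Ad {X Y : Matrix (Fin n) (Fin n) ℂ}
    (h : ∀ i j, Ad T.diagonalizer X i j = Ad T.diagonalizer Y i j) : X = Y :=
  Ad_injective T.diagonalizer (Matrix.ext h)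

theorem wproj_isWeightVec (α : charGroup T) (Y : Matrix (Fin n) (Fin n) ℂ) :
    T.IsWeightVec α (T.wproj α Y) := by
  intro t
  refine T.ext_Ad fun i j => ?_
  rw [Ad_diagonalizer_apply, Ad_smul, Matrix.smul_apply, Ad_wproj, smul_eq_mul]
  split_ifs with h
  · rw [h]
  · simp

theorem IsWeightVec.wproj_eq {T : Torus n} {α : charGroup T} {Y : Matrix (Fin n) (Fin n) ℂ}
    (h : T.IsWeightVec α Y) : T.wproj α Y = Y := by
  refine T.ext_Ad fun i j => ?_
  rw [Ad_wproj]
  split_ifs with hij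
  · rfl
  · by_contra hne
    exact hij (h.wt_eq (Ne.symm hne))

theorem IsWeightVec.wproj_eq_zero {T : Torus n} {α β : charGroup T}
    {Y : Matrix (Fin n) (Fin n) ℂ} (h : T.IsWeightVec α Y) (hne : β ≠ α) : T.wproj β Y = 0 := by
  refine T.ext_Ad fun i j => ?_
  rw [Ad_wproj]
  split_ifs with hij
  · by_contra h0
    have h1 : Ad T.diagonalizer Y i j ≠ 0 := by
      intro h2
      rw [h2] at h0
      simp [Ad] at h0
    exact hne (hij ▸ h.wt_eq h1)
  · simp [Ad]

open Classical in
/-- The weights of the torus on the matrices. -/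
def wts : Finset (charGroup T) := Finset.univ.image T.wt

theorem wt_mem_wts (p : Fin n × Fin n) : T.wt p ∈ T.wts := by
  classical
  exact Finset.mem_image_of_mem _ (Finset.mem_univ p)

theorem IsWeightVec.mem_wts {T : Torus n} {α : charGroup T} {Y : Matrix (Fin n) (Fin n) ℂ}
    (h : T.IsWeightVec α Y) (h0 : Y ≠ 0) : α ∈ T.wts := by
  by_contra hne
  apply h0
  refine T.ext_Ad fun i j => ?_
  by_contra h1
  have h2 : Ad T.diagonalizer Y i j ≠ 0 := by
    intro h3
    rw [h3] at h1
    simp [Ad] at h1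
  exact hne (h.wt_eq h2 ▸ T.wt_mem_wts _)

theorem sum_wproj (Y : Matrix (Fin n) (Fin n) ℂ) : ∑ α ∈ T.wts, T.wproj α Y = Y := by
  classical
  refine T.ext_Ad fun i j => ?_
  rw [← Adₗ_apply, map_sum, Matrix.sum_apply]
  simp only [Adₗ_apply, Ad_wproj]
  rw [Finset.sum_ite_eq]
  simp [T.wt_mem_wts]

theorem isSemisimple_Adₗ (t : T.carrier) :
    Module.End.IsSemisimple (Adₗ (t : GL (Fin n) ℂ)) := by
  refine isSemisimple_of_span_eigenvectors (eq_top_iff.2 fun Y _ => ?_)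
  rw [← T.sum_wproj Y]
  exact sum_mem fun α _ => Submodule.subset_span ⟨_, T.wproj_isWeightVec α Y t⟩

/-- The Lie algebra of a group that contains the torus is the sum of its weight spaces. -/
theorem wproj_mem_lieAlg {G : Subgroup (GL (Fin n) ℂ)}
    (hG : IsZariskiClosed ℂ (G : Set (GL (Fin n) ℂ))) (hT : T.carrier ≤ G) (α : charGroup T)
    {Y : Matrix (Fin n) (Fin n) ℂ} (hY : Y ∈ lieAlg G) : T.wproj α Y ∈ lieAlg G := by
  let W := (lieSub G hG).toSubmodule
  have hW : ∀ t : T.carrier, ∀ Y ∈ W, Adₗ (t : GL (Fin n) ℂ) Y ∈ W :=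
    fun t Y hY => Ad_mem_lieAlg (hT t.2) hY
  have hY' := mem_span_joint_eigenvectors (fun t : T.carrier => Adₗ (t : GL (Fin n) ℂ))
    T.isSemisimple_Adₗ (fun s t => LinearMap.ext fun Y => by
      change Ad _ (Ad _ _) = Ad _ (Ad _ _)
      rw [← Ad_mul, ← Ad_mul, T.comm s.2 t.2]) W hW hY
  suffices h : Submodule.span ℂ {v | v ∈ W ∧ ∀ t : T.carrier, ∃ c : ℂ,
      Adₗ (t : GL (Fin n) ℂ) v = c • v} ≤ W.comap (T.wproj α) from h hY'
  rw [Submodule.span_le]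
  rintro v ⟨hvW, hv⟩
  change T.wproj α v ∈ W
  by_cases h0 : v = 0
  · rw [h0, map_zero]
    exact W.zero_mem
  obtain ⟨i, j, hij⟩ : ∃ i j, Ad T.diagonalizer v i j ≠ 0 := by
    by_contra! hall
    refine h0 (T.ext_Ad fun i j => ?_)
    rw [hall]
    simp [Ad]
  have hwt : T.IsWeightVec (T.wt (i, j)) v := by
    intro t
    obtain ⟨c, hc⟩ := hv t
    have hc' : Ad (t : GL (Fin n) ℂ) v = c • v := hc
    have h1 := T.Ad_diagonalizer_apply t v i j
    rw [hc', Ad_smul, Matrix.smul_apply, smul_eq_mul] at h1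
    rw [hc', mul_right_cancel₀ hij h1]
  by_cases h : α = T.wt (i, j)
  · rw [h, hwt.wproj_eq]
    exact hvW
  · rw [hwt.wproj_eq_zero h]
    exact W.zero_mem

theorem roots_finite (G : Subgroup (GL (Fin n) ℂ)) : (roots G T).Finite := by
  refine T.wts.finite_toSet.subset ?_
  rintro α ⟨_, Y, _, h0, hY⟩
  exact IsWeightVec.mem_wts (T := T) hY h0

/-! ### Differentials of the weights -/

open Classical in
/-- The differential of a weight of the torus, as a functional on all matrices: in diagonal form,
a difference of diagonal entries. It is `0` for characters that are not weights. -/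
def dwt (α : charGroup T) : Matrix (Fin n) (Fin n) ℂ →ₗ[ℂ] ℂ :=
  if h : ∃ p, T.wt p = α then
    (Matrix.entryLinearMap ℂ ℂ h.choose.1 h.choose.1 -
      Matrix.entryLinearMap ℂ ℂ h.choose.2 h.choose.2) ∘ₗ Adₗ T.diagonalizer
  else 0

theorem Ad_diagonalizer_lie {X : Matrix (Fin n) (Fin n) ℂ} (hX : X ∈ lieAlg T.carrier) :
    (Ad T.diagonalizer X).IsDiag := by
  intro i j hij
  have h1 := (hasDerivAt_exp_entry (Ad T.diagonalizer X) i j ((0 : ℝ) : ℂ)).comp_ofReal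
  have h2 : (fun t : ℝ => (NormedSpace.exp ((t : ℂ) • Ad T.diagonalizer X) :
      Matrix (Fin n) (Fin n) ℂ) i j) = fun _ => 0 := by
    funext t
    rw [← expGL_val, ← Ad_smul, ← conj_expGL, Complex.coe_smul]
    exact T.diagonalizer_spec (mem_lieAlg_iff_exp.1 hX t) hij
  rw [h2] at h1
  have h3 := h1.unique (hasDerivAt_const _ _)
  simpa using h3

theorem diagChar_exp {X : Matrix (Fin n) (Fin n) ℂ} (hX : X ∈ lieAlg T.carrier) (z : ℂ)
    (i : Fin n) : ((T.diagChar i).1 ⟨expGL (z • X), expGL_mem T.closed hX z⟩ : ℂ) =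
      Complex.exp (z * Ad T.diagonalizer X i i) := by
  rw [diagChar_apply]
  change (T.diagonalizer * expGL (z • X) * T.diagonalizer⁻¹).1 i i = _
  rw [conj_expGL, Ad_smul, expGL_val, ← (T.Ad_diagonalizer_lie hX).diagonal_diag,
    ← Matrix.diagonal_smul, Matrix.exp_diagonal, Matrix.diagonal_apply_eq, Pi.coe_exp,
    Complex.exp_eq_exp_ℂ, Matrix.diagonal_apply_eq]
  rfl

theorem wt_exp {α : charGroup T} (hα : α ∈ T.wts) {X : Matrix (Fin n) (Fin n) ℂ}
    (hX : X ∈ lieAlg T.carrier) (z : ℂ) :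
    (α.1 ⟨expGL (z • X), expGL_mem T.closed hX z⟩ : ℂ) = Complex.exp (z * T.dwt α X) := by
  classical
  have h : ∃ p, T.wt p = α := by simpa [wts] using hα
  have h1 : (α.1 ⟨expGL (z • X), expGL_mem T.closed hX z⟩ : ℂ) =
      ((T.wt h.choose).1 ⟨expGL (z • X), expGL_mem T.closed hX z⟩ : ℂ) := by
    rw [h.choose_spec]
  rw [h1, wt_apply, T.diagChar_exp hX, T.diagChar_exp hX, ← Complex.exp_neg, ← Complex.exp_add, dwt,
    dif_pos h]
  congr 1
  simp only [LinearMap.comp_apply, LinearMap.sub_apply, Matrix.entryLinearMap_apply, Adₗ_apply]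
  ring

theorem IsWeightVec.lie_eq {T : Torus n} {α : charGroup T} {Y : Matrix (Fin n) (Fin n) ℂ}
    (h : T.IsWeightVec α Y) {X : Matrix (Fin n) (Fin n) ℂ} (hX : X ∈ lieAlg T.carrier) :
    ⁅X, Y⁆ = T.dwt α X • Y := by
  by_cases h0 : Y = 0
  · simp [h0]
  refine lie_eq_of_Ad_exp fun t => ?_
  rw [← T.wt_exp (h.mem_wts h0) hX]
  exact h ⟨_, expGL_mem T.closed hX t⟩

/-- A torus is connected, so its characters are determined by their values on one-parameter
groups. -/
theorem char_eq_of_exp {α β : charGroup T}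
    (h : ∀ (X : Matrix (Fin n) (Fin n) ℂ) (hX : X ∈ lieAlg T.carrier) (t : ℝ),
      α.1 ⟨expGL ((t : ℂ) • X), expGL_mem T.closed hX t⟩ =
        β.1 ⟨expGL ((t : ℂ) • X), expGL_mem T.closed hX t⟩) : α = β := by
  let K : Subgroup (GL (Fin n) ℂ) := (α.1.eqLocus β.1).map T.carrier.subtype
  have hreg : IsRegular (fun t : T.carrier => (α.1 t : ℂ) - (β.1 t : ℂ)) := α.2.sub β.2
  have hK : (K : Set (GL (Fin n) ℂ)) =
      {g | ∃ hg : g ∈ T.carrier, (α.1 ⟨g, hg⟩ : ℂ) - (β.1 ⟨g, hg⟩ : ℂ) = 0} := by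
    ext g
    constructor
    · rintro ⟨t, ht, rfl⟩
      exact ⟨t.2, sub_eq_zero.2 (congrArg Units.val ht)⟩
    · rintro ⟨hg, h⟩
      exact ⟨⟨g, hg⟩, Units.ext (sub_eq_zero.1 h), rfl⟩
  have hKT : K = T.carrier := by
    refine eq_of_lieAlg_le T.closed T.connected ?_ ?_ ?_
    · rw [hK]
      exact hreg.isZariskiClosed_zeros T.closed
    · rintro _ ⟨t, _, rfl⟩
      exact t.2
    · intro X hX
      rw [mem_lieAlg_iff_exp]
      intro t
      refine ⟨⟨expGL ((t : ℂ) • X), expGL_mem T.closed hX t⟩, h X hX t, ?_⟩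
      change expGL ((t : ℂ) • X) = _
      rw [Complex.coe_smul]
  refine T.char_ext fun t => ?_
  have ht : (t : GL (Fin n) ℂ) ∈ (K : Set (GL (Fin n) ℂ)) := by
    rw [hKT]
    exact t.2
  rw [hK] at ht
  exact sub_eq_zero.1 ht.2

theorem char_eq_of_dwt {α β : charGroup T} (hα : α ∈ T.wts) (hβ : β ∈ T.wts)
    (h : ∀ X ∈ lieAlg T.carrier, T.dwt α X = T.dwt β X) : α = β := by
  refine T.char_eq_of_exp fun X hX t => Units.ext ?_
  rw [T.wt_exp hα hX, T.wt_exp hβ hX, h X hX]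

theorem exists_dwt_ne_zero {α : charGroup T} (hα : α ∈ T.wts) (h1 : α ≠ 1) :
    ∃ X ∈ lieAlg T.carrier, T.dwt α X ≠ 0 := by
  by_contra! h
  refine h1 (T.char_eq_of_exp fun X hX t => Units.ext ?_)
  rw [T.wt_exp hα hX, h X hX, mul_zero, Complex.exp_zero]
  rfl

theorem eq_inv_of_dwt {α β : charGroup T} (hα : α ∈ T.wts) (hβ : β ∈ T.wts)
    (h : ∀ X ∈ lieAlg T.carrier, T.dwt β X = -T.dwt α X) : β = α⁻¹ := by
  refine T.char_eq_of_exp fun X hX t => Units.ext ?_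
  have h2 : ∀ x, ((α⁻¹ : charGroup T).1 x : ℂ) = (α.1 x : ℂ)⁻¹ := fun x => by simp
  rw [h2, T.wt_exp hα hX, T.wt_exp hβ hX, h X hX, ← Complex.exp_neg, mul_neg]

theorem isWeightVec_one_iff {Y : Matrix (Fin n) (Fin n) ℂ} :
    T.IsWeightVec 1 Y ↔ ∀ t ∈ T.carrier, Commute t.1 Y := by
  constructor
  · intro h t ht
    have h1 := h ⟨t, ht⟩
    have h2 : Ad t Y = Y := by simpa using h1
    have h3 := congrArg (· * t.1) h2
    simp only [Ad, mul_assoc, ← Units.val_mul, inv_mul_cancel, Units.val_one, mul_one] at h3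
    exact h3
  · intro h t
    have h1 := h t t.2
    have h2 : Ad (t : GL (Fin n) ℂ) Y = Y := by
      rw [Ad, h1.eq, mul_assoc, ← Units.val_mul, mul_inv_cancel, Units.val_one, mul_one]
    simpa using h2

theorem IsWeightVec.lie {T : Torus n} {α β : charGroup T} {X Y : Matrix (Fin n) (Fin n) ℂ}
    (hX : T.IsWeightVec α X) (hY : T.IsWeightVec β Y) : T.IsWeightVec (α * β) ⁅X, Y⁆ := by
  intro t
  rw [Ad_lie, hX t, hY t, smul_lie, lie_smul, smul_smul]
  rfl

theorem IsWeightVec.smul {T : Torus n} {α : charGroup T} {X : Matrix (Fin n) (Fin n) ℂ}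
    (hX : T.IsWeightVec α X) (c : ℂ) : T.IsWeightVec α (c • X) := by
  intro t
  rw [Ad_smul, hX t, smul_comm]

end Torus

/-! ### Semisimple elements that commute with a maximal torus -/

/-- Commuting diagonalizable matrices are diagonalized by a common matrix. -/
theorem exists_common_diagonalizer {n : ℕ} {ι : Type*} (A : ι → Matrix (Fin n) (Fin n) ℂ)
    (hA : ∀ i, Module.End.IsSemisimple (Matrix.toLin' (A i)))
    (hcomm : ∀ i j, Commute (A i) (A j)) :
    ∃ P : GL (Fin n) ℂ, ∀ i, (Ad P (A i)).IsDiag := by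
  have h := span_joint_eigenvectors_eq_top (fun i => Matrix.toLin' (A i)) hA (fun i j => by
    rw [commute_iff_eq, Module.End.mul_eq_comp, Module.End.mul_eq_comp, ← Matrix.toLin'_mul,
      ← Matrix.toLin'_mul, (hcomm i j).eq])
  obtain ⟨b₀, hb₀⟩ := exists_basis_mem_of_span_eq_top h
  let b : Module.Basis (Fin n) ℂ (Fin n → ℂ) :=
    b₀.reindex (finCongr (Module.finrank_fin_fun ℂ))
  have hb : ∀ i j, ∃ c : ℂ, (A i).mulVec (b j) = c • b j := by
    intro i j
    rw [Module.Basis.reindex_apply]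
    exact hb₀ _ i
  choose c hc using hb
  let Q : Matrix (Fin n) (Fin n) ℂ := Matrix.of fun i j => b j i
  have hQ : Q = (Pi.basisFun ℂ (Fin n)).toMatrix b := by
    ext i j
    simp [Q, Module.Basis.toMatrix_apply]
  have hQu : IsUnit Q := by
    rw [hQ]
    have := Module.Basis.invertibleToMatrix (Pi.basisFun ℂ (Fin n)) b
    exact isUnit_of_invertible _
  obtain ⟨q, hq⟩ := hQu
  refine ⟨q⁻¹, fun i => ?_⟩
  have h1 : A i * Q = Q * Matrix.diagonal (c i) := by
    ext k j
    have h2 := congrFun (hc i j) k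
    rw [Matrix.mul_diagonal]
    simp only [Matrix.mulVec, dotProduct, Pi.smul_apply, smul_eq_mul] at h2
    rw [Matrix.mul_apply]
    exact h2.trans (mul_comm _ _)
  have h2 : Ad q⁻¹ (A i) = Matrix.diagonal (c i) := by
    rw [Ad, inv_inv, mul_assoc, hq, h1, ← mul_assoc, ← hq, ← Units.val_mul, inv_mul_cancel,
      Units.val_one, one_mul]
  rw [h2]
  exact Matrix.isDiag_diagonal _

theorem IsZariskiClosed.translate {n : ℕ} {Z : Set (GL (Fin n) ℂ)} (hZ : IsZariskiClosed ℂ Z)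
    (g : GL (Fin n) ℂ) : IsZariskiClosed ℂ {t : GL (Fin n) ℂ | t * g ∈ Z} := by
  refine isZariskiClosed_iff.2 ⟨translateRight g.1 '' vanIdeal Z, ?_⟩
  ext t
  rw [Set.mem_ofPred_eq, hZ.mem_iff, Set.mem_ofPred_eq, Set.forall_mem_image]
  refine forall₂_congr fun p _ => ?_
  rw [ev_translateRight, ← Units.val_mul]

namespace Torus

variable {n : ℕ} (T : Torus n)

theorem isSemisimple_toLin' (t : T.carrier) :
    Module.End.IsSemisimple (Matrix.toLin' (t : GL (Fin n) ℂ).1) := by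
  refine isSemisimple_of_span_eigenvectors (eq_top_iff.2 fun v _ => ?_)
  have h1 : (t : GL (Fin n) ℂ).1 * (T.diagonalizer⁻¹).1 = (T.diagonalizer⁻¹).1 *
      Matrix.diagonal fun i => ((T.diagChar i).1 t : ℂ) := by
    rw [← conj_eq_diagonal, ← Units.val_mul, ← Units.val_mul]
    congr 1
    group
  have h2 : v = ∑ i, (T.diagonalizer.1.mulVec v) i •
      (T.diagonalizer⁻¹).1.mulVec (Pi.single i 1) := by
    have h3 : v = (T.diagonalizer⁻¹).1.mulVec (T.diagonalizer.1.mulVec v) := by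
      rw [Matrix.mulVec_mulVec, ← Units.val_mul, inv_mul_cancel, Units.val_one, Matrix.one_mulVec]
    have h4 := Pi.basisFun ℂ (Fin n) |>.sum_repr (T.diagonalizer.1.mulVec v)
    conv_lhs => rw [h3, ← h4]
    simp only [Matrix.mulVec_sum, Matrix.mulVec_smul, Pi.basisFun_repr, Pi.basisFun_apply]
  rw [h2]
  refine sum_mem fun i _ => Submodule.smul_mem _ _ (Submodule.subset_span
    ⟨((T.diagChar i).1 t : ℂ), ?_⟩)
  rw [Matrix.toLin'_apply, Matrix.mulVec_mulVec, h1, ← Matrix.mulVec_mulVec,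
    Matrix.diagonal_mulVec_single, mul_one, ← Matrix.mulVec_smul]
  congr 1
  ext j
  simp [Pi.single_apply]

theorem expGL_comm {S : Matrix (Fin n) (Fin n) ℂ} (hS : T.IsWeightVec 1 S)
    {t : GL (Fin n) ℂ} (ht : t ∈ T.carrier) (z : ℂ) :
    t * expGL (z • S) = expGL (z • S) * t := by
  have h1 : Ad t S = S := by simpa using hS ⟨t, ht⟩
  have h2 := conj_expGL t (z • S)
  rw [Ad_smul, h1] at h2
  exact mul_inv_eq_iff_eq_mul.1 h2

/-- The group generated by the torus and a one-parameter group that commutes with it. -/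
def adjoin (S : Matrix (Fin n) (Fin n) ℂ) (hS : T.IsWeightVec 1 S) : Subgroup (GL (Fin n) ℂ) where
  carrier := {g | ∃ t ∈ T.carrier, ∃ z : ℂ, g = t * expGL (z • S)}
  one_mem' := ⟨1, one_mem _, 0, by rw [zero_smul, expGL_zero, mul_one]⟩
  mul_mem' := by
    rintro _ _ ⟨t, ht, z, rfl⟩ ⟨s, hs, w, rfl⟩
    refine ⟨t * s, mul_mem ht hs, z + w, ?_⟩
    rw [expGL_add_smul, mul_assoc, ← mul_assoc (expGL _), ← T.expGL_comm hS hs]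
    group
  inv_mem' := by
    rintro _ ⟨t, ht, z, rfl⟩
    refine ⟨t⁻¹, inv_mem ht, -z, ?_⟩
    rw [mul_inv_rev, expGL_inv, ← neg_smul, T.expGL_comm hS (inv_mem ht)]

theorem adjoin_subset_of_one_mem (S : Matrix (Fin n) (Fin n) ℂ) (hS : T.IsWeightVec 1 S)
    {Z₁ Z₂ : Set (GL (Fin n) ℂ)} (h1 : IsZariskiClosed ℂ Z₁) (h2 : IsZariskiClosed ℂ Z₂)
    (hcov : (T.adjoin S hS : Set (GL (Fin n) ℂ)) ⊆ Z₁ ∪ Z₂)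
    (hdisj : (T.adjoin S hS : Set (GL (Fin n) ℂ)) ∩ Z₁ ∩ Z₂ = ∅) (hone : (1 : GL (Fin n) ℂ) ∈ Z₁) :
    (T.adjoin S hS : Set (GL (Fin n) ℂ)) ⊆ Z₁ := by
  have hmem : ∀ t ∈ T.carrier, ∀ z : ℂ, t * expGL (z • S) ∈ T.adjoin S hS :=
    fun t ht z => ⟨t, ht, z, rfl⟩
  have hdisj' : ∀ g ∈ T.adjoin S hS, g ∈ Z₁ → g ∉ Z₂ := by
    intro g hg hg1 hg2
    have : g ∈ (T.adjoin S hS : Set (GL (Fin n) ℂ)) ∩ Z₁ ∩ Z₂ := ⟨⟨hg, hg1⟩, hg2⟩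
    rw [hdisj] at this
    exact this
  have hexp : ∀ z : ℂ, expGL (z • S) ∈ Z₁ := by
    obtain ⟨f₂, hf₂, hne⟩ : ∃ f ∈ vanIdeal Z₂, ev (1 : GL (Fin n) ℂ).1 f ≠ 0 := by
      by_contra! hall
      exact hdisj' 1 (one_mem _) hone (h2.mem_iff.2 hall)
    have hdiff : ∀ f : MatPoly n, AnalyticOnNhd ℂ (fun z : ℂ => ev (expGL (z • S)).1 f)
        Set.univ := by
      intro f
      refine DifferentiableOn.analyticOnNhd (fun z _ => ?_) isOpen_univ
      have h := (hasDerivAt_ev_exp S 1 f z).differentiableAt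
      simp only [one_mul] at h
      exact h.differentiableWithinAt
    intro z
    rw [h1.mem_iff]
    intro f₁ hf₁
    have hprod : ∀ z : ℂ, ev (expGL (z • S)).1 f₁ * ev (expGL (z • S)).1 f₂ = 0 := by
      intro z
      have hz := hmem 1 (one_mem _) z
      rw [one_mul] at hz
      rcases hcov hz with h | h
      · rw [hf₁ _ h, zero_mul]
      · rw [hf₂ _ h, mul_zero]
    rcases AnalyticOnNhd.eq_zero_or_eq_zero_of_mul_eq_zero (hdiff f₁) (hdiff f₂)
      (fun z _ => hprod z) isPreconnected_univ with h | h
    · exact h z trivial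
    · exfalso
      have h0 := h 0 trivial
      simp only [zero_smul, expGL_zero] at h0
      exact hne h0
  rintro _ ⟨t, ht, z, rfl⟩
  rcases T.connected _ _ (h1.translate _) (h2.translate _) (fun t ht => hcov (hmem t ht z)) (by
      ext t
      simp only [Set.mem_inter_iff, Set.mem_empty_iff_false, iff_false, not_and]
      rintro ⟨ht, h⟩
      exact hdisj' _ (hmem t ht z) h) with h | h
  · exact h ht
  · have h3 := h (one_mem T.carrier)
    change 1 * expGL (z • S) ∈ Z₂ at h3
    rw [one_mul] at h3
    have h4 := hmem 1 (one_mem _) z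
    rw [one_mul] at h4
    exact absurd h3 (hdisj' _ h4 (hexp z))

theorem adjoin_connected (S : Matrix (Fin n) (Fin n) ℂ) (hS : T.IsWeightVec 1 S) :
    IsZariskiConnected (T.adjoin S hS : Set (GL (Fin n) ℂ)) := by
  intro Z₁ Z₂ h1 h2 hcov hdisj
  rcases hcov (one_mem (T.adjoin S hS)) with h | h
  · exact Or.inl (T.adjoin_subset_of_one_mem S hS h1 h2 hcov hdisj h)
  · refine Or.inr (T.adjoin_subset_of_one_mem S hS h2 h1 (by rwa [Set.union_comm]) ?_ h)
    rw [← hdisj, Set.inter_assoc, Set.inter_assoc, Set.inter_comm Z₂]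

/-- The torus obtained from `T` and a semisimple element `S` of the Lie algebra that commutes
with `T`. -/
def extend (S : Matrix (Fin n) (Fin n) ℂ) (hS : T.IsWeightVec 1 S)
    (hss : Module.End.IsSemisimple (Matrix.toLin' S)) : Torus n where
  carrier := zariskiClosure (T.adjoin S hS)
  closed := zariskiClosure_isZariskiClosed _
  connected := zariskiClosure_connected (T.adjoin_connected S hS)
  diagonalizable := by
    let A : Option T.carrier → Matrix (Fin n) (Fin n) ℂ :=
      fun i => i.elim S fun t => (t : GL (Fin n) ℂ).1
    obtain ⟨P, hP⟩ := exists_common_diagonalizer A (by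
      rintro (_ | t)
      exacts [hss, T.isSemisimple_toLin' t]) (by
      have h := T.isWeightVec_one_iff.1 hS
      rintro (_ | t) (_ | s)
      · exact Commute.refl S
      · exact (h s s.2).symm
      · exact h t t.2
      · exact congrArg Units.val (T.comm t.2 s.2))
    refine ⟨P, fun g hg => ?_⟩
    intro i j hij
    let f : MatPoly n := ∑ k, ∑ l, (P.1 i k * (P⁻¹).1 l j) • MvPolynomial.X (k, l)
    have hf : ∀ g : GL (Fin n) ℂ, ev g.1 f = (P * g * P⁻¹).1 i j := by
      intro g
      simp only [f, map_sum, map_smul, ev_X, smul_eq_mul]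
      rw [Units.val_mul, Units.val_mul, Matrix.mul_apply, Finset.sum_comm]
      refine Finset.sum_congr rfl fun l _ => ?_
      rw [Matrix.mul_apply, Finset.sum_mul]
      exact Finset.sum_congr rfl fun k _ => by ring
    rw [← hf]
    refine hg f ?_
    rintro _ ⟨t, ht, z, rfl⟩
    rw [hf]
    have h1 : P * (t * expGL (z • S)) * P⁻¹ = P * t * P⁻¹ * (P * expGL (z • S) * P⁻¹) := by
      group
    have h2 : (P * t * P⁻¹).1.IsDiag := hP (some ⟨t, ht⟩)
    have h3 : (Ad P S).IsDiag := hP none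
    rw [h1, conj_expGL, Ad_smul, Units.val_mul, expGL_val, ← h3.diagonal_diag, ← h2.diagonal_diag,
      ← Matrix.diagonal_smul, Matrix.exp_diagonal, Matrix.diagonal_mul_diagonal]
    exact Matrix.diagonal_apply_ne _ hij

/-- A semisimple element of the Lie algebra that commutes with a maximal torus lies in the Lie
algebra of the torus. -/
theorem mem_lieAlg_of_isSemisimple {G : Subgroup (GL (Fin n) ℂ)}
    (hG : IsZariskiClosed ℂ (G : Set (GL (Fin n) ℂ))) (hT : IsMaximalTorus G T)
    {S : Matrix (Fin n) (Fin n) ℂ} (hSG : S ∈ lieAlg G) (hS : T.IsWeightVec 1 S)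
    (hss : Module.End.IsSemisimple (Matrix.toLin' S)) : S ∈ lieAlg T.carrier := by
  have hle : (T.adjoin S hS : Set (GL (Fin n) ℂ)) ⊆ G := by
    rintro _ ⟨t, ht, z, rfl⟩
    exact mul_mem (hT.1 ht) (expGL_mem hG hSG z)
  have h := hT.2 (T.extend S hS hss) (zariskiClosure_subset hG hle) (fun t ht =>
    le_zariskiClosure _ ⟨t, ht, 0, by rw [zero_smul, expGL_zero, mul_one]⟩)
  rw [mem_lieAlg_iff_exp, ← h]
  intro t
  refine le_zariskiClosure _ ⟨1, one_mem _, t, ?_⟩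
  rw [one_mul, Complex.coe_smul]

end Torus

/-! ### Compact forms and the Killing form -/

theorem trace_sq_of_imaginary {E : Type*} [AddCommGroup E] [Module ℂ E] [FiniteDimensional ℂ E]
    (A : Module.End ℂ E)
    (h : Submodule.span ℂ {w | ∃ y : ℝ, A w = (y * Complex.I) • w} = ⊤) :
    ∃ r : ℝ, 0 ≤ r ∧ LinearMap.trace ℂ E (A ∘ₗ A) = -r ∧ (r = 0 → A = 0) := by
  obtain ⟨b, hb⟩ := exists_basis_mem_of_span_eq_top h
  choose y hy using hb
  refine ⟨∑ i, y i ^ 2, Finset.sum_nonneg fun i _ => sq_nonneg _, ?_, fun h0 => b.ext fun i => ?_⟩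
  · rw [LinearMap.trace_eq_matrix_trace ℂ b, Matrix.trace]
    push_cast
    rw [← Finset.sum_neg_distrib]
    refine Finset.sum_congr rfl fun i _ => ?_
    rw [Matrix.diag_apply, LinearMap.toMatrix_apply, LinearMap.comp_apply, hy, map_smul, hy,
      smul_smul, map_smul, Module.Basis.repr_self, Finsupp.smul_single, Finsupp.single_eq_same,
      smul_eq_mul, mul_one, mul_mul_mul_comm, Complex.I_mul_I]
    ring
  · have h1 := (Finset.sum_eq_zero_iff_of_nonneg fun i _ => sq_nonneg (y i)).1 h0 i
      (Finset.mem_univ i)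
    rw [hy, pow_eq_zero_iff two_ne_zero |>.1 h1]
    simp

section Abstract

variable {L : Type*} [LieRing L] [LieAlgebra ℂ L]

theorem mem_center_iff {x : L} : x ∈ LieAlgebra.center ℂ L ↔ ∀ y : L, ⁅x, y⁆ = 0 := by
  rw [LieModule.mem_maxTrivSubmodule]
  refine forall_congr' fun y => ?_
  rw [← lie_skew, neg_eq_zero]

/-- The image of `x` in the quotient by the centre. -/
abbrev modCenter (x : L) : L ⧸ LieAlgebra.center ℂ L := LieSubmodule.Quotient.mk x

theorem modCenter_lie (x y : L) : modCenter ⁅x, y⁆ = ⁅modCenter x, modCenter y⁆ :=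
  LieSubmodule.Quotient.mk_bracket (I := LieAlgebra.center ℂ L) x y

theorem modCenter_eq_zero {x : L} : modCenter x = 0 ↔ x ∈ LieAlgebra.center ℂ L :=
  LieSubmodule.Quotient.mk_eq_zero'

theorem modCenter_surjective : Function.Surjective (modCenter (L := L)) :=
  LieSubmodule.Quotient.surjective_mk' _

theorem modCenter_add (x y : L) : modCenter (x + y) = modCenter x + modCenter y := rfl

theorem modCenter_smul (c : ℂ) (x : L) : modCenter (c • x) = c • modCenter x := rfl

/-- If the fixed points of a conjugation act with imaginary eigenvalues, as the Lie algebra of a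
compact group does, then the Killing form modulo the centre is nondegenerate. -/
theorem isKilling_of_compact_form [FiniteDimensional ℂ L] (σ : L → L)
    (hadd : ∀ x y, σ (x + y) = σ x + σ y)
    (hsmul : ∀ (c : ℂ) x, σ (c • x) = (starRingEnd ℂ c) • σ x) (hinv : ∀ x, σ (σ x) = x)
    (h : ∀ x, σ x = x →
      Submodule.span ℂ {w : L | ∃ y : ℝ, ⁅x, w⁆ = ((y : ℂ) * Complex.I) • w} = ⊤) :
    LieAlgebra.IsKilling ℂ (L ⧸ LieAlgebra.center ℂ L) := by
  have htr : ∀ x, σ x = x → ∃ r : ℝ, 0 ≤ r ∧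
      killingForm ℂ (L ⧸ LieAlgebra.center ℂ L) (modCenter x) (modCenter x) = -r ∧
        (r = 0 → modCenter x = 0) := by
    intro x hx
    obtain ⟨r, hr0, hr, hz⟩ := trace_sq_of_imaginary
      (LieAlgebra.ad ℂ (L ⧸ LieAlgebra.center ℂ L) (modCenter x)) (by
        rw [eq_top_iff]
        rintro w -
        obtain ⟨w, rfl⟩ := modCenter_surjective w
        have hw : w ∈ Submodule.span ℂ {w : L | ∃ y : ℝ, ⁅x, w⁆ = ((y : ℂ) * Complex.I) • w} :=
          h x hx ▸ Submodule.mem_top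
        induction hw using Submodule.span_induction with
        | mem w hw =>
          obtain ⟨y, hy⟩ := hw
          refine Submodule.subset_span ⟨y, ?_⟩
          rw [LieAlgebra.ad_apply, ← modCenter_lie, hy, modCenter_smul]
        | zero => exact Submodule.zero_mem _
        | add v w _ _ hv hw => exact add_mem hv hw
        | smul c v _ hv => exact Submodule.smul_mem _ c hv)
    refine ⟨r, hr0, hr, fun h0 => ?_⟩
    have had := hz h0
    rw [modCenter_eq_zero, mem_center_iff]
    intro w
    have hw : w ∈ Submodule.span ℂ {w : L | ∃ y : ℝ, ⁅x, w⁆ = ((y : ℂ) * Complex.I) • w} :=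
      h x hx ▸ Submodule.mem_top
    induction hw using Submodule.span_induction with
    | mem w hw =>
      obtain ⟨y, hy⟩ := hw
      have h1 := LinearMap.congr_fun had (modCenter w)
      rw [LieAlgebra.ad_apply, ← modCenter_lie, LinearMap.zero_apply, modCenter_eq_zero, hy] at h1
      by_cases hy0 : ((y : ℂ) * Complex.I) = 0
      · rw [hy, hy0, zero_smul]
      · have h2 := (LieAlgebra.center ℂ L).smul_mem ((y : ℂ) * Complex.I)⁻¹ h1
        rw [smul_smul, inv_mul_cancel₀ hy0, one_smul] at h2
        rw [← lie_skew, mem_center_iff.1 h2, neg_zero]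
    | zero => simp
    | add v w _ _ hv hw => rw [lie_add, hv, hw, add_zero]
    | smul c v _ hv => rw [lie_smul, hv, smul_zero]
  refine ⟨?_⟩
  rw [eq_bot_iff]
  intro x hx
  obtain ⟨x, rfl⟩ := modCenter_surjective x
  rw [LieIdeal.mem_killingCompl] at hx
  set a : L := (1 / 2 : ℂ) • (x + σ x) with ha
  set b : L := (-(1 / 2) * Complex.I : ℂ) • (x - σ x) with hb
  have hneg : ∀ y, σ (-y) = -σ y := by
    intro y
    have := hsmul (-1) y
    simpa using this
  have hσa : σ a = a := by
    rw [ha, hsmul, hadd, hinv, add_comm (σ x)]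
    congr 1
    simp [Complex.conj_ofNat]
  have hσb : σ b = b := by
    rw [hb, hsmul, sub_eq_add_neg, hadd, hneg, hinv]
    have : (starRingEnd ℂ) (-(1 / 2) * Complex.I) = (1 / 2) * Complex.I := by
      simp [Complex.conj_ofNat]
    rw [this]
    module
  have hx1 : x = a + Complex.I • b := by
    rw [ha, hb, smul_smul, show Complex.I * (-(1 / 2) * Complex.I) = 1 / 2 by
      linear_combination (-(1 / 2 : ℂ)) * Complex.I_mul_I]
    module
  have hx2 : σ x = a + (-Complex.I) • b := by
    rw [ha, hb, smul_smul, show -Complex.I * (-(1 / 2) * Complex.I) = -(1 / 2) by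
      linear_combination (1 / 2 : ℂ) * Complex.I_mul_I]
    module
  obtain ⟨r, hr0, hr, hra⟩ := htr a hσa
  obtain ⟨s, hs0, hs, hsb⟩ := htr b hσb
  clear_value a b
  have h0 := hx (modCenter (σ x)) trivial
  rw [hx2, hx1, modCenter_add, modCenter_add, modCenter_smul, modCenter_smul] at h0
  simp only [map_add, map_smul, LinearMap.add_apply, LinearMap.smul_apply, smul_eq_mul] at h0
  rw [LieModule.traceForm_comm ℂ (L ⧸ LieAlgebra.center ℂ L) (L ⧸ LieAlgebra.center ℂ L)
    (modCenter b) (modCenter a)] at h0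
  have h1 : (r : ℂ) + s = 0 := by
    have h2 : killingForm ℂ (L ⧸ LieAlgebra.center ℂ L) (modCenter a) (modCenter a) +
        killingForm ℂ (L ⧸ LieAlgebra.center ℂ L) (modCenter b) (modCenter b) = 0 := by
      linear_combination h0 + (killingForm ℂ (L ⧸ LieAlgebra.center ℂ L) (modCenter b)
        (modCenter b)) * Complex.I_mul_I
    rw [hr, hs] at h2
    linear_combination -h2
  have h2 : r + s = 0 := by exact_mod_cast h1
  rw [hx1, modCenter_add, modCenter_smul, hra (by linarith), hsb (by linarith), smul_zero,
    add_zero]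
  exact LieSubmodule.zero_mem _

end Abstract

/-! ### The compact form of a Shimura datum -/

/-- Entrywise complex conjugation of matrices. -/
def conjMat {n : ℕ} (Y : Matrix (Fin n) (Fin n) ℂ) : Matrix (Fin n) (Fin n) ℂ :=
  Y.map (starRingEnd ℂ)

theorem conjMat_apply {n : ℕ} (Y : Matrix (Fin n) (Fin n) ℂ) (i j : Fin n) :
    conjMat Y i j = starRingEnd ℂ (Y i j) := rfl

theorem conjMat_add {n : ℕ} (X Y : Matrix (Fin n) (Fin n) ℂ) :
    conjMat (X + Y) = conjMat X + conjMat Y := by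
  ext i j
  simp [conjMat_apply]

theorem conjMat_smul {n : ℕ} (c : ℂ) (Y : Matrix (Fin n) (Fin n) ℂ) :
    conjMat (c • Y) = starRingEnd ℂ c • conjMat Y := by
  ext i j
  simp [conjMat_apply]

theorem conjMat_conjMat {n : ℕ} (Y : Matrix (Fin n) (Fin n) ℂ) : conjMat (conjMat Y) = Y := by
  ext i j
  simp [conjMat_apply]

theorem conj_val {n : ℕ} (g : GL (Fin n) ℂ) : (conj g).1 = conjMat g.1 := rfl

theorem conjMat_exp {n : ℕ} (Y : Matrix (Fin n) (Fin n) ℂ) :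
    conj (expGL Y) = expGL (conjMat Y) := by
  apply Units.ext
  have h1 : ∀ A : Matrix (Fin n) (Fin n) ℂ, conjMat A = A.conjTranspose.transpose := fun A => rfl
  rw [conj_val, expGL_val, expGL_val, h1, h1, Matrix.exp_transpose, Matrix.exp_conjTranspose]

theorem conjMat_Ad {n : ℕ} (g : GL (Fin n) ℂ) (Y : Matrix (Fin n) (Fin n) ℂ) :
    conjMat (Ad g Y) = Ad (conj g) (conjMat Y) := by
  have h : ∀ A B : Matrix (Fin n) (Fin n) ℂ, conjMat (A * B) = conjMat A * conjMat B :=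
    fun A B => Matrix.map_mul
  rw [Ad, h, h, Ad, ← map_inv, conj_val, conj_val]

theorem conj_mem_of_rational {n : ℕ} {G : Subgroup (GL (Fin n) ℂ)}
    (hG : IsZariskiClosed ℚ (G : Set (GL (Fin n) ℂ))) {g : GL (Fin n) ℂ} (hg : g ∈ G) :
    conj g ∈ G := by
  obtain ⟨F, hF⟩ := hG
  change g ∈ (G : Set (GL (Fin n) ℂ)) at hg
  change conj g ∈ (G : Set (GL (Fin n) ℂ))
  rw [hF] at hg ⊢
  intro f hf
  have h1 : (MvPolynomial.aeval fun p : Fin n × Fin n => (conj g).1 p.1 p.2) f =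
      starRingEnd ℂ ((MvPolynomial.aeval fun p : Fin n × Fin n => g.1 p.1 p.2) f) := by
    have h2 := MvPolynomial.map_aeval (fun p : Fin n × Fin n => g.1 p.1 p.2) (starRingEnd ℂ) f
    rw [h2, MvPolynomial.aeval_def]
    congr 1
    exact Subsingleton.elim _ _
  rw [h1, hg f hf, map_zero]

theorem conjMat_mem_lieAlg {n : ℕ} {G : Subgroup (GL (Fin n) ℂ)}
    (hG : IsZariskiClosed ℚ (G : Set (GL (Fin n) ℂ))) {Y : Matrix (Fin n) (Fin n) ℂ}
    (hY : Y ∈ lieAlg G) : conjMat Y ∈ lieAlg G := by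
  rw [mem_lieAlg_iff_exp] at *
  intro t
  have h : t • conjMat Y = conjMat (t • Y) := by
    rw [← Complex.coe_smul, ← Complex.coe_smul, conjMat_smul, Complex.conj_ofReal]
  rw [h, ← conjMat_exp]
  exact conj_mem_of_rational hG (hY t)

theorem eq_of_expGL_eq {n : ℕ} {X Y : Matrix (Fin n) (Fin n) ℂ}
    (h : ∀ t : ℝ, expGL ((t : ℂ) • X) = expGL ((t : ℂ) • Y)) : X = Y := by
  ext i j
  have h1 := (hasDerivAt_exp_entry X i j ((0 : ℝ) : ℂ)).comp_ofReal
  have h2 := (hasDerivAt_exp_entry Y i j ((0 : ℝ) : ℂ)).comp_ofReal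
  have h3 : (fun t : ℝ => (NormedSpace.exp ((t : ℂ) • X) : Matrix (Fin n) (Fin n) ℂ) i j) =
      fun t : ℝ => (NormedSpace.exp ((t : ℂ) • Y) : Matrix (Fin n) (Fin n) ℂ) i j := by
    funext t
    exact congrArg (fun g : GL (Fin n) ℂ => g.1 i j) (h t)
  rw [h3] at h1
  simpa using h1.unique h2

theorem Ad_center {n : ℕ} {G : Subgroup (GL (Fin n) ℂ)} {c : G} (hc : c ∈ Subgroup.center G)
    {W : Matrix (Fin n) (Fin n) ℂ} (hW : W ∈ lieAlg G) : Ad (c : GL (Fin n) ℂ) W = W := by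
  refine eq_of_expGL_eq fun t => ?_
  rw [← Ad_smul, ← conj_expGL]
  have hm : expGL ((t : ℂ) • W) ∈ G := by
    rw [Complex.coe_smul]
    exact mem_lieAlg_iff_exp.1 hW t
  have h := congrArg Subtype.val (Subgroup.mem_center_iff.1 hc ⟨_, hm⟩)
  change expGL ((t : ℂ) • W) * c = c * expGL ((t : ℂ) • W) at h
  rw [← h, mul_assoc, mul_inv_cancel, mul_one]

/-- A one-parameter group with image in a compact subset of the adjoint group has bounded adjoint
action. -/
theorem bounded_Ad_exp {n : ℕ} {G : Subgroup (GL (Fin n) ℂ)} {S : Set G}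
    (hS : IsCompact ((fun g : G => (QuotientGroup.mk g : G ⧸ Subgroup.center G)) '' S))
    {W : Matrix (Fin n) (Fin n) ℂ} (hW : W ∈ lieAlg G) (i j : Fin n) :
    ∃ C : ℝ, ∀ g ∈ S, ‖Ad (g : GL (Fin n) ℂ) W i j‖ ≤ C := by
  let φ : G ⧸ Subgroup.center G → ℂ := Quotient.lift (fun g : G => Ad (g : GL (Fin n) ℂ) W i j) (by
    intro a b hab
    have h := QuotientGroup.leftRel_apply.1 hab
    have h1 : (b : GL (Fin n) ℂ) = a * ((a⁻¹ * b : G) : GL (Fin n) ℂ) := by simp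
    change Ad _ _ _ _ = Ad _ _ _ _
    rw [h1, Ad_mul, Ad_center h hW])
  have hφ : Continuous φ := by
    refine Continuous.quotient_lift ?_ _
    have h1 : Continuous fun g : G => ((g : GL (Fin n) ℂ).1 : Matrix (Fin n) (Fin n) ℂ) :=
      Units.continuous_val.comp continuous_subtype_val
    have h2 : Continuous fun g : G => (((g : GL (Fin n) ℂ)⁻¹).1 : Matrix (Fin n) (Fin n) ℂ) :=
      Units.continuous_val.comp (continuous_inv.comp continuous_subtype_val)
    exact ((h1.matrix_mul continuous_const).matrix_mul h2).matrix_elem i j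
  obtain ⟨C, hC⟩ := hS.exists_bound_of_continuousOn hφ.continuousOn
  exact ⟨C, fun g hg => hC _ ⟨g, hg, rfl⟩⟩

theorem re_eq_zero_of_bounded {c w : ℂ} (hw : w ≠ 0) {C : ℝ}
    (h : ∀ t : ℝ, ‖Complex.exp (t * c) * w‖ ≤ C) : c.re = 0 := by
  by_contra hne
  have hw' : 0 < ‖w‖ := norm_pos_iff.2 hw
  have h1 : ∀ s : ℝ, Real.exp s ≤ C / ‖w‖ := by
    intro s
    have h2 := h (s / c.re)
    rw [norm_mul, Complex.norm_exp] at h2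
    have h3 : (((s / c.re : ℝ) : ℂ) * c).re = s := by
      rw [Complex.re_ofReal_mul]
      field_simp
    rw [h3] at h2
    exact (le_div_iff₀ hw').2 h2
  have h4 := h1 (C / ‖w‖)
  have h5 := Real.add_one_le_exp (C / ‖w‖)
  linarith

theorem eq_zero_of_bounded_linear {u w : ℂ} {C : ℝ} (h : ∀ t : ℝ, ‖w + t * u‖ ≤ C) : u = 0 := by
  by_contra hne
  have hu : 0 < ‖u‖ := norm_pos_iff.2 hne
  have h1 : ∀ s : ℝ, 0 ≤ s → s * ‖u‖ ≤ C + ‖w‖ := by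
    intro s hs
    have h2 := norm_sub_le (w + s * u) w
    rw [add_sub_cancel_left, norm_mul, Complex.norm_real, Real.norm_of_nonneg hs] at h2
    linarith [h s]
  have h3 : 0 ≤ C + ‖w‖ := by simpa using h1 0 le_rfl
  have h4 := h1 ((C + ‖w‖ + 1) / ‖u‖) (by positivity)
  rw [div_mul_cancel₀ _ hu.ne'] at h4
  linarith

/-- If the one-parameter group of `Y` has bounded adjoint action on an invariant space of matrices,
then `ad Y` is diagonalizable there with imaginary eigenvalues. -/
theorem span_imaginary_of_bounded {n : ℕ} (L : LieSubalgebra ℂ (Matrix (Fin n) (Fin n) ℂ)) (Y : L)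
    (hbd : ∀ W ∈ L, ∀ i j, ∃ C : ℝ, ∀ t : ℝ,
      ‖Ad (expGL ((t : ℂ) • (Y : Matrix (Fin n) (Fin n) ℂ))) W i j‖ ≤ C) :
    Submodule.span ℂ {w : L | ∃ y : ℝ, ⁅Y, w⁆ = ((y : ℂ) * Complex.I) • w} = ⊤ := by
  set A : Module.End ℂ L := LieAlgebra.ad ℂ L Y with hA
  have heig : ∀ (c : ℂ) (w : L), ⁅Y, w⁆ = c • w → w ≠ 0 → c.re = 0 := by
    intro c w hw h0
    obtain ⟨i, j, hij⟩ : ∃ i j, (w : Matrix (Fin n) (Fin n) ℂ) i j ≠ 0 := by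
      by_contra! hall
      exact h0 (Subtype.ext (Matrix.ext hall))
    obtain ⟨C, hC⟩ := hbd w w.2 i j
    refine re_eq_zero_of_bounded hij (C := C) fun t => ?_
    have h1 := Ad_exp_of_lie (X := (Y : Matrix (Fin n) (Fin n) ℂ)) (W := w) (U := 0) (c := c)
      (by rw [add_zero]; exact congrArg Subtype.val hw) (by simp) t
    have h2 := hC t
    rw [h1, smul_zero, add_zero] at h2
    exact h2
  have hrank : ∀ (c : ℂ) (w : L), ((A - algebraMap ℂ (Module.End ℂ L) c) ^ 2) w = 0 →
      (A - algebraMap ℂ (Module.End ℂ L) c) w = 0 := by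
    intro c w hw
    set u := (A - algebraMap ℂ (Module.End ℂ L) c) w with hu
    rw [pow_two, Module.End.mul_apply, ← hu] at hw
    by_contra h0
    have hu1 : ⁅Y, u⁆ = c • u := by
      rw [LinearMap.sub_apply, Module.algebraMap_end_apply, sub_eq_zero] at hw
      exact hw
    have hw1 : ⁅Y, w⁆ = c • w + u := by
      rw [hu, LinearMap.sub_apply, Module.algebraMap_end_apply, add_sub_cancel]
      rfl
    have hre := heig c u hu1 h0
    refine h0 (Subtype.ext (Matrix.ext fun i j => ?_))
    obtain ⟨C, hC⟩ := hbd w w.2 i j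
    refine eq_zero_of_bounded_linear (w := (w : Matrix (Fin n) (Fin n) ℂ) i j) (C := C)
      fun t => ?_
    have h1 := Ad_exp_of_lie (X := (Y : Matrix (Fin n) (Fin n) ℂ)) (W := w) (U := u) (c := c)
      (congrArg Subtype.val hw1) (congrArg Subtype.val hu1) t
    have h2 := hC t
    rw [h1, Matrix.smul_apply, norm_smul, Complex.norm_exp, Complex.re_ofReal_mul, hre, mul_zero,
      Real.exp_zero, one_mul] at h2
    exact h2
  have hgen : ∀ (c : ℂ) (k : ℕ) (w : L), ((A - algebraMap ℂ (Module.End ℂ L) c) ^ k) w = 0 →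
      (A - algebraMap ℂ (Module.End ℂ L) c) w = 0 := by
    intro c k
    induction k with
    | zero =>
      intro w hw
      have hw' : w = 0 := hw
      rw [hw', map_zero]
    | succ k ih =>
      intro w hw
      rw [pow_succ, Module.End.mul_apply] at hw
      refine hrank c w ?_
      rw [pow_two, Module.End.mul_apply]
      exact ih _ hw
  rw [eq_top_iff, ← Module.End.iSup_maxGenEigenspace_eq_top A]
  refine iSup_le fun c w hw => Submodule.subset_span ?_
  obtain ⟨k, hk⟩ := Module.End.mem_maxGenEigenspace A c w |>.1 hw
  have h1 := hgen c k w hk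
  rw [LinearMap.sub_apply, Module.algebraMap_end_apply, sub_eq_zero] at h1
  by_cases h0 : w = 0
  · exact ⟨0, by rw [h0]; simp⟩
  · refine ⟨c.im, ?_⟩
    have h2 : (c.im : ℂ) * Complex.I = c := by
      apply Complex.ext <;> simp [heig c w h1 h0]
    rw [h2]
    exact h1

namespace IsShimuraDatum

variable {n : ℕ} {G : Subgroup (GL (Fin n) ℂ)} {X : Set (ℂˣ × ℂˣ →* GL (Fin n) ℂ)}

theorem closed (hGX : IsShimuraDatum G X) : IsZariskiClosed ℂ (G : Set (GL (Fin n) ℂ)) :=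
  hGX.reductive.closed

theorem conj_deligneI (hGX : IsShimuraDatum G X) {h : ℂˣ × ℂˣ →* GL (Fin n) ℂ} (hh : h ∈ X) :
    conj (h deligneI) = h deligneI := by
  have h1 := (hGX.hom h hh).real unitI (star unitI)
  rw [star_star] at h1
  exact h1.symm

theorem Ad_deligneI_sq (hGX : IsShimuraDatum G X) {h : ℂˣ × ℂˣ →* GL (Fin n) ℂ} (hh : h ∈ X)
    {Y : Matrix (Fin n) (Fin n) ℂ} (hY : Y ∈ lieAlg G) :
    Ad (h deligneI) (Ad (h deligneI) Y) = Y := by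
  have hsq : deligneI * deligneI = ((-1 : ℂˣ), (-1 : ℂˣ)) := by
    refine Prod.ext (Units.ext ?_) (Units.ext ?_) <;> simp [deligneI, unitI]
  rw [← Ad_mul, ← map_mul, hsq]
  obtain ⟨Y₁, h1, Y₂, h2, Y₃, h3, rfl⟩ := hGX.hodgeType h hh Y hY
  rw [Ad_add, Ad_add, h1.2, h2.2, h3.2]
  simp

/-- The Lie algebra of `G` modulo its centre has nondegenerate Killing form. -/
theorem isKilling (hGX : IsShimuraDatum G X) :
    LieAlgebra.IsKilling ℂ
      (lieSub G hGX.closed ⧸ LieAlgebra.center ℂ (lieSub G hGX.closed)) := by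
  obtain ⟨h, hh, -⟩ := hGX.conjClass
  have hG : h deligneI ∈ G := (hGX.hom h hh).mem _
  refine isKilling_of_compact_form (L := lieSub G hGX.closed)
    (fun Y => ⟨Ad (h deligneI) (conjMat Y), Ad_mem_lieAlg hG
      (conjMat_mem_lieAlg hGX.rational Y.2)⟩) ?_ ?_ ?_ ?_
  · intro Y Z
    apply Subtype.ext
    change Ad _ (conjMat (_ + _)) = _ + _
    rw [conjMat_add, Ad_add]
  · intro c Y
    apply Subtype.ext
    change Ad _ (conjMat (c • _)) = _ • _
    rw [conjMat_smul, Ad_smul]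
  · intro Y
    apply Subtype.ext
    change Ad _ (conjMat (Ad _ (conjMat _))) = _
    rw [conjMat_Ad, hGX.conj_deligneI hh, conjMat_conjMat, hGX.Ad_deligneI_sq hh Y.2]
  · intro Y hY
    have hY' : Ad (h deligneI) (conjMat (Y : Matrix (Fin n) (Fin n) ℂ)) = Y :=
      congrArg Subtype.val hY
    refine span_imaginary_of_bounded _ Y fun W hW i j => ?_
    obtain ⟨C, hC⟩ := bounded_Ad_exp (hGX.cartan h hh) hW i j
    refine ⟨C, fun t => hC ⟨_, expGL_mem hGX.closed Y.2 t⟩ ⟨1, ?_⟩⟩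
    change h deligneI * conj (expGL _) * _ = expGL _ * 1
    rw [mul_one, conjMat_exp, conj_expGL, conjMat_smul, Ad_smul, hY', Complex.conj_ofReal]

end IsShimuraDatum

/-! ### Roots of a Lie algebra with semisimple quotient by its centre -/

/-- `H` is a Cartan subalgebra of `L` (nilpotent and self-normalizing) whose elements lie in the
subspace `t`, up to elements that act nilpotently on `L`. -/
structure IsToralPair {L : Type*} [LieRing L] [LieAlgebra ℂ L] (t : Submodule ℂ L)
    (H : LieSubalgebra ℂ L) : Prop where
  le : ∀ x ∈ t, x ∈ H
  nilpotent : LieRing.IsNilpotent H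
  selfNormalizing : ∀ y, (∀ x ∈ H, ⁅x, y⁆ ∈ H) → y ∈ H
  jordan : ∀ x ∈ H, ∃ s ∈ t, IsNilpotent (LieAlgebra.ad ℂ L (x - s))

section Abstract

variable {L : Type*} [LieRing L] [LieAlgebra ℂ L]

/-- The projection to the quotient by the centre, as a homomorphism of Lie algebras. -/
def modCenterHom (L : Type*) [LieRing L] [LieAlgebra ℂ L] :
    L →ₗ⁅ℂ⁆ L ⧸ LieAlgebra.center ℂ L where
  toFun := modCenter
  map_add' := modCenter_add
  map_smul' := modCenter_smul
  map_lie' := modCenter_lie _ _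

/-- The image of a subalgebra in the quotient by the centre. -/
def LieSubalgebra.modCenter (H : LieSubalgebra ℂ L) :
    LieSubalgebra ℂ (L ⧸ LieAlgebra.center ℂ L) :=
  ((modCenterHom L).comp H.incl).range

theorem modCenter_mem {H : LieSubalgebra ℂ L} {x : L} (hx : x ∈ H) :
    modCenter x ∈ LieSubalgebra.modCenter H := ⟨⟨x, hx⟩, rfl⟩

namespace IsToralPair

variable {t : Submodule ℂ L} {H : LieSubalgebra ℂ L}

theorem center_le (h : IsToralPair t H) {x : L} (hx : x ∈ LieAlgebra.center ℂ L) : x ∈ H := by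
  refine h.selfNormalizing x fun y _ => ?_
  rw [← lie_skew, mem_center_iff.1 hx, neg_zero]
  exact H.zero_mem

theorem isCartan (h : IsToralPair t H) : (LieSubalgebra.modCenter H).IsCartanSubalgebra where
  nilpotent := by
    have := h.nilpotent
    exact Function.Surjective.lieAlgebra_isNilpotent
      (LieHom.surjective_rangeRestrict ((modCenterHom L).comp H.incl))
  self_normalizing := by
    refine le_antisymm (fun x hx => ?_) (LieSubalgebra.le_normalizer _)
    obtain ⟨y, rfl⟩ := modCenter_surjective x
    rw [LieSubalgebra.mem_normalizer_iff'] at hx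
    refine modCenter_mem (h.selfNormalizing y fun x hxH => ?_)
    obtain ⟨⟨z, hz⟩, hzx⟩ := hx _ (modCenter_mem hxH)
    have h1 : modCenter (⁅x, y⁆ - z) = 0 := by
      have h2 : modCenter z = ⁅modCenter x, modCenter y⁆ := hzx
      have h3 : modCenter (⁅x, y⁆ - z) = modCenter ⁅x, y⁆ - modCenter z := rfl
      rw [h3, h2, modCenter_lie, sub_self]
    have h4 := add_mem (h.center_le (modCenter_eq_zero.1 h1)) hz
    rwa [sub_add_cancel] at h4

variable [FiniteDimensional ℂ L] [LieAlgebra.IsKilling ℂ (L ⧸ LieAlgebra.center ℂ L)]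

/-- The elements of a Cartan subalgebra act semisimply modulo the centre, so that the nilpotent
parts are central. -/
theorem exists_sub_mem_center (h : IsToralPair t H) {x : L} (hx : x ∈ H) :
    ∃ s ∈ t, modCenter x = modCenter s := by
  have := h.isCartan
  obtain ⟨s, hs, hnil⟩ := h.jordan x hx
  refine ⟨s, hs, ?_⟩
  have hss := LieAlgebra.IsKilling.isSemisimple_ad_of_mem_isCartanSubalgebra
    (K := ℂ) (modCenter_mem (sub_mem hx (h.le s hs)))
  have hnil' : IsNilpotent (LieAlgebra.ad ℂ (L ⧸ LieAlgebra.center ℂ L) (modCenter (x - s))) := by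
    obtain ⟨k, hk⟩ := hnil
    refine ⟨k, LinearMap.ext fun y => ?_⟩
    obtain ⟨y, rfl⟩ := modCenter_surjective y
    have h1 : ∀ j : ℕ, ((LieAlgebra.ad ℂ (L ⧸ LieAlgebra.center ℂ L) (modCenter (x - s))) ^ j)
        (modCenter y) = modCenter (((LieAlgebra.ad ℂ L (x - s)) ^ j) y) := by
      intro j
      induction j with
      | zero => rfl
      | succ j ih =>
        rw [pow_succ', Module.End.mul_apply, ih, pow_succ', Module.End.mul_apply,
          LieAlgebra.ad_apply, LieAlgebra.ad_apply, modCenter_lie]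
    rw [h1, hk]
    rfl
  have h0 := Module.End.eq_zero_of_isNilpotent_isSemisimple hnil' hss
  have h2 : modCenter (x - s) ∈ LieAlgebra.center ℂ (L ⧸ LieAlgebra.center ℂ L) := by
    rw [mem_center_iff]
    exact fun y => LinearMap.congr_fun h0 y
  have h3 : modCenter (x - s) = 0 :=
    (LieSubmodule.mem_bot _).1 ((SetLike.ext_iff.1 (LieAlgebra.center_eq_bot (R := ℂ)
      (L := L ⧸ LieAlgebra.center ℂ L)) _).1 h2)
  exact sub_eq_zero.1 h3

/-- A nonzero joint eigenvector of `t` with nonzero eigenvalues is a root vector modulo the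
centre. -/
theorem exists_root (h : IsToralPair t H) [(LieSubalgebra.modCenter H).IsCartanSubalgebra]
    {l : L → ℂ} {Y : L} (hY : ∀ x ∈ t, ⁅x, Y⁆ = l x • Y)
    (h0 : Y ≠ 0) (hl : ∃ x ∈ t, l x ≠ 0) :
    ∃ α : LieModule.Weight ℂ (LieSubalgebra.modCenter H) (L ⧸ LieAlgebra.center ℂ L),
      α.IsNonZero ∧ ∀ x (hx : x ∈ t), α ⟨modCenter x, modCenter_mem (h.le x hx)⟩ = l x := by
  obtain ⟨x₀, hx₀, hlx₀⟩ := hl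
  have hY0 : modCenter Y ≠ 0 := by
    intro hYc
    rw [modCenter_eq_zero, mem_center_iff] at hYc
    have h1 := hY x₀ hx₀
    rw [← lie_skew, hYc, neg_zero] at h1
    exact (smul_ne_zero hlx₀ h0) h1.symm
  have hex : ∀ z : LieSubalgebra.modCenter H, ∃ s ∈ t, (z : L ⧸ LieAlgebra.center ℂ L) =
      modCenter s := by
    rintro ⟨_, ⟨x, hx⟩, rfl⟩
    exact h.exists_sub_mem_center hx
  choose s hs hzs using hex
  have hact : ∀ z : LieSubalgebra.modCenter H, ⁅z, modCenter Y⁆ = l (s z) • modCenter Y := by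
    intro z
    have h1 : ⁅z, modCenter Y⁆ = ⁅(z : L ⧸ LieAlgebra.center ℂ L), modCenter Y⁆ := rfl
    rw [h1, hzs z, ← modCenter_lie, hY _ (hs z), modCenter_smul]
  have hval : ∀ x (hx : x ∈ t), l (s ⟨modCenter x, modCenter_mem (h.le x hx)⟩) = l x := by
    intro x hx
    have h1 := hact ⟨modCenter x, modCenter_mem (h.le x hx)⟩
    have h2 : ⁅modCenter x, modCenter Y⁆ = l x • modCenter Y := by
      rw [← modCenter_lie, hY x hx, modCenter_smul]
    exact smul_left_injective ℂ hY0 (h1.symm.trans h2)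
  have hmem : modCenter Y ∈ LieModule.genWeightSpace (L ⧸ LieAlgebra.center ℂ L)
      (fun z : LieSubalgebra.modCenter H => l (s z)) :=
    LieModule.weightSpace_le_genWeightSpace _ _ ((LieModule.mem_weightSpace _ _).2 hact)
  refine ⟨⟨fun z => l (s z), fun hbot => hY0 ?_⟩, fun hz => hlx₀ ?_, hval⟩
  · rw [hbot] at hmem
    exact hmem
  · rw [← hval x₀ hx₀]
    exact congrFun hz _

theorem mem_rootSpace (h : IsToralPair t H) [(LieSubalgebra.modCenter H).IsCartanSubalgebra]
    {l : L → ℂ} {Y : L} (hY : ∀ x ∈ t, ⁅x, Y⁆ = l x • Y)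
    {α : LieModule.Weight ℂ (LieSubalgebra.modCenter H) (L ⧸ LieAlgebra.center ℂ L)}
    (hα : ∀ x (hx : x ∈ t), α ⟨modCenter x, modCenter_mem (h.le x hx)⟩ = l x) :
    modCenter Y ∈ LieAlgebra.rootSpace (LieSubalgebra.modCenter H) α := by
  refine LieModule.weightSpace_le_genWeightSpace _ _ ((LieModule.mem_weightSpace _ _).2 ?_)
  rintro ⟨_, ⟨x, hx⟩, rfl⟩
  obtain ⟨s, hs, hxs⟩ := h.exists_sub_mem_center hx
  have h1 : (⟨((modCenterHom L).comp H.incl) ⟨x, hx⟩, ⟨x, hx⟩, rfl⟩ :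
      LieSubalgebra.modCenter H) = ⟨modCenter s, modCenter_mem (h.le s hs)⟩ := Subtype.ext hxs
  refine (congrArg (fun z : LieSubalgebra.modCenter H => ⁅z, modCenter Y⁆) h1).trans ?_
  refine Eq.trans ?_ (congrArg (fun z : LieSubalgebra.modCenter H => α z • modCenter Y) h1).symm
  change ⁅modCenter s, modCenter Y⁆ = α _ • modCenter Y
  rw [hα s hs, ← modCenter_lie, hY s hs, modCenter_smul]

/-- Root spaces are lines. -/
theorem eq_smul (h : IsToralPair t H) {l : L → ℂ} {Y Z : L} (hY : ∀ x ∈ t, ⁅x, Y⁆ = l x • Y)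
    (hZ : ∀ x ∈ t, ⁅x, Z⁆ = l x • Z) (h0 : Y ≠ 0) (hl : ∃ x ∈ t, l x ≠ 0) :
    ∃ c : ℂ, Z = c • Y := by
  have := h.isCartan
  obtain ⟨α, hα0, hα⟩ := h.exists_root hY h0 hl
  have h1 := LieAlgebra.IsKilling.finrank_rootSpace_eq_one α hα0
  obtain ⟨x₀, hx₀, hlx₀⟩ := hl
  have hcen : ∀ W : L, ⁅x₀, W⁆ = l x₀ • W → modCenter W = 0 → W = 0 := by
    intro W hW hWc
    rw [modCenter_eq_zero, mem_center_iff] at hWc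
    rw [← lie_skew, hWc, neg_zero] at hW
    exact (smul_eq_zero.1 hW.symm).resolve_left hlx₀
  obtain ⟨c, hc⟩ := (finrank_eq_one_iff_of_nonzero'
    (⟨modCenter Y, h.mem_rootSpace hY hα⟩ : LieAlgebra.rootSpace (LieSubalgebra.modCenter H) α)
    (fun h2 => h0 (hcen Y (hY x₀ hx₀) (congrArg Subtype.val h2)))).1 h1
    ⟨modCenter Z, h.mem_rootSpace hZ hα⟩
  refine ⟨c, sub_eq_zero.1 (hcen _ ?_ ?_)⟩
  · rw [lie_sub, lie_smul, hY x₀ hx₀, hZ x₀ hx₀, smul_sub, smul_comm]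
  · have h2 : c • modCenter Y = modCenter Z := congrArg Subtype.val hc
    have h3 : modCenter (Z - c • Y) = modCenter Z - c • modCenter Y := rfl
    rw [h3, h2, sub_self]

/-- The negative of a root is a root. -/
theorem exists_neg (h : IsToralPair t H) {l : L → ℂ} {Y : L} (hY : ∀ x ∈ t, ⁅x, Y⁆ = l x • Y)
    (h0 : Y ≠ 0) (hl : ∃ x ∈ t, l x ≠ 0) :
    ∃ Z : L, Z ∉ LieAlgebra.center ℂ L ∧ ∀ x ∈ t, ⁅x, Z⁆ + l x • Z ∈ LieAlgebra.center ℂ L := by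
  have := h.isCartan
  obtain ⟨α, -, hα⟩ := h.exists_root hY h0 hl
  obtain ⟨z, hz, hz0⟩ := (-α).exists_ne_zero
  obtain ⟨Z, rfl⟩ := modCenter_surjective z
  refine ⟨Z, fun hZ => hz0 (modCenter_eq_zero.2 hZ), fun x hx => ?_⟩
  have h1 := LieAlgebra.IsKilling.lie_eq_smul_of_mem_rootSpace hz
    ⟨modCenter x, modCenter_mem (h.le x hx)⟩
  have h2 : ⁅modCenter x, modCenter Z⁆ = (-l x) • modCenter Z := by
    rw [← hα x hx]
    exact h1
  rw [← modCenter_eq_zero]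
  have h3 : modCenter (⁅x, Z⁆ + l x • Z) = modCenter ⁅x, Z⁆ + l x • modCenter Z := rfl
  rw [h3, modCenter_lie, h2, neg_smul, neg_add_cancel]

/-- Proportional roots agree up to sign. -/
theorem eq_neg_or_eq (h : IsToralPair t H) {l m : L → ℂ} {Y Z : L}
    (hY : ∀ x ∈ t, ⁅x, Y⁆ = l x • Y) (hZ : ∀ x ∈ t, ⁅x, Z⁆ = m x • Z) (hY0 : Y ≠ 0) (hZ0 : Z ≠ 0)
    (hl : ∃ x ∈ t, l x ≠ 0) (hm : ∃ x ∈ t, m x ≠ 0) (c : ℂ) (hc : ∀ x ∈ t, m x = c * l x) :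
    (∀ x ∈ t, m x = -l x) ∨ ∀ x ∈ t, m x = l x := by
  have := h.isCartan
  obtain ⟨α, -, hα⟩ := h.exists_root hY hY0 hl
  obtain ⟨β, hβ0, hβ⟩ := h.exists_root hZ hZ0 hm
  have hβα : (β : LieSubalgebra.modCenter H → ℂ) = c • (α : LieSubalgebra.modCenter H → ℂ) := by
    funext z
    obtain ⟨_, ⟨x, hx⟩, rfl⟩ := z
    obtain ⟨s, hs, hxs⟩ := h.exists_sub_mem_center hx
    have h1 : (⟨((modCenterHom L).comp H.incl) ⟨x, hx⟩, ⟨x, hx⟩, rfl⟩ :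
      LieSubalgebra.modCenter H) = ⟨modCenter s, modCenter_mem (h.le s hs)⟩ := Subtype.ext hxs
    refine (congrArg β h1).trans (Eq.trans ?_ (congrArg (c • ⇑α) h1).symm)
    change β _ = c * α _
    rw [hα s hs, hβ s hs, hc s hs]
  rcases LieAlgebra.IsKilling.eq_neg_or_eq_of_eq_smul α β hβ0 c hβα with h1 | h1
  · left
    intro x hx
    rw [← hα x hx, ← hβ x hx, h1, LieModule.Weight.coe_neg, Pi.neg_apply]
  · right
    intro x hx
    rw [← hα x hx, ← hβ x hx, h1]

end IsToralPair

end Abstract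

/-! ### The roots of the group of a Shimura datum -/

theorem lieAlg_mono {n : ℕ} {K G : Subgroup (GL (Fin n) ℂ)} (h : K ≤ G) : lieAlg K ⊆ lieAlg G :=
  fun _ hX t => (hX t).imp fun _ hg => ⟨h hg.1, hg.2⟩

namespace Torus

variable {n : ℕ} (T : Torus n)

theorem isWeightVec_of_wproj_eq_zero {α : charGroup T} {Y : Matrix (Fin n) (Fin n) ℂ}
    (h : ∀ β, β ≠ α → T.wproj β Y = 0) : T.IsWeightVec α Y := by
  have h1 : T.wproj α Y = Y := by
    refine T.ext_Ad fun i j => ?_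
    rw [Ad_wproj]
    split_ifs with hij
    · rfl
    · have h2 := T.Ad_wproj (T.wt (i, j)) Y i j
      rw [h _ hij, if_pos rfl] at h2
      rw [← h2]
      simp [Ad]
  rw [← h1]
  exact T.wproj_isWeightVec α Y

theorem wproj_lie (α : charGroup T) {X : Matrix (Fin n) (Fin n) ℂ} (hX : X ∈ lieAlg T.carrier)
    (Y : Matrix (Fin n) (Fin n) ℂ) : T.wproj α ⁅X, Y⁆ = T.dwt α X • T.wproj α Y := by
  have h1 : ⁅X, Y⁆ = ∑ β ∈ T.wts, T.dwt β X • T.wproj β Y := by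
    conv_lhs => rw [← T.sum_wproj Y, lie_sum]
    exact Finset.sum_congr rfl fun β _ => (T.wproj_isWeightVec β Y).lie_eq hX
  rw [h1, map_sum]
  by_cases hα : α ∈ T.wts
  · rw [Finset.sum_eq_single_of_mem α hα]
    · rw [map_smul, (T.wproj_isWeightVec α Y).wproj_eq]
    · intro β _ hβ
      rw [map_smul, (T.wproj_isWeightVec β Y).wproj_eq_zero hβ.symm, smul_zero]
  · have h0 : T.wproj α Y = 0 := by
      by_contra h0
      exact hα ((T.wproj_isWeightVec α Y).mem_wts h0)
    rw [h0, smul_zero]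
    refine Finset.sum_eq_zero fun β hβ => ?_
    have hne : α ≠ β := fun h => hα (h ▸ hβ)
    rw [map_smul, (T.wproj_isWeightVec β Y).wproj_eq_zero hne, smul_zero]

theorem isWeightVec_one_of_mem {X : Matrix (Fin n) (Fin n) ℂ} (hX : X ∈ lieAlg T.carrier) :
    T.IsWeightVec 1 X := by
  intro t
  have h1 : Ad (t : GL (Fin n) ℂ) X = X := by
    refine eq_of_expGL_eq fun s => ?_
    have h2 := expGL_mem T.closed hX (s : ℂ)
    rw [← Ad_smul, ← conj_expGL, T.comm t.2 h2, mul_inv_cancel_right]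
  rw [h1]
  exact (one_smul ℂ X).symm

theorem IsWeightVec.lie_eq_zero {T : Torus n} {Y : Matrix (Fin n) (Fin n) ℂ}
    (hY : T.IsWeightVec 1 Y) {X : Matrix (Fin n) (Fin n) ℂ} (hX : X ∈ lieAlg T.carrier) :
    ⁅X, Y⁆ = 0 :=
  lie_eq_zero_of_Ad_exp fun t =>
    (hY ⟨expGL ((t : ℂ) • X), expGL_mem T.closed hX t⟩).trans (one_smul ℂ Y)

variable {G : Subgroup (GL (Fin n) ℂ)} (hG : IsZariskiClosed ℂ (G : Set (GL (Fin n) ℂ)))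

/-- The Lie algebra of a torus, as a subspace of the Lie algebra of a group containing it. -/
def lieTorus : Submodule ℂ (lieSub G hG) :=
  (lieSub T.carrier T.closed).toSubmodule.comap (lieSub G hG).toSubmodule.subtype

/-- The centralizer of a torus in the Lie algebra of `G`. -/
def lieCentralizer : LieSubalgebra ℂ (lieSub G hG) where
  carrier := {x | T.IsWeightVec 1 (x : Matrix (Fin n) (Fin n) ℂ)}
  add_mem' := by
    intro x y hx hy t
    exact (Ad_add _ _ _).trans ((congrArg₂ (· + ·) (hx t) (hy t)).trans (smul_add _ _ _).symm)
  zero_mem' := by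
    intro t
    simp [Ad]
  smul_mem' := by
    intro c x hx
    exact hx.smul c
  lie_mem' := by
    intro x y hx hy
    have h := hx.lie hy
    rw [mul_one] at h
    exact h

theorem jordan_of_isWeightVec_one (hG : IsZariskiClosed ℂ (G : Set (GL (Fin n) ℂ)))
    (hT : IsMaximalTorus G T) {x : Matrix (Fin n) (Fin n) ℂ}
    (hxG : x ∈ lieAlg G) (hx : T.IsWeightVec 1 x) :
    ∃ S ∈ lieAlg T.carrier, S ∈ lieAlg G ∧ IsNilpotent (x - S) := by
  obtain ⟨S, hSG, N, rfl, hN, hss, hcomm⟩ := exists_jordan hG hxG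
  have hS : T.IsWeightVec 1 S :=
    T.isWeightVec_one_iff.2 fun t ht => hcomm _ (T.isWeightVec_one_iff.1 hx t ht)
  refine ⟨S, T.mem_lieAlg_of_isSemisimple hG hT hSG hS hss, hSG, ?_⟩
  rwa [add_sub_cancel_left]

theorem isNilpotent_ad_of_isWeightVec_one (hT : IsMaximalTorus G T) {x : lieSub G hG}
    (hx : x ∈ T.lieCentralizer hG) :
    ∃ s ∈ T.lieTorus hG, IsNilpotent (LieAlgebra.ad ℂ (lieSub G hG) (x - s)) := by
  obtain ⟨S, hST, hSG, hnil⟩ := T.jordan_of_isWeightVec_one hG hT x.2 hx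
  let s : lieSub G hG := ⟨S, hSG⟩
  have h1 : IsNilpotent ((x - s : lieSub G hG) : Matrix (Fin n) (Fin n) ℂ) := by
    have h2 : ((x - s : lieSub G hG) : Matrix (Fin n) (Fin n) ℂ) = x - S := rfl
    rw [h2]
    exact hnil
  refine ⟨s, hST, ?_⟩
  exact LieAlgebra.isNilpotent_ad_of_isNilpotent h1

theorem lieTorus_le {x : lieSub G hG} (hx : x ∈ T.lieTorus hG) : x ∈ T.lieCentralizer hG :=
  T.isWeightVec_one_of_mem hx

theorem isNilpotent_lieCentralizer (hT : IsMaximalTorus G T) :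
    LieRing.IsNilpotent (T.lieCentralizer hG) := by
  rw [LieAlgebra.isNilpotent_iff_forall (R := ℂ)]
  rintro ⟨x, hx⟩
  obtain ⟨s, hs, hnil⟩ := T.isNilpotent_ad_of_isWeightVec_one hG hT hx
  have hN : x - s ∈ T.lieCentralizer hG := sub_mem hx (T.lieTorus_le hG hs)
  have h2 := LieSubalgebra.isNilpotent_ad_of_isNilpotent_ad
    (T.lieCentralizer hG) (x := ⟨x - s, hN⟩) hnil
  have h3 : LieAlgebra.ad ℂ (T.lieCentralizer hG) ⟨x, hx⟩ =
      LieAlgebra.ad ℂ (T.lieCentralizer hG) ⟨x - s, hN⟩ := by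
    refine LinearMap.ext fun y => Subtype.ext ?_
    have h4 : ⁅s, (y : lieSub G hG)⁆ = 0 := Subtype.ext (IsWeightVec.lie_eq_zero y.2 hs)
    change ⁅x, (y : lieSub G hG)⁆ = ⁅x - s, (y : lieSub G hG)⁆
    rw [sub_lie, h4, sub_zero]
  rw [h3]
  exact h2

theorem mem_lieCentralizer_of_lie_mem (hTG : T.carrier ≤ G) {y : lieSub G hG}
    (hy : ∀ x ∈ T.lieCentralizer hG, ⁅x, y⁆ ∈ T.lieCentralizer hG) :
    y ∈ T.lieCentralizer hG := by
  refine T.isWeightVec_of_wproj_eq_zero fun β hβ => ?_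
  by_contra h0
  obtain ⟨X, hX, hne⟩ :=
    T.exists_dwt_ne_zero ((T.wproj_isWeightVec β _).mem_wts h0) hβ
  have h1 : T.IsWeightVec 1 ⁅X, (y : Matrix (Fin n) (Fin n) ℂ)⁆ :=
    hy ⟨X, lieAlg_mono hTG hX⟩ (T.isWeightVec_one_of_mem hX)
  have h2 := T.wproj_lie β hX (y : Matrix (Fin n) (Fin n) ℂ)
  rw [h1.wproj_eq_zero hβ] at h2
  exact smul_ne_zero hne h0 h2.symm

/-- For a maximal torus `T` of `G`, the centralizer of `T` in the Lie algebra of `G` is a Cartan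
subalgebra: by Jordan decomposition its elements are nilpotent up to elements of `Lie T`. -/
theorem isToralPair (hT : IsMaximalTorus G T) :
    IsToralPair (T.lieTorus hG) (T.lieCentralizer hG) where
  le _ hx := T.lieTorus_le hG hx
  nilpotent := T.isNilpotent_lieCentralizer hG hT
  selfNormalizing _ hy := T.mem_lieCentralizer_of_lie_mem hG hT.1 hy
  jordan _ hx := T.isNilpotent_ad_of_isWeightVec_one hG hT hx

end Torus

section Roots

variable {n : ℕ} {G : Subgroup (GL (Fin n) ℂ)} {T : Torus n}

theorem root_mem_wts {α : charGroup T} (hα : α ∈ roots G T) : α ∈ T.wts := by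
  obtain ⟨_, Y, -, h0, hY⟩ := hα
  exact Torus.IsWeightVec.mem_wts hY h0

theorem exists_lieTorus_dwt_ne_zero (hG : IsZariskiClosed ℂ (G : Set (GL (Fin n) ℂ)))
    (hT : IsMaximalTorus G T) {α : charGroup T} (hα : α ∈ roots G T) :
    ∃ x ∈ T.lieTorus hG, T.dwt α (x : Matrix (Fin n) (Fin n) ℂ) ≠ 0 := by
  obtain ⟨X, hX, hne⟩ := T.exists_dwt_ne_zero (root_mem_wts hα) hα.1
  exact ⟨⟨X, lieAlg_mono hT.1 hX⟩, hX, hne⟩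

theorem lie_rootVec (hG : IsZariskiClosed ℂ (G : Set (GL (Fin n) ℂ))) {α : charGroup T}
    {Y : Matrix (Fin n) (Fin n) ℂ} (hYG : Y ∈ lieAlg G) (hY : T.IsWeightVec α Y) :
    ∀ x ∈ T.lieTorus hG, ⁅x, (⟨Y, hYG⟩ : lieSub G hG)⁆ =
      T.dwt α (x : Matrix (Fin n) (Fin n) ℂ) • (⟨Y, hYG⟩ : lieSub G hG) :=
  fun _ hx => Subtype.ext (hY.lie_eq hx)

variable {hG : IsZariskiClosed ℂ (G : Set (GL (Fin n) ℂ))}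

/-- Root spaces are lines. -/
theorem exists_eq_smul_of_root (hT : IsMaximalTorus G T)
    (hK : LieAlgebra.IsKilling ℂ (lieSub G hG ⧸ LieAlgebra.center ℂ (lieSub G hG)))
    {α : charGroup T} (hα : α ∈ roots G T) {Y Z : Matrix (Fin n) (Fin n) ℂ}
    (hYG : Y ∈ lieAlg G) (hY : T.IsWeightVec α Y) (h0 : Y ≠ 0) (hZG : Z ∈ lieAlg G)
    (hZ : T.IsWeightVec α Z) : ∃ c : ℂ, Z = c • Y := by
  obtain ⟨c, hc⟩ := (T.isToralPair hG hT).eq_smul (lie_rootVec hG hYG hY) (lie_rootVec hG hZG hZ)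
    (fun h => h0 (congrArg Subtype.val h)) (exists_lieTorus_dwt_ne_zero hG hT hα)
  exact ⟨c, congrArg Subtype.val hc⟩

theorem inv_mem_roots (hT : IsMaximalTorus G T)
    (hK : LieAlgebra.IsKilling ℂ (lieSub G hG ⧸ LieAlgebra.center ℂ (lieSub G hG)))
    {α : charGroup T} (hα : α ∈ roots G T) : α⁻¹ ∈ roots G T := by
  obtain ⟨hα1, Y, hYG, h0, hY⟩ := id hα
  obtain ⟨Z, hZc, hZ⟩ := (T.isToralPair hG hT).exists_neg (lie_rootVec hG hYG hY)
    (fun h => h0 (congrArg Subtype.val h)) (exists_lieTorus_dwt_ne_zero hG hT hα)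
  obtain ⟨β, hβ, hβZ⟩ : ∃ β, β ≠ 1 ∧ T.wproj β (Z : Matrix (Fin n) (Fin n) ℂ) ≠ 0 := by
    by_contra! h
    have h1 := T.isWeightVec_of_wproj_eq_zero h
    obtain ⟨x, hx, hne⟩ := exists_lieTorus_dwt_ne_zero hG hT hα
    have h2 := hZ x hx
    have h3 : ⁅x, Z⁆ = 0 := Subtype.ext (h1.lie_eq_zero hx)
    rw [h3, zero_add] at h2
    have h4 := (LieAlgebra.center ℂ (lieSub G hG)).smul_mem
      (T.dwt α (x : Matrix (Fin n) (Fin n) ℂ))⁻¹ h2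
    rw [smul_smul, inv_mul_cancel₀ hne, one_smul] at h4
    exact hZc h4
  have hβw := (T.wproj_isWeightVec β (Z : Matrix (Fin n) (Fin n) ℂ)).mem_wts hβZ
  have h : β = α⁻¹ := by
    refine T.eq_inv_of_dwt (root_mem_wts hα) hβw fun X hX => ?_
    -- central elements have weight `1`, so `β` does not occur in them
    have h1 : T.IsWeightVec 1 _ := (T.isToralPair hG hT).center_le
      (hZ ⟨X, lieAlg_mono hT.1 hX⟩ hX)
    have h2 := h1.wproj_eq_zero hβ
    change T.wproj β (⁅X, (Z : Matrix (Fin n) (Fin n) ℂ)⁆ +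
      T.dwt α X • (Z : Matrix (Fin n) (Fin n) ℂ)) = 0 at h2
    rw [map_add, map_smul, T.wproj_lie β hX, ← add_smul] at h2
    exact eq_neg_of_add_eq_zero_left ((smul_eq_zero.1 h2).resolve_right hβZ)
  rw [← h]
  exact ⟨hβ, _, T.wproj_mem_lieAlg hG hT.1 β Z.2, hβZ, T.wproj_isWeightVec β _⟩

/-- The root system is reduced. -/
theorem eq_inv_or_eq_of_dwt (hT : IsMaximalTorus G T)
    (hK : LieAlgebra.IsKilling ℂ (lieSub G hG ⧸ LieAlgebra.center ℂ (lieSub G hG)))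
    {α β : charGroup T} (hα : α ∈ roots G T) (hβ : β ∈ roots G T) (c : ℂ)
    (h : ∀ X ∈ lieAlg T.carrier, T.dwt β X = c * T.dwt α X) : β = α⁻¹ ∨ β = α := by
  obtain ⟨-, Y, hYG, hY0, hY⟩ := id hα
  obtain ⟨-, Z, hZG, hZ0, hZ⟩ := id hβ
  rcases (T.isToralPair hG hT).eq_neg_or_eq (lie_rootVec hG hYG hY) (lie_rootVec hG hZG hZ)
    (fun h => hY0 (congrArg Subtype.val h)) (fun h => hZ0 (congrArg Subtype.val h))
    (exists_lieTorus_dwt_ne_zero hG hT hα) (exists_lieTorus_dwt_ne_zero hG hT hβ) c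
    (fun x hx => h x hx) with h1 | h1
  · exact Or.inl (T.eq_inv_of_dwt (root_mem_wts hα) (root_mem_wts hβ)
      fun X hX => h1 ⟨X, lieAlg_mono hT.1 hX⟩ hX)
  · exact Or.inr (T.char_eq_of_dwt (root_mem_wts hβ) (root_mem_wts hα)
      fun X hX => h1 ⟨X, lieAlg_mono hT.1 hX⟩ hX)

end Roots

/-! ### The pairing of characters and cocharacters -/

theorem IsLaurent.exists_polynomial {f : ℂˣ → ℂ} (hf : IsLaurent f) :
    ∃ (N : ℕ) (q : Polynomial ℂ), ∀ z : ℂˣ, (z : ℂ) ^ N * f z = q.eval (z : ℂ) := by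
  obtain ⟨p, hp⟩ := hf
  suffices h : ∀ p : MvPolynomial (Fin 2) ℂ, ∃ (N : ℕ) (q : Polynomial ℂ), ∀ z : ℂˣ,
      (z : ℂ) ^ N * MvPolynomial.eval ![(z : ℂ), ((z⁻¹ : ℂˣ) : ℂ)] p = q.eval (z : ℂ) by
    obtain ⟨N, q, h⟩ := h p
    exact ⟨N, q, fun z => by rw [hp, h]⟩
  intro p
  induction p using MvPolynomial.induction_on with
  | C a => exact ⟨0, Polynomial.C a, fun z => by simp⟩
  | add p p' h h' =>
    obtain ⟨N, q, h⟩ := h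
    obtain ⟨N', q', h'⟩ := h'
    refine ⟨N + N', Polynomial.X ^ N' * q + Polynomial.X ^ N * q', fun z => ?_⟩
    simp only [Polynomial.eval_add, Polynomial.eval_mul, Polynomial.eval_pow, Polynomial.eval_X,
      ← h, ← h', map_add]
    ring
  | mul_X p i h =>
    obtain ⟨N, q, h⟩ := h
    fin_cases i
    · refine ⟨N, q * Polynomial.X, fun z => ?_⟩
      simp only [Polynomial.eval_mul, Polynomial.eval_X, ← h, map_mul, MvPolynomial.eval_X]
      simp [mul_assoc]
    · refine ⟨N + 1, q, fun z => ?_⟩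
      simp only [← h, map_mul, MvPolynomial.eval_X]
      simp only [Fin.mk_one, Matrix.cons_val_one, Matrix.cons_val_fin_one, Units.val_inv_eq_inv_val]
      field_simp [z.ne_zero]
      ring

/-- The algebraic endomorphisms of `ℂˣ` are the powers: a polynomial without nonzero roots is a
monomial. -/
theorem exists_zpow_of_isLaurent (f : ℂˣ →* ℂˣ) (hf : IsLaurent fun z => (f z : ℂ)) :
    ∃ k : ℤ, ∀ z, f z = z ^ k := by
  obtain ⟨N, q, hq⟩ := hf.exists_polynomial
  have hne : ∀ z : ℂˣ, q.eval (z : ℂ) ≠ 0 := fun z => by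
    rw [← hq]
    exact mul_ne_zero (pow_ne_zero _ z.ne_zero) (f z).ne_zero
  have hq0 : q ≠ 0 := fun h => hne 1 (by simp [h])
  obtain ⟨r, hr, hdvd⟩ := Polynomial.exists_eq_pow_rootMultiplicity_mul_and_not_dvd q hq0 0
  set m := Polynomial.rootMultiplicity 0 q
  have hdeg : r.degree = 0 := by
    by_contra hd
    obtain ⟨x, hx⟩ := IsAlgClosed.exists_root r hd
    by_cases hx0 : x = 0
    · exact hdvd (Polynomial.dvd_iff_isRoot.2 (hx0 ▸ hx))
    · refine hne (Units.mk0 x hx0) ?_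
      rw [hr, Polynomial.eval_mul, Units.val_mk0, hx.eq_zero, mul_zero]
  obtain ⟨c, hc⟩ : ∃ c, r = Polynomial.C c := ⟨_, Polynomial.eq_C_of_degree_eq_zero hdeg⟩
  have hz : ∀ z : ℂˣ, (z : ℂ) ^ N * f z = z ^ m * c := fun z => by
    rw [hq, hr, hc, Polynomial.eval_mul, Polynomial.eval_pow, Polynomial.eval_sub,
      Polynomial.eval_X, Polynomial.eval_C, Polynomial.eval_C, sub_zero]
  have hc1 : c = 1 := by simpa using (hz 1).symm
  refine ⟨m - N, fun z => Units.ext ?_⟩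
  have h1 := hz z
  rw [hc1, mul_one] at h1
  rw [Units.val_zpow_eq_zpow_val, zpow_sub₀ z.ne_zero, zpow_natCast, zpow_natCast, ← h1]
  field_simp [z.ne_zero]

theorem IsLaurent.eval {σ : Type} {F : σ → ℂˣ → ℂ} (hF : ∀ s, IsLaurent (F s))
    (p : MvPolynomial σ ℂ) : IsLaurent fun z => MvPolynomial.eval (fun s => F s z) p := by
  induction p using MvPolynomial.induction_on with
  | C a => simpa using IsLaurent.const a
  | add p q hp hq => simpa using hp.add hq
  | mul_X p s hp => simpa using hp.mul (hF s)

section Pairing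

variable {n : ℕ} {T : Torus n}

theorem IsRegular.comp_cochar {G : Subgroup (GL (Fin n) ℂ)} {hT : T.carrier ≤ G} {f : G → ℂ}
    (hf : IsRegular f) (l : cocharGroup T) :
    IsLaurent fun z => f (Subgroup.inclusion hT (l.1 z)) := by
  obtain ⟨p, hp⟩ := hf
  let F : (Fin n × Fin n) ⊕ (Fin n × Fin n) → ℂˣ → ℂ :=
    Sum.elim (fun q z => (l.1 z : GL (Fin n) ℂ).1 q.1 q.2)
      (fun q z => (l⁻¹.1 z : GL (Fin n) ℂ).1 q.1 q.2)
  have hF : ∀ s, IsLaurent (F s) := by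
    rintro (q | q)
    · exact l.2 q.1 q.2
    · exact l⁻¹.2 q.1 q.2
  have h : (fun z => f (Subgroup.inclusion hT (l.1 z))) =
      fun z => MvPolynomial.eval (fun s => F s z) p := by
    funext z
    refine (hp _).trans ?_
    congr 2
    funext s
    rcases s with s | s <;> rfl
  rw [h]
  exact IsLaurent.eval hF p

theorem exists_pairing (χ : charGroup T) (l : cocharGroup T) : ∃ k : ℤ, Pairing χ l k :=
  exists_zpow_of_isLaurent (χ.1.comp l.1) (IsRegular.comp_cochar (hT := le_rfl) χ.2 l)

/-- The integer `⟨χ, l⟩`. -/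
def pair (χ : charGroup T) (l : cocharGroup T) : ℤ := (exists_pairing χ l).choose

theorem pairing_pair (χ : charGroup T) (l : cocharGroup T) : Pairing χ l (pair χ l) :=
  (exists_pairing χ l).choose_spec

theorem zpow_unit_injective {a b : ℤ} (h : ∀ z : ℂˣ, z ^ a = z ^ b) : a = b := by
  have h1 := congrArg (fun u : ℂˣ => ‖(u : ℂ)‖) (h (Units.mk0 2 two_ne_zero))
  simp only [Units.val_zpow_eq_zpow_val, Units.val_mk0, norm_zpow, Complex.norm_ofNat] at h1
  exact zpow_right_injective₀ (by norm_num) (by norm_num) h1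

theorem pairing_iff {χ : charGroup T} {l : cocharGroup T} {k : ℤ} :
    Pairing χ l k ↔ pair χ l = k := by
  constructor
  · intro h
    exact zpow_unit_injective fun z => ((pairing_pair χ l) z).symm.trans (h z)
  · rintro rfl
    exact pairing_pair χ l

theorem pair_mul_left (χ χ' : charGroup T) (l : cocharGroup T) :
    pair (χ * χ') l = pair χ l + pair χ' l := by
  rw [← pairing_iff]
  intro z
  rw [zpow_add, ← pairing_pair χ l z, ← pairing_pair χ' l z]
  rfl

theorem pair_one_left (l : cocharGroup T) : pair 1 l = 0 := by
  rw [← pairing_iff]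
  intro z
  rw [zpow_zero]
  rfl

theorem pair_inv_left (χ : charGroup T) (l : cocharGroup T) : pair χ⁻¹ l = -pair χ l := by
  have h := pair_mul_left χ⁻¹ χ l
  rw [inv_mul_cancel, pair_one_left] at h
  omega

theorem pair_zpow_left (χ : charGroup T) (l : cocharGroup T) (k : ℤ) :
    pair (χ ^ k) l = k * pair χ l := by
  rw [← pairing_iff]
  intro z
  rw [mul_comm, zpow_mul, ← pairing_pair χ l z]
  rfl

theorem pair_prod (s : Finset (charGroup T)) (l : cocharGroup T) :
    pair (∏ χ ∈ s, χ) l = ∑ χ ∈ s, pair χ l := by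
  classical
  induction s using Finset.induction_on with
  | empty => simpa using pair_one_left l
  | insert a s ha ih => rw [Finset.prod_insert ha, Finset.sum_insert ha, pair_mul_left, ih]

end Pairing

/-! ### The dimension of the Hermitian symmetric domain -/

section Hodge

variable {n : ℕ} {G : Subgroup (GL (Fin n) ℂ)} {X : Set (ℂˣ × ℂˣ →* GL (Fin n) ℂ)}

theorem mem_lieAlg_realPoints {Y : Matrix (Fin n) (Fin n) ℂ} :
    Y ∈ lieAlg (realPoints G) ↔ Y ∈ lieAlg G ∧ conjMat Y = Y := by
  simp only [mem_lieAlg_iff_exp]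
  have hc : ∀ t : ℝ, conj (expGL (t • Y)) = expGL (t • conjMat Y) := fun t => by
    rw [conjMat_exp, ← Complex.coe_smul, conjMat_smul, Complex.conj_ofReal, Complex.coe_smul]
  constructor
  · intro h
    refine ⟨fun t => (h t).1, eq_of_expGL_eq fun t => ?_⟩
    have h1 : conj (expGL (t • Y)) = expGL (t • Y) := (h t).2
    rw [hc] at h1
    exact h1
  · rintro ⟨h, hY⟩ t
    refine ⟨h t, ?_⟩
    change conj (expGL (t • Y)) = expGL (t • Y)
    rw [hc, hY]

theorem mem_lieAlg_stabilizer {h : ℂˣ × ℂˣ →* GL (Fin n) ℂ} {Y : Matrix (Fin n) (Fin n) ℂ} :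
    Y ∈ lieAlg (stabilizer G h) ↔ Y ∈ hodgePart G h 0 0 ∧ conjMat Y = Y := by
  have h0 : Y ∈ lieAlg (stabilizer G h) ↔ Y ∈ lieAlg (realPoints G) ∧ ∀ x, Ad (h x) Y = Y := by
    simp only [mem_lieAlg_iff_exp]
    constructor
    · intro hY
      refine ⟨fun t => (hY t).1, fun x => eq_of_expGL_eq fun t => ?_⟩
      have h1 := Subgroup.mem_centralizer_iff.1 (hY t).2 (h x) ⟨x, rfl⟩
      rw [← Ad_smul, ← conj_expGL, mul_inv_eq_iff_eq_mul]
      exact h1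
    · rintro ⟨hY, hx⟩ t
      refine ⟨hY t, Subgroup.mem_centralizer_iff.2 ?_⟩
      rintro _ ⟨x, rfl⟩
      rw [← mul_inv_eq_iff_eq_mul, conj_expGL, ← Complex.coe_smul, Ad_smul, hx]
  rw [h0, mem_lieAlg_realPoints]
  constructor
  · rintro ⟨⟨h1, h2⟩, h3⟩
    exact ⟨⟨h1, fun z w => by rw [h3]; simp⟩, h2⟩
  · rintro ⟨⟨h1, h2⟩, h3⟩
    exact ⟨⟨h1, h3⟩, fun x => by have := h2 x.1 x.2; simpa using this⟩

theorem conjMat_mem_hodgePart (hG : IsZariskiClosed ℚ (G : Set (GL (Fin n) ℂ)))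
    {h : ℂˣ × ℂˣ →* GL (Fin n) ℂ} (hh : IsDeligneHom G h) {p q : ℤ}
    {Y : Matrix (Fin n) (Fin n) ℂ} (hY : Y ∈ hodgePart G h p q) :
    conjMat Y ∈ hodgePart G h q p := by
  refine ⟨conjMat_mem_lieAlg hG hY.1, fun z w => ?_⟩
  have h1 := hh.real (star w) (star z)
  rw [star_star, star_star] at h1
  rw [h1, ← conjMat_Ad, hY.2, conjMat_smul]
  congr 1
  simp [mul_comm]

/-- The parts of the Hodge decomposition are independent. -/
theorem hodgePart_eq_zero {h : ℂˣ × ℂˣ →* GL (Fin n) ℂ} {Y₁ Y₂ Y₃ : Matrix (Fin n) (Fin n) ℂ}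
    (h1 : Y₁ ∈ hodgePart G h (-1) 1) (h2 : Y₂ ∈ hodgePart G h 0 0)
    (h3 : Y₃ ∈ hodgePart G h 1 (-1)) (h0 : Y₁ + Y₂ + Y₃ = 0) : Y₁ = 0 ∧ Y₂ = 0 ∧ Y₃ = 0 := by
  have hz : ∀ z : ℂˣ, (z : ℂ) • Y₁ + Y₂ + (z⁻¹ : ℂ) • Y₃ = 0 := fun z => by
    have h4 : Ad (h (z, 1)) (Y₁ + Y₂ + Y₃) = 0 := by
      rw [h0]
      simp [Ad]
    rw [Ad_add, Ad_add, h1.2, h2.2, h3.2] at h4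
    simpa using h4
  -- compare the actions of `-1` and `2`
  have e1 := hz (-1)
  have e2 := hz (Units.mk0 2 two_ne_zero)
  simp only [Units.val_neg, Units.val_one, Units.val_mk0] at e1 e2
  refine ⟨?_, ?_, ?_⟩ <;> ext i j <;>
  · have f0 := congrFun (congrFun h0 i) j
    have f1 := congrFun (congrFun e1 i) j
    have f2 := congrFun (congrFun e2 i) j
    simp only [Matrix.add_apply, Matrix.smul_apply, smul_eq_mul, Matrix.zero_apply] at f0 f1 f2 ⊢
    norm_num at f1 f2
    grind

/-- The part of type `(p, q)` of the Lie algebra, as a subspace. -/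
def hodgeSub (hG : IsZariskiClosed ℂ (G : Set (GL (Fin n) ℂ)))
    (h : ℂˣ × ℂˣ →* GL (Fin n) ℂ) (p q : ℤ) : Submodule ℂ (Matrix (Fin n) (Fin n) ℂ) where
  carrier := hodgePart G h p q
  add_mem' := by
    intro A B hA hB
    exact ⟨(lieSub G hG).add_mem hA.1 hB.1, fun z w => by
      rw [Ad_add, hA.2, hB.2, smul_add]⟩
  zero_mem' := ⟨(lieSub G hG).zero_mem, fun z w => by simp [Ad]⟩
  smul_mem' := by
    intro c A hA
    exact ⟨(lieSub G hG).smul_mem c hA.1, fun z w => by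
      rw [Ad_smul, hA.2, smul_comm]⟩

/-- The real points of a complex subspace of matrices. -/
def realForm (W : Submodule ℂ (Matrix (Fin n) (Fin n) ℂ)) :
    Submodule ℝ (Matrix (Fin n) (Fin n) ℂ) where
  carrier := {Y | Y ∈ W ∧ conjMat Y = Y}
  add_mem' := by
    intro A B hA hB
    exact ⟨W.add_mem hA.1 hB.1, by rw [conjMat_add, hA.2, hB.2]⟩
  zero_mem' := ⟨W.zero_mem, by ext; simp [conjMat_apply]⟩
  smul_mem' := by
    intro c A hA
    refine ⟨W.smul_mem (c : ℂ) hA.1, ?_⟩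
    rw [← Complex.coe_smul, conjMat_smul, hA.2, Complex.conj_ofReal]

theorem realDim_eq_finrank {K : Subgroup (GL (Fin n) ℂ)}
    {W : Submodule ℂ (Matrix (Fin n) (Fin n) ℂ)}
    (hW : ∀ Y, Y ∈ lieAlg K ↔ Y ∈ W ∧ conjMat Y = Y) :
    realDim K = Module.finrank ℝ (realForm W) := by
  have h : lieAlg K = (realForm W : Set (Matrix (Fin n) (Fin n) ℂ)) := Set.ext hW
  rw [realDim, Set.finrank, h, Submodule.span_eq]

/-- The real Lie algebra of `G` is the sum of that of the stabilizer of `h` and of the real points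
of `𝔤^(-1,1) ⊕ 𝔤^(1,-1)`, which correspond to the elements of `𝔤^(-1,1)`. -/
theorem IsShimuraDatum.finrank_hodgePart (hGX : IsShimuraDatum G X) {d : ℕ}
    (hd : HasComplexDim G X d) {h : ℂˣ × ℂˣ →* GL (Fin n) ℂ} (hh : h ∈ X) :
    Module.finrank ℂ (hodgeSub hGX.closed h (-1) 1) = d := by
  have h1 := hd h hh
  have hDh := hGX.hom h hh
  have hQ := hGX.rational
  rw [realDim_eq_finrank (W := hodgeSub hGX.closed h 0 0) (fun Y => mem_lieAlg_stabilizer),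
    realDim_eq_finrank (W := (lieSub G hGX.closed).toSubmodule)
      (fun Y => mem_lieAlg_realPoints)] at h1
  let A := hodgeSub hGX.closed h (-1) 1
  let f : (A × realForm (hodgeSub hGX.closed h 0 0)) →ₗ[ℝ]
      realForm (lieSub G hGX.closed).toSubmodule :=
    { toFun := fun x => ⟨x.1.1 + conjMat x.1.1 + x.2.1,
        (lieSub G hGX.closed).add_mem ((lieSub G hGX.closed).add_mem x.1.2.1
          (conjMat_mem_lieAlg hQ x.1.2.1)) x.2.2.1.1, by
        rw [conjMat_add, conjMat_add, conjMat_conjMat, x.2.2.2, add_comm (conjMat x.1.1)]⟩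
      map_add' := fun x y => Subtype.ext (by
        change (x.1.1 + y.1.1) + conjMat (x.1.1 + y.1.1) + (x.2.1 + y.2.1) =
          (x.1.1 + conjMat x.1.1 + x.2.1) + (y.1.1 + conjMat y.1.1 + y.2.1)
        rw [conjMat_add]
        abel)
      map_smul' := fun c x => Subtype.ext (by
        change c • x.1.1 + conjMat (c • x.1.1) + c • x.2.1 =
          c • (x.1.1 + conjMat x.1.1 + x.2.1)
        rw [← Complex.coe_smul, conjMat_smul, Complex.conj_ofReal, Complex.coe_smul,
          Complex.coe_smul, smul_add, smul_add]) }
  have hf : Function.Bijective f := by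
    constructor
    · rw [← LinearMap.ker_eq_bot, LinearMap.ker_eq_bot']
      rintro ⟨⟨a, ha⟩, ⟨b, hb⟩⟩ hab
      have h2 : a + conjMat a + b = 0 := congrArg Subtype.val hab
      rw [add_right_comm] at h2
      obtain ⟨rfl, rfl, -⟩ := hodgePart_eq_zero ha hb.1 (conjMat_mem_hodgePart hQ hDh ha) h2
      rfl
    · rintro ⟨Y, hY, hYc⟩
      obtain ⟨Y₁, h1, Y₂, h2, Y₃, h3, rfl⟩ := hGX.hodgeType h hh Y hY
      have e : (Y₁ - conjMat Y₃) + (Y₂ - conjMat Y₂) + (Y₃ - conjMat Y₁) = 0 := by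
        rw [conjMat_add, conjMat_add] at hYc
        rw [← sub_eq_zero] at hYc
        rw [← neg_eq_zero, ← hYc]
        abel
      obtain ⟨-, e2, e3⟩ := hodgePart_eq_zero
        ((hodgeSub hGX.closed h (-1) 1).sub_mem h1 (conjMat_mem_hodgePart hQ hDh h3))
        ((hodgeSub hGX.closed h 0 0).sub_mem h2 (conjMat_mem_hodgePart hQ hDh h2))
        ((hodgeSub hGX.closed h 1 (-1)).sub_mem h3 (conjMat_mem_hodgePart hQ hDh h1)) e
      refine ⟨⟨⟨Y₁, h1⟩, ⟨Y₂, h2, (sub_eq_zero.1 e2).symm⟩⟩, Subtype.ext ?_⟩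
      change Y₁ + conjMat Y₁ + Y₂ = Y₁ + Y₂ + Y₃
      rw [← sub_eq_zero.1 e3, add_right_comm]
  have h2 := (LinearEquiv.ofBijective f hf).finrank_eq
  rw [Module.finrank_prod, finrank_real_of_complex] at h2
  change Module.finrank ℂ A = d
  omega

end Hodge

/-! ### The sum of the positive roots and the Hodge cocharacter -/

namespace Torus

variable {n : ℕ} {T : Torus n}

theorem wproj_Ad (α : charGroup T) (t : T.carrier) (Y : Matrix (Fin n) (Fin n) ℂ) :
    T.wproj α (Ad (t : GL (Fin n) ℂ) Y) = (α.1 t : ℂ) • T.wproj α Y := by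
  refine T.ext_Ad fun i j => ?_
  rw [Ad_wproj, Ad_diagonalizer_apply, Ad_smul, Matrix.smul_apply, Ad_wproj]
  split_ifs with h
  · rw [h, smul_eq_mul]
  · simp

end Torus

section Weights

variable {n : ℕ} {G : Subgroup (GL (Fin n) ℂ)} {X : Set (ℂˣ × ℂˣ →* GL (Fin n) ℂ)} {T : Torus n}

/-- The subspace of the Lie algebra of `G` on which `T` acts through the cocharacter `μ` by
`z ↦ z ^ k`. -/
def cocharPart (hG : IsZariskiClosed ℂ (G : Set (GL (Fin n) ℂ))) (μ : cocharGroup T) (k : ℤ) :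
    Submodule ℂ (Matrix (Fin n) (Fin n) ℂ) where
  carrier := {Y | Y ∈ lieAlg G ∧ ∀ z : ℂˣ, Ad (μ.1 z : GL (Fin n) ℂ) Y = ((z ^ k : ℂˣ) : ℂ) • Y}
  add_mem' := by
    intro A B hA hB
    exact ⟨(lieSub G hG).add_mem hA.1 hB.1, fun z => by rw [Ad_add, hA.2, hB.2, smul_add]⟩
  zero_mem' := ⟨(lieSub G hG).zero_mem, fun z => by simp [Ad]⟩
  smul_mem' := by
    intro c A hA
    exact ⟨(lieSub G hG).smul_mem c hA.1, fun z => by rw [Ad_smul, hA.2, smul_comm]⟩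

theorem Torus.IsWeightVec.mem_cocharPart {hG : IsZariskiClosed ℂ (G : Set (GL (Fin n) ℂ))}
    {α : charGroup T} {Y : Matrix (Fin n) (Fin n) ℂ} (hYG : Y ∈ lieAlg G)
    (hY : T.IsWeightVec α Y) (μ : cocharGroup T) : Y ∈ cocharPart hG μ (pair α μ) :=
  ⟨hYG, fun z => (hY (μ.1 z)).trans (by rw [pairing_pair α μ z])⟩

section Conjugate

variable {h : ℂˣ × ℂˣ →* GL (Fin n) ℂ} {g : GL (Fin n) ℂ} {μ : cocharGroup T}

theorem Ad_inv_of_mem_cocharPart {hG : IsZariskiClosed ℂ (G : Set (GL (Fin n) ℂ))}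
    (hμ : ∀ z : ℂˣ, (μ.1 z : GL (Fin n) ℂ) = g * (h (z, 1))⁻¹ * g⁻¹) {k : ℤ}
    {Y : Matrix (Fin n) (Fin n) ℂ} (hY : Y ∈ cocharPart hG μ k) (z : ℂˣ) :
    Ad (h (z, 1)) (Ad g⁻¹ Y) = ((z ^ (-k) : ℂˣ) : ℂ) • Ad g⁻¹ Y := by
  have h1 := hY.2 z⁻¹
  have h2 : ((μ.1 z⁻¹ : T.carrier) : GL (Fin n) ℂ) = g * h (z, 1) * g⁻¹ := by
    rw [hμ, ← map_inv]
    simp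
  rw [h2, Ad_mul, Ad_mul, inv_zpow'] at h1
  rw [← Ad_smul, ← h1, ← Ad_mul g⁻¹ g, inv_mul_cancel, Ad_one]

theorem pair_eq_of_mem_cocharPart (hGX : IsShimuraDatum G X) (hh : h ∈ X) (hg : g ∈ G)
    (hμ : ∀ z : ℂˣ, (μ.1 z : GL (Fin n) ℂ) = g * (h (z, 1))⁻¹ * g⁻¹) {k : ℤ}
    {Y : Matrix (Fin n) (Fin n) ℂ} (hY : Y ∈ cocharPart hGX.closed μ k) (h0 : Y ≠ 0) :
    k = -1 ∨ k = 0 ∨ k = 1 := by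
  have hAd := Ad_inv_of_mem_cocharPart hμ hY
  have hne : Ad g⁻¹ Y ≠ 0 := fun h1 => h0 (by
    have h2 : Ad g (Ad g⁻¹ Y) = 0 := by
      rw [h1]
      simp [Ad]
    rwa [← Ad_mul, mul_inv_cancel, Ad_one] at h2)
  obtain ⟨Y₁, h1, Y₂, h2, Y₃, h3, hsum⟩ := hGX.hodgeType h hh _ (Ad_mem_lieAlg (inv_mem hg) hY.1)
  rw [hsum] at hAd hne
  have key : ∀ z : ℂˣ, ((z : ℂ) - (z ^ (-k) : ℂˣ)) • Y₁ = 0 ∧ (1 - ((z ^ (-k) : ℂˣ) : ℂ)) • Y₂ = 0 ∧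
      ((z⁻¹ : ℂˣ) - ((z ^ (-k) : ℂˣ) : ℂ)) • Y₃ = 0 := by
    intro z
    refine hodgePart_eq_zero ((hodgeSub hGX.closed h _ _).smul_mem _ h1)
      ((hodgeSub hGX.closed h _ _).smul_mem _ h2) ((hodgeSub hGX.closed h _ _).smul_mem _ h3) ?_
    have h4 := hAd z
    rw [Ad_add, Ad_add, h1.2, h2.2, h3.2, ← sub_eq_zero] at h4
    simp only [neg_neg, zpow_one, inv_one, mul_one, neg_zero, zpow_zero, Units.val_one,
      one_smul, zpow_neg_one] at h4
    rw [← h4]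
    module
  have hz : ∀ {j : ℤ} {W : Matrix (Fin n) (Fin n) ℂ}, W ≠ 0 →
      (∀ z : ℂˣ, (((z ^ j : ℂˣ) : ℂ) - ((z ^ (-k) : ℂˣ) : ℂ)) • W = 0) → j = -k := by
    intro j W hW hj
    exact zpow_unit_injective fun z =>
      Units.ext (sub_eq_zero.1 ((smul_eq_zero.1 (hj z)).resolve_right hW))
  by_cases hY1 : Y₁ = 0
  · by_cases hY2 : Y₂ = 0
    · have hY3 : Y₃ ≠ 0 := fun hY3 => hne (by simp [hY1, hY2, hY3])
      have := hz (j := -1) hY3 fun z => by simpa using (key z).2.2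
      omega
    · have := hz (j := 0) hY2 fun z => by simpa using (key z).2.1
      omega
  · have := hz (j := 1) hY1 fun z => by simpa using (key z).1
    omega

theorem finrank_cocharPart (hGX : IsShimuraDatum G X) {d : ℕ} (hd : HasComplexDim G X d)
    (hh : h ∈ X) (hg : g ∈ G)
    (hμ : ∀ z : ℂˣ, (μ.1 z : GL (Fin n) ℂ) = g * (h (z, 1))⁻¹ * g⁻¹) :
    Module.finrank ℂ (cocharPart hGX.closed μ (-1)) = d := by
  rw [← hGX.finrank_hodgePart hd hh]
  have hmap : cocharPart hGX.closed μ (-1) = (hodgeSub hGX.closed h (-1) 1).map (Adₗ g) := by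
    ext Y
    constructor
    · intro hY
      refine ⟨Ad g⁻¹ Y, ?_, by rw [Adₗ_apply, ← Ad_mul, mul_inv_cancel, Ad_one]⟩
      have hAd := Ad_inv_of_mem_cocharPart hμ hY (Units.mk0 2 two_ne_zero)
      obtain ⟨Y₁, h1, Y₂, h2, Y₃, h3, hsum⟩ :=
        hGX.hodgeType h hh _ (Ad_mem_lieAlg (inv_mem hg) hY.1)
      rw [hsum, Ad_add, Ad_add, h1.2, h2.2, h3.2, ← sub_eq_zero] at hAd
      obtain ⟨-, e2, e3⟩ := hodgePart_eq_zero (hodgeSub hGX.closed h (-1) 1).zero_mem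
        ((hodgeSub hGX.closed h _ _).smul_mem (-1 : ℂ) h2)
        ((hodgeSub hGX.closed h _ _).smul_mem ((2 : ℂ)⁻¹ - 2) h3) (by
          refine Eq.trans ?_ hAd
          simp only [neg_neg, zpow_one, inv_one, mul_one, neg_zero, zpow_zero, Units.val_one,
            one_smul, zpow_neg_one, Units.val_mk0, Units.val_inv_eq_inv_val]
          module)
      rw [hsum, (smul_eq_zero.1 e2).resolve_left (by norm_num),
        (smul_eq_zero.1 e3).resolve_left (by norm_num), add_zero, add_zero]
      exact h1
    · rintro ⟨Z, hZ, rfl⟩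
      refine ⟨Ad_mem_lieAlg hg hZ.1, fun z => ?_⟩
      rw [hμ, Adₗ_apply, ← map_inv, ← Ad_mul, inv_mul_cancel_right, Ad_mul]
      have h1 := hZ.2 z⁻¹ 1
      have h2 : (z, (1 : ℂˣ))⁻¹ = (z⁻¹, 1) := by simp
      rw [h2, h1, Ad_smul]
      simp
  rw [hmap]
  exact (Submodule.equivMapOfInjective (Adₗ g) (Torus.Ad_injective g) _).finrank_eq.symm

end Conjugate

theorem finite_positiveSystem {P : Set (charGroup T)} (hP : IsPositiveSystem G T P) : P.Finite := by
  obtain ⟨l, -, rfl⟩ := hP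
  exact (T.roots_finite G).subset fun α hα => hα.1

theorem IsPositiveSystem.subset_roots {P : Set (charGroup T)} (hP : IsPositiveSystem G T P) :
    P ⊆ roots G T := by
  obtain ⟨l, -, rfl⟩ := hP
  exact fun α hα => hα.1

/-- If the roots come in opposite pairs, one of each pair is positive. -/
theorem IsPositiveSystem.mem_or_inv_mem {P : Set (charGroup T)} (hP : IsPositiveSystem G T P)
    {α : charGroup T} (hα : α ∈ roots G T) (hα' : α⁻¹ ∈ roots G T) : α ∈ P ∨ α⁻¹ ∈ P := by
  obtain ⟨l, hl, rfl⟩ := hP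
  have h0 : pair α l ≠ 0 := fun h => hl α hα (pairing_iff.2 h)
  rcases lt_or_gt_of_ne h0 with h | h
  · exact Or.inr ⟨hα', -pair α l, by omega, pairing_iff.2 (pair_inv_left α l)⟩
  · exact Or.inl ⟨hα, pair α l, h, pairing_pair α l⟩

theorem IsPositiveSystem.not_inv_mem {P : Set (charGroup T)} (hP : IsPositiveSystem G T P)
    {α : charGroup T} (hα : α ∈ P) : α⁻¹ ∉ P := by
  obtain ⟨l, hl, rfl⟩ := hP
  rintro ⟨-, k, hk, h⟩
  obtain ⟨-, k', hk', h'⟩ := hα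
  rw [pairing_iff] at h h'
  rw [pair_inv_left] at h
  omega

theorem pair_sumPosRoots {P : Set (charGroup T)} (hP : P.Finite) (l : cocharGroup T) :
    pair (sumPosRoots P) l = ∑ α ∈ hP.toFinset, pair α l := by
  rw [sumPosRoots, finprod_mem_eq_finite_toFinset_prod _ hP, pair_prod]

/-- The dimension of the part of weight `-1` is the number of roots of weight `-1`. -/
theorem card_roots_eq_finrank (hG : IsZariskiClosed ℂ (G : Set (GL (Fin n) ℂ)))
    (hT : IsMaximalTorus G T)
    (hK : LieAlgebra.IsKilling ℂ (lieSub G hG ⧸ LieAlgebra.center ℂ (lieSub G hG)))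
    (μ : cocharGroup T) (S : Finset (charGroup T))
    (hS : ∀ α, α ∈ S ↔ α ∈ roots G T ∧ pair α μ = -1) :
    S.card = Module.finrank ℂ (cocharPart hG μ (-1)) := by
  have hex : ∀ α : S, ∃ Y ∈ lieAlg G, Y ≠ 0 ∧ T.IsWeightVec α.1 Y :=
    fun α => ((hS α).1 α.2).1.2
  choose Y hYG hY0 hY using hex
  have hli : LinearIndependent ℂ Y := by
    rw [Fintype.linearIndependent_iff]
    intro c hc β
    have h1 := congrArg (T.wproj β.1) hc
    rw [map_sum, map_zero, Finset.sum_eq_single β, map_smul, (hY β).wproj_eq] at h1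
    · exact (smul_eq_zero.1 h1).resolve_right (hY0 β)
    · intro α _ hne
      rw [map_smul, (hY α).wproj_eq_zero (fun h => hne (Subtype.ext h.symm)), smul_zero]
    · simp
  have hspan : cocharPart hG μ (-1) = Submodule.span ℂ (Set.range Y) := by
    refine le_antisymm (fun Z hZ => ?_) (Submodule.span_le.2 ?_)
    · rw [← T.sum_wproj Z]
      refine sum_mem fun α _ => ?_
      by_cases h0 : T.wproj α Z = 0
      · rw [h0]
        exact zero_mem _
      have hp : pair α μ = -1 := zpow_unit_injective fun z => Units.ext (by
        have h1 := Torus.wproj_Ad α (μ.1 z) Z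
        rw [hZ.2 z, map_smul, pairing_pair α μ z, ← sub_eq_zero, ← sub_smul] at h1
        exact (sub_eq_zero.1 ((smul_eq_zero.1 h1).resolve_right h0)).symm)
      have hZG := T.wproj_mem_lieAlg hG hT.1 α hZ.1
      have hZw := T.wproj_isWeightVec α Z
      have hαS : α ∈ S := (hS α).2 ⟨⟨fun h1 => by
        rw [h1, pair_one_left] at hp
        omega, _, hZG, h0, hZw⟩, hp⟩
      obtain ⟨c, hc⟩ := exists_eq_smul_of_root hT hK ((hS α).1 hαS).1 (hYG ⟨α, hαS⟩)
        (hY ⟨α, hαS⟩) (hY0 ⟨α, hαS⟩) hZG hZw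
      rw [hc]
      exact Submodule.smul_mem _ _ (Submodule.subset_span ⟨_, rfl⟩)
    · rintro _ ⟨α, rfl⟩
      have h1 := (hY α).mem_cocharPart (hG := hG) (hYG α) μ
      rwa [((hS α).1 α.2).2] at h1
  rw [hspan, finrank_span_eq_card hli, Fintype.card_coe]

/-- The positive roots pair with `μ` to `0` or `-1`, and the root spaces of the latter make up a
conjugate of the holomorphic tangent space `𝔤^(-1,1)` of `X`. -/
theorem pair_sumPosRoots_eq (hGX : IsShimuraDatum G X) {d : ℕ} (hd : HasComplexDim G X d)
    (hT : IsMaximalTorus G T) {P : Set (charGroup T)} (hP : IsPositiveSystem G T P)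
    {μ : cocharGroup T} (hμ : IsNegHodgeCochar G X μ) (hμP : IsAntidominant P μ) :
    pair (sumPosRoots P) μ = -d := by
  classical
  obtain ⟨h, hh, g, hg, hμ⟩ := hμ
  have hfin := finite_positiveSystem hP
  have hK := hGX.isKilling
  have hle : ∀ α ∈ P, pair α μ ≤ 0 := fun α hα => by
    obtain ⟨k, hk, hp⟩ := hμP α hα
    rwa [pairing_iff.1 hp]
  have hval : ∀ α ∈ P, pair α μ = if pair α μ = -1 then -1 else 0 := fun α hα => by
    obtain ⟨-, Y, hYG, hY0, hY⟩ := hP.subset_roots hα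
    have h1 := pair_eq_of_mem_cocharPart hGX hh hg hμ
      (Torus.IsWeightVec.mem_cocharPart hYG hY μ) hY0
    have h2 := hle α hα
    split_ifs with h3 <;> omega
  have hcard := card_roots_eq_finrank hGX.closed hT hK μ
    (hfin.toFinset.filter fun α => pair α μ = -1) (fun α => by
      rw [Finset.mem_filter, hfin.mem_toFinset]
      refine and_congr_left fun h1 => ⟨fun h2 => hP.subset_roots h2, fun h2 => ?_⟩
      refine (hP.mem_or_inv_mem h2 (inv_mem_roots hT hK h2)).resolve_right fun h3 => ?_
      have h4 := hle _ h3
      rw [pair_inv_left] at h4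
      omega)
  rw [finrank_cocharPart hGX hd hh hg hμ] at hcard
  rw [pair_sumPosRoots hfin, Finset.sum_congr rfl fun α hα => hval α (hfin.mem_toFinset.1 hα),
    ← Finset.sum_filter, Finset.sum_const, hcard, nsmul_eq_mul, mul_neg_one]

end Weights

/-! ### The sum of the positive roots pairs evenly with coroots -/

section Parity

variable {n : ℕ} {G : Subgroup (GL (Fin n) ℂ)} {T : Torus n}

theorem eq_of_exp_eq {u v : ℂ} (h : ∀ z : ℂ, Complex.exp (z * u) = Complex.exp (z * v)) :
    u = v := by
  have hd : ∀ w : ℂ, HasDerivAt (fun z : ℂ => Complex.exp (z * w)) w 0 := fun w => by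
    have h1 := ((hasDerivAt_id (0 : ℂ)).mul_const w).cexp
    refine h1.congr_deriv ?_
    simp
  have h2 := hd u
  rw [funext h] at h2
  exact h2.unique (hd v)

theorem Torus.dwt_eq_of_zpow {α β : charGroup T} (hα : α ∈ T.wts) (hβ : β ∈ T.wts) {a b : ℤ}
    (h : α ^ a = β ^ b) {X : Matrix (Fin n) (Fin n) ℂ} (hX : X ∈ lieAlg T.carrier) :
    a * T.dwt α X = b * T.dwt β X := by
  refine eq_of_exp_eq fun z => ?_
  have key : ∀ {γ : charGroup T} (_ : γ ∈ T.wts) (k : ℤ), Complex.exp (z * (k * T.dwt γ X)) =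
      ((γ ^ k).1 ⟨expGL (z • X), expGL_mem T.closed hX z⟩ : ℂ) := fun {γ} hγ k => by
    have h1 : (γ ^ k).1 ⟨expGL (z • X), expGL_mem T.closed hX z⟩ =
      (γ.1 ⟨expGL (z • X), expGL_mem T.closed hX z⟩) ^ k := rfl
    rw [h1, Units.val_zpow_eq_zpow_val, T.wt_exp hγ hX, ← Complex.exp_int_mul]
    congr 1
    ring
  rw [key hα, key hβ, h]

/-- The reflection of the character group in the root `α` with coroot `l`. -/
def reflect (α : charGroup T) (l : cocharGroup T) (χ : charGroup T) : charGroup T :=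
  χ * α ^ (-pair χ l)

theorem pair_reflect {α : charGroup T} {l : cocharGroup T} (h : Pairing α l 2)
    (χ : charGroup T) : pair (reflect α l χ) l = -pair χ l := by
  rw [reflect, pair_mul_left, pair_zpow_left, pairing_iff.1 h]
  ring

theorem reflect_reflect {α : charGroup T} {l : cocharGroup T} (h : Pairing α l 2)
    (χ : charGroup T) : reflect α l (reflect α l χ) = χ := by
  rw [reflect, pair_reflect h, reflect, mul_assoc, ← zpow_add]
  simp

theorem reflect_inv (α : charGroup T) (l : cocharGroup T) (χ : charGroup T) :
    reflect α l χ⁻¹ = (reflect α l χ)⁻¹ := by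
  rw [reflect, reflect, pair_inv_left, mul_inv, ← zpow_neg]

theorem reflect_mem_roots {α : charGroup T} {l : cocharGroup T} (h : IsCoroot G T α l)
    {χ : charGroup T} (hχ : χ ∈ roots G T) : reflect α l χ ∈ roots G T := by
  obtain ⟨-, hp, w, hwG, hw⟩ := h
  obtain ⟨hχ1, Y, hYG, hY0, hY⟩ := hχ
  refine ⟨fun h1 => hχ1 ?_, Ad w⁻¹ Y, Ad_mem_lieAlg (inv_mem hwG) hYG, fun h1 => hY0 ?_, ?_⟩
  · rw [← reflect_reflect hp χ, h1, reflect, pair_one_left]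
    simp
  · have h2 : Ad w⁻¹ 0 = (0 : Matrix (Fin n) (Fin n) ℂ) := by simp [Ad]
    exact Torus.Ad_injective _ (h1.trans h2.symm)
  · intro t
    have h1 : (t : GL (Fin n) ℂ) * w⁻¹ = w⁻¹ * (w * (t : GL (Fin n) ℂ) * w⁻¹) := by group
    rw [← Ad_mul, h1, Ad_mul, hw, hY, Ad_smul]
    congr 2
    rw [map_mul, map_inv, pairing_pair χ l, ← zpow_neg]
    rfl

/-- Up to signs, the reflection in a root `β` permutes the positive roots. It does not change the
parity of the pairing with the coroot `l` of `β`. A positive root fixed up to sign is `β`, `β⁻¹` or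
orthogonal to `l`, because the root system is reduced, so that its pairing with `l` is even. -/
theorem even_pair_sumPosRoots {hG : IsZariskiClosed ℂ (G : Set (GL (Fin n) ℂ))}
    (hT : IsMaximalTorus G T)
    (hK : LieAlgebra.IsKilling ℂ (lieSub G hG ⧸ LieAlgebra.center ℂ (lieSub G hG)))
    {P : Set (charGroup T)} (hP : IsPositiveSystem G T P) {l : cocharGroup T}
    (hl : l ∈ coroots G T) : Even (pair (sumPosRoots P) l) := by
  classical
  obtain ⟨β, hβ⟩ := hl
  have hp := hβ.2.1
  have hfin := finite_positiveSystem hP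
  rw [pair_sumPosRoots hfin, ← ZMod.intCast_eq_zero_iff_even, Int.cast_sum]
  let φ : charGroup T → charGroup T := fun γ =>
    if reflect β l γ ∈ P then reflect β l γ else (reflect β l γ)⁻¹
  have hφ : ∀ γ, φ γ = reflect β l γ ∨ φ γ = (reflect β l γ)⁻¹ := fun γ => by
    by_cases h : reflect β l γ ∈ P
    · exact Or.inl (if_pos h)
    · exact Or.inr (if_neg h)
  have hparity : ∀ γ, ((pair (φ γ) l : ℤ) : ZMod 2) = (pair γ l : ℤ) := fun γ => by
    rcases hφ γ with h | h
    · rw [h, pair_reflect hp, Int.cast_neg, ZMod.neg_eq_self_mod_two]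
    · rw [h, pair_inv_left, pair_reflect hp, neg_neg]
  refine Finset.sum_involution (fun γ _ => φ γ) ?_ ?_ ?_ ?_
  · intro γ _
    rw [hparity]
    exact CharTwo.add_self_eq_zero _
  · intro γ hγ hne h
    refine hne ?_
    have hγr := hP.subset_roots (hfin.mem_toFinset.1 hγ)
    change φ γ = γ at h
    rcases hφ γ with h1 | h1
    · have h2 := pair_reflect hp γ
      rw [← h1, h] at h2
      have h3 : pair γ l = 0 := by omega
      rw [h3, Int.cast_zero]
    · -- `γ ^ 2` is a power of `β`
      have h2 : γ ^ (2 : ℤ) = β ^ pair γ l := by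
        have h3 : γ = γ⁻¹ * β ^ pair γ l := by
          conv_lhs => rw [← h, h1, reflect, mul_inv, ← zpow_neg, neg_neg]
        rw [zpow_two]
        exact (congrArg (γ * ·) h3).trans (mul_inv_cancel_left γ _)
      have h4 : ∀ X ∈ lieAlg T.carrier, T.dwt γ X = (pair γ l / 2 : ℂ) * T.dwt β X := by
        intro X hX
        have h5 := Torus.dwt_eq_of_zpow (root_mem_wts hγr) (root_mem_wts hβ.1) h2 hX
        push_cast at h5
        linear_combination h5 / 2
      rcases eq_inv_or_eq_of_dwt hT hK hβ.1 hγr _ h4 with h5 | h5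
      · rw [h5, pair_inv_left, pairing_iff.1 hp]
        decide
      · rw [h5, pairing_iff.1 hp]
        decide
  · intro γ hγ
    have hγr := reflect_mem_roots hβ (hP.subset_roots (hfin.mem_toFinset.1 hγ))
    rw [hfin.mem_toFinset]
    by_cases h : reflect β l γ ∈ P
    · simp only [φ, if_pos h]
      exact h
    · simp only [φ, if_neg h]
      exact (hP.mem_or_inv_mem hγr (inv_mem_roots hT hK hγr)).resolve_left h
  · intro γ hγ
    have hγP := hfin.mem_toFinset.1 hγ
    by_cases h : reflect β l γ ∈ P
    · simp only [φ, if_pos h, reflect_reflect hp, if_pos hγP]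
    · simp only [φ, if_neg h, reflect_inv, reflect_reflect hp, if_neg (hP.not_inv_mem hγP), inv_inv]

end Parity

/-! ### The element `e` of the dual group -/

section Dual

variable {n m : ℕ} {G : Subgroup (GL (Fin n) ℂ)} {T : Torus n} {P : Set (charGroup T)}
  {G' : Subgroup (GL (Fin m) ℂ)} {T' : Torus m} {P' : Set (charGroup T')}

/-- The positive coroots of the dual group are the positive roots. -/
theorem Duality.posCoroots_eq (D : Duality G T P G' T' P') (hP : IsPositiveSystem G T P) :
    posCoroots G' T' P' = D.toCochar '' P := by
  ext l'
  constructor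
  · rintro ⟨α', hα', hc⟩
    obtain ⟨l, rfl⟩ := D.toChar.surjective α'
    obtain ⟨χ, rfl⟩ := D.toCochar.surjective l'
    rw [D.isCoroot_iff] at hc
    exact ⟨χ, (D.pos_iff χ l hc).1 hα', rfl⟩
  · rintro ⟨χ, hχ, rfl⟩
    obtain ⟨α', hc⟩ := (D.coroots_iff χ).2 (hP.subset_roots hχ)
    obtain ⟨l, rfl⟩ := D.toChar.surjective α'
    exact ⟨D.toChar l, (D.pos_iff χ l ((D.isCoroot_iff χ l).1 hc)).2 hχ, hc⟩

theorem Duality.sumPosCoroots_eq (D : Duality G T P G' T' P') (hP : IsPositiveSystem G T P) :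
    sumPosCoroots G' T' P' = D.toCochar (sumPosRoots P) := by
  rw [sumPosCoroots, D.posCoroots_eq hP, finprod_mem_image D.toCochar.injective.injOn,
    sumPosRoots, MulEquiv.map_finprod_mem D.toCochar _ (finite_positiveSystem hP)]

theorem Duality.pair_toChar (D : Duality G T P G' T' P') (χ : charGroup T) (l : cocharGroup T) :
    pair (D.toChar l) (D.toCochar χ) = pair χ l :=
  pairing_iff.1 ((D.pairing χ l _).2 (pairing_pair χ l))

theorem Duality.toChar_sumPosCoroots (D : Duality G T P G' T' P') (hP : IsPositiveSystem G T P)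
    (l : cocharGroup T) :
    (D.toChar l).1 ((sumPosCoroots G' T' P').1 (-1)) = (-1) ^ pair (sumPosRoots P) l := by
  rw [D.sumPosCoroots_eq hP, pairing_pair (D.toChar l), D.pair_toChar]

theorem isZariskiClosed_commute {m : ℕ} (e : GL (Fin m) ℂ) :
    IsZariskiClosed ℂ {g : GL (Fin m) ℂ | g * e = e * g} := by
  refine ⟨Set.range fun q : Fin m × Fin m =>
    ∑ k, (MvPolynomial.X (q.1, k) * MvPolynomial.C (e.1 k q.2) -
      MvPolynomial.C (e.1 q.1 k) * MvPolynomial.X (k, q.2)), ?_⟩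
  ext g
  simp only [Set.mem_ofPred_eq, Set.forall_mem_range, map_sum, map_sub, map_mul,
    MvPolynomial.aeval_X, MvPolynomial.aeval_C, Finset.sum_sub_distrib]
  rw [Units.ext_iff, ← Matrix.ext_iff, Prod.forall]
  refine forall₂_congr fun i j => ?_
  rw [sub_eq_zero, Units.val_mul, Units.val_mul, Matrix.mul_apply, Matrix.mul_apply]
  rfl

/-- An element of the torus on which all roots are trivial is central: its centralizer contains the
Lie algebra of the connected group `G'`. -/
theorem mem_center_of_roots (hG' : IsConnectedReductive G') (hT' : T'.carrier ≤ G') (t : T'.carrier)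
    (ht : ∀ α ∈ roots G' T', α.1 t = 1) : Subgroup.inclusion hT' t ∈ Subgroup.center G' := by
  let K : Subgroup (GL (Fin m) ℂ) := G' ⊓ Subgroup.centralizer {(t : GL (Fin m) ℂ)}
  have hmem : ∀ g, g ∈ K ↔ g ∈ G' ∧ g * (t : GL (Fin m) ℂ) = t * g := fun g => by
    rw [Subgroup.mem_inf, Subgroup.mem_centralizer_singleton_iff]
  have hK : K = G' := by
    refine eq_of_lieAlg_le hG'.closed hG'.connected ?_ inf_le_left fun Y hY => ?_
    · have h1 : (K : Set (GL (Fin m) ℂ)) =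
          (G' : Set (GL (Fin m) ℂ)) ∩ {g | g * (t : GL (Fin m) ℂ) = t * g} :=
        Set.ext hmem
      rw [h1]
      exact hG'.closed.inter (isZariskiClosed_commute _)
    · have hAd : Ad (t : GL (Fin m) ℂ) Y = Y := by
        rw [← Adₗ_apply]
        conv_lhs => rw [← T'.sum_wproj Y]
        conv_rhs => rw [← T'.sum_wproj Y]
        rw [map_sum]
        refine Finset.sum_congr rfl fun α _ => ?_
        rw [Adₗ_apply, T'.wproj_isWeightVec α Y t]
        by_cases h0 : T'.wproj α Y = 0
        · rw [h0, smul_zero]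
        by_cases h1 : α = 1
        · rw [h1]
          exact one_smul ℂ _
        · rw [ht α ⟨h1, _, T'.wproj_mem_lieAlg hG'.closed hT' α hY, h0,
            T'.wproj_isWeightVec α Y⟩, Units.val_one, one_smul]
      rw [mem_lieAlg_iff_exp] at hY ⊢
      intro s
      refine (hmem _).2 ⟨hY s, ?_⟩
      rw [eq_comm, ← mul_inv_eq_iff_eq_mul, conj_expGL, ← Complex.coe_smul, Ad_smul, hAd]
  rw [Subgroup.mem_center_iff]
  intro g
  have hg : (g : GL (Fin m) ℂ) ∈ K := by
    rw [hK]
    exact g.2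
  exact Subtype.ext ((hmem _).1 hg).2

theorem elementE_mem_center {hG : IsZariskiClosed ℂ (G : Set (GL (Fin n) ℂ))}
    (hT : IsMaximalTorus G T)
    (hK : LieAlgebra.IsKilling ℂ (lieSub G hG ⧸ LieAlgebra.center ℂ (lieSub G hG)))
    (hP : IsPositiveSystem G T P) (hG' : IsConnectedReductive G') (hT' : T'.carrier ≤ G')
    (D : Duality G T P G' T' P') : elementE G' T' P' hT' ∈ Subgroup.center G' := by
  refine mem_center_of_roots hG' hT' _ fun α' hα' => ?_
  obtain ⟨l, rfl⟩ := D.toChar.surjective α'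
  rw [D.toChar_sumPosCoroots hP]
  exact (even_pair_sumPosRoots hT hK hP ((D.roots_iff l).1 hα')).neg_one_zpow

end Dual

/-! ### The action of `e` in the irreducible representation -/

/-- Schur's lemma, for an endomorphism with a known eigenvector. -/
theorem eq_smul_of_commute {H V : Type*} [Group H] [AddCommGroup V] [Module ℂ V]
    {r : Representation ℂ H V} (hr : r.IsIrreducible) (A : V →ₗ[ℂ] V)
    (hA : ∀ g v, A (r g v) = r g (A v)) {v : V} (hv : v ≠ 0) {c : ℂ} (hAv : A v = c • v) (x : V) :
    A x = c • x := by
  have h1 : ∀ g x, (A - c • LinearMap.id : V →ₗ[ℂ] V) (r g x) =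
      r g ((A - c • LinearMap.id : V →ₗ[ℂ] V) x) := by
    intro g x
    simp [hA]
  let f := LinearMap.intertwiningMap_of_isIntertwiningMap (ρ := r) (σ := r) _ h1
  rcases Representation.IsIrreducible.injective_or_eq_zero f with h | h
  · refine absurd (h (a₁ := v) (a₂ := 0) ?_) hv
    rw [map_zero]
    change A v - c • v = 0
    rw [hAv, sub_self]
  · have h2 : f x = 0 := by
      rw [h]
      rfl
    exact sub_eq_zero.1 h2

section Action

variable {m : ℕ} {G' : Subgroup (GL (Fin m) ℂ)} {T' : Torus m} {P' : Set (charGroup T')}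

namespace IsPinnedAction

variable {hT' : T'.carrier ≤ G'} {Γ : Type*} [Group Γ] {act : Γ →* MulAut G'}

/-- The restriction to the torus of the automorphism given by `γ`. -/
def onTorus (h : IsPinnedAction P' hT' act) (γ : Γ) : T'.carrier →* T'.carrier where
  toFun t := (h.torus γ t).choose
  map_one' := Subgroup.inclusion_injective hT' (by
    rw [← (h.torus γ 1).choose_spec, map_one, map_one])
  map_mul' s t := Subgroup.inclusion_injective hT' (by
    rw [← (h.torus γ (s * t)).choose_spec, map_mul, map_mul, map_mul,
      ← (h.torus γ s).choose_spec, ← (h.torus γ t).choose_spec])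

theorem act_inclusion (h : IsPinnedAction P' hT' act) (γ : Γ) (t : T'.carrier) :
    act γ (Subgroup.inclusion hT' t) = Subgroup.inclusion hT' (h.onTorus γ t) :=
  (h.torus γ t).choose_spec

theorem onTorus_inv (h : IsPinnedAction P' hT' act) (γ : Γ) (t : T'.carrier) :
    h.onTorus γ (h.onTorus γ⁻¹ t) = t :=
  Subgroup.inclusion_injective hT' (by
    rw [← act_inclusion, ← act_inclusion, ← MulAut.mul_apply, ← map_mul, mul_inv_cancel, map_one,
      MulAut.one_apply])

/-- The action of `γ` on the cocharacters of the torus. -/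
def onCochar (h : IsPinnedAction P' hT' act) (γ : Γ) : cocharGroup T' →* cocharGroup T' where
  toFun l := ⟨(h.onTorus γ).comp l.1, fun i j => by
    have h1 := (h.algebraic γ i j).comp_cochar (hT := hT') l
    have h2 : (fun z => ((act γ (Subgroup.inclusion hT' (l.1 z)) : G') : GL (Fin m) ℂ).1 i j) =
        fun z => ((h.onTorus γ (l.1 z) : T'.carrier) : GL (Fin m) ℂ).1 i j := by
      funext z
      rw [h.act_inclusion]
      rfl
    exact h2 ▸ h1⟩
  map_one' := Subtype.ext (MonoidHom.ext fun z => map_one (h.onTorus γ))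
  map_mul' l l' := Subtype.ext (MonoidHom.ext fun z => map_mul (h.onTorus γ) (l.1 z) (l'.1 z))

theorem onCochar_injective (h : IsPinnedAction P' hT' act) (γ : Γ) :
    Function.Injective (h.onCochar γ) := by
  intro l l' hl
  refine Subtype.ext (MonoidHom.ext fun z => ?_)
  have h1 : h.onTorus γ (l.1 z) = h.onTorus γ (l'.1 z) :=
    congrArg (fun k : cocharGroup T' => k.1 z) hl
  have h2 := congrArg (Subgroup.inclusion hT') h1
  rw [← act_inclusion, ← act_inclusion] at h2
  exact Subgroup.inclusion_injective hT' ((act γ).injective h2)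

theorem onCochar_mem_posCoroots (h : IsPinnedAction P' hT' act) (hP' : IsPositiveSystem G' T' P')
    (γ : Γ) {l : cocharGroup T'} (hl : l ∈ posCoroots G' T' P') :
    h.onCochar γ l ∈ posCoroots G' T' P' := by
  obtain ⟨α, hα, -, hp, w, hw, hwt⟩ := hl
  obtain ⟨β, hβP, hβ⟩ := h.positive γ⁻¹ α hα
  have hβ' : ∀ t, β.1 t = α.1 (h.onTorus γ⁻¹ t) := fun t => hβ t _ (h.act_inclusion γ⁻¹ t)
  have hβγ : ∀ t, β.1 (h.onTorus γ t) = α.1 t := fun t => by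
    have h1 := h.onTorus_inv γ⁻¹ t
    rw [inv_inv] at h1
    rw [hβ', h1]
  refine ⟨β, hβP, hP'.subset_roots hβP, fun z => (hβγ (l.1 z)).trans (hp z), _,
    (act γ ⟨w, hw⟩).2, fun t => ?_⟩
  have h1 : (⟨w, hw⟩ : G') * Subgroup.inclusion hT' (h.onTorus γ⁻¹ t) * (⟨w, hw⟩ : G')⁻¹ =
      Subgroup.inclusion hT' (h.onTorus γ⁻¹ t * (l.1 (α.1 (h.onTorus γ⁻¹ t)))⁻¹) :=
    Subtype.ext (hwt _)
  have h2 := congrArg (act γ) h1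
  rw [map_mul, map_mul, map_inv, h.act_inclusion, h.act_inclusion, map_mul, map_inv, onTorus_inv,
    ← hβ'] at h2
  exact congrArg Subtype.val h2

/-- The action permutes the positive coroots, and so fixes their sum. -/
theorem act_elementE (h : IsPinnedAction P' hT' act) (hP' : IsPositiveSystem G' T' P')
    (hfin : (posCoroots G' T' P').Finite) (γ : Γ) :
    act γ (elementE G' T' P' hT') = elementE G' T' P' hT' := by
  have himage : h.onCochar γ '' posCoroots G' T' P' = posCoroots G' T' P' := by
    refine Set.eq_of_subset_of_ncard_le ?_ ?_ hfin
    · rintro _ ⟨l, hl, rfl⟩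
      exact h.onCochar_mem_posCoroots hP' γ hl
    · rw [Set.ncard_image_of_injective _ (h.onCochar_injective γ)]
  have hsum : h.onCochar γ (sumPosCoroots G' T' P') = sumPosCoroots G' T' P' := by
    have h1 := finprod_mem_image (f := fun l => l)
      (h.onCochar_injective γ).injOn (s := posCoroots G' T' P')
    rw [himage] at h1
    rw [sumPosCoroots, MonoidHom.map_finprod_mem _ _ hfin]
    exact h1.symm
  rw [elementE, h.act_inclusion]
  exact congrArg (fun l : cocharGroup T' => Subgroup.inclusion hT' (l.1 (-1))) hsum

end IsPinnedAction

end Action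

/-! ### The representation of the `C`-group -/

section CGroupRep

variable {H Γ V : Type*} [Group H] [Group Γ] [AddCommGroup V] [Module ℂ V] {act : Γ →* MulAut H}

/-- The representation `((g, z), γ) ↦ z ^ k * rL (g, γ)` before passing to the quotient. -/
def twistRep (rL : Representation ℂ (H ⋊[act] Γ) V) (k : ℤ) :
    Representation ℂ ((H × ℂˣ) ⋊[prodAct act] Γ) V where
  toFun x := ((x.left.2 ^ k : ℂˣ) : ℂ) • rL ⟨x.left.1, x.right⟩
  map_one' := by
    change ((1 ^ k : ℂˣ) : ℂ) • rL 1 = 1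
    rw [one_zpow, map_one, Units.val_one, one_smul]
  map_mul' x y := by
    change (((x.left.2 * y.left.2) ^ k : ℂˣ) : ℂ) •
      rL (⟨x.left.1, x.right⟩ * ⟨y.left.1, y.right⟩) = _
    rw [map_mul, mul_zpow, Units.val_mul, smul_mul_smul_comm]

/-- The representation `[g, z, γ] ↦ z ^ k * rL (g, γ)` of the `C`-group. -/
def cRep (rL : Representation ℂ (H ⋊[act] Γ) V) (k : ℤ) (e : H)
    (he : twistRep rL k (SemidirectProduct.inl (e, -1)) = 1) :
    Representation ℂ (CGroup act e) V :=
  QuotientGroup.lift (cKernel act e) (twistRep rL k) (by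
    refine Subgroup.normalClosure_le_normal ?_
    rw [Set.singleton_subset_iff]
    exact he)

theorem cRep_mk (rL : Representation ℂ (H ⋊[act] Γ) V) (k : ℤ) (e : H)
    (he : twistRep rL k (SemidirectProduct.inl (e, -1)) = 1) (g : H) (z : ℂˣ) (γ : Γ) :
    cRep rL k e he (CGroup.mk act e g z γ) = ((z ^ k : ℂˣ) : ℂ) • rL ⟨g, γ⟩ := rfl

theorem CGroup.mk_mul (e : H) (g g' : H) (z z' : ℂˣ) (γ γ' : Γ) :
    CGroup.mk act e g z γ * CGroup.mk act e g' z' γ' =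
      CGroup.mk act e (g * act γ g') (z * z') (γ * γ') := rfl

/-- On the elements of `Γ`, a representation of the `C`-group with the given restriction to the
identity component differs from `rL` by an operator that commutes with `r`, and that is the identity
as soon as both fix a common nonzero vector. -/
theorem rep_CGroup_eq (rL : Representation ℂ (H ⋊[act] Γ) V) {r : Representation ℂ H V}
    (hr : r.IsIrreducible) (hrL : ∀ g, rL (SemidirectProduct.inl g) = r g) (k : ℤ) (e : H)
    (rC : Representation ℂ (CGroup act e) V)
    (hrC : ∀ g z, rC (CGroup.mk act e g z 1) = ((z ^ k : ℂˣ) : ℂ) • r g) {v : V} (hv : v ≠ 0)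
    (hLv : ∀ γ, rL (SemidirectProduct.inr γ) v = v) (hCv : ∀ γ, rC (CGroup.mk act e 1 1 γ) v = v)
    (g : H) (z : ℂˣ) (γ : Γ) :
    rC (CGroup.mk act e g z γ) = ((z ^ k : ℂˣ) : ℂ) • rL ⟨g, γ⟩ := by
  have hC1 : ∀ g, rC (CGroup.mk act e g 1 1) = r g := fun g => by
    rw [hrC, one_zpow, Units.val_one, one_smul]
  have hΓ : ∀ γ, rC (CGroup.mk act e 1 1 γ) = rL (SemidirectProduct.inr γ) := by
    intro γ
    have hL : ∀ g, rL (SemidirectProduct.inr γ⁻¹) * r g =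
        r (act γ⁻¹ g) * rL (SemidirectProduct.inr γ⁻¹) := fun g => by
      rw [← hrL, ← hrL, ← map_mul, ← map_mul]
      congr 1
      ext <;> simp
    have hC : ∀ g, rC (CGroup.mk act e 1 1 γ) * r g =
        r (act γ g) * rC (CGroup.mk act e 1 1 γ) := fun g => by
      rw [← hC1, ← hC1, ← map_mul, ← map_mul, CGroup.mk_mul, CGroup.mk_mul]
      simp
    have hA := eq_smul_of_commute hr
      (rC (CGroup.mk act e 1 1 γ) * rL (SemidirectProduct.inr γ⁻¹)) (fun g x => by
        have h1 : rC (CGroup.mk act e 1 1 γ) * rL (SemidirectProduct.inr γ⁻¹) * r g =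
            r g * (rC (CGroup.mk act e 1 1 γ) * rL (SemidirectProduct.inr γ⁻¹)) := by
          rw [mul_assoc, hL, ← mul_assoc, hC, ← MulAut.mul_apply, ← map_mul, mul_inv_cancel,
            map_one, MulAut.one_apply, mul_assoc]
        exact LinearMap.congr_fun h1 x) hv (c := 1) (by
        rw [Module.End.mul_apply, hLv, hCv, one_smul])
    refine LinearMap.ext fun x => ?_
    have h2 := hA (rL (SemidirectProduct.inr γ) x)
    rw [one_smul, Module.End.mul_apply, ← Module.End.mul_apply (rL _) (rL _), ← map_mul, ← map_mul,
      inv_mul_cancel, map_one, map_one, Module.End.one_apply] at h2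
    exact h2
  have h1 : CGroup.mk act e g z γ = CGroup.mk act e g z 1 * CGroup.mk act e 1 1 γ := by
    rw [CGroup.mk_mul]
    simp
  have h2 : (⟨g, γ⟩ : H ⋊[act] Γ) = SemidirectProduct.inl g * SemidirectProduct.inr γ :=
    SemidirectProduct.mk_eq_inl_mul_inr γ g
  rw [h1, map_mul, hrC, hΓ, h2, map_mul, hrL, smul_mul_assoc]

end CGroupRep

end ShimuraCGroup

end

theorem mainTheorem5 {n : ℕ} (G : Subgroup (GL (Fin n) ℂ))
    (X : Set (ℂˣ × ℂˣ →* GL (Fin n) ℂ)) (hGX : ShimuraCGroup.IsShimuraDatum G X)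
    (d : ℕ) (hd : ShimuraCGroup.HasComplexDim G X d)
    (T : ShimuraCGroup.Torus n) (hT : ShimuraCGroup.IsMaximalTorus G T)
    (P : Set (ShimuraCGroup.charGroup T)) (hP : ShimuraCGroup.IsPositiveSystem G T P)
    (μ : ShimuraCGroup.cocharGroup T) (hμ : ShimuraCGroup.IsNegHodgeCochar G X μ)
    (hμP : ShimuraCGroup.IsAntidominant P μ) :
    -- `⟨χ, μ⟩ = -d`
    ShimuraCGroup.Pairing (ShimuraCGroup.sumPosRoots P) μ (-(d : ℤ)) ∧
    -- for the dual group and its irreducible representation with extreme weight `μ`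
    ∀ (m : ℕ) (G' : Subgroup (GL (Fin m) ℂ)) (_ : ShimuraCGroup.IsConnectedReductive G')
      (T' : ShimuraCGroup.Torus m) (hT' : ShimuraCGroup.IsMaximalTorus G' T')
      (P' : Set (ShimuraCGroup.charGroup T')) (_ : ShimuraCGroup.IsPositiveSystem G' T' P')
      (D : ShimuraCGroup.Duality G T P G' T' P')
      (V : Type*) [AddCommGroup V] [Module ℂ V] [FiniteDimensional ℂ V]
      (r : Representation ℂ G' V) (_ : ShimuraCGroup.IsAlgebraicRep r) (_ : r.IsIrreducible)
      (_ : ShimuraCGroup.IsExtremeWeight hT'.1 r (D.toChar μ)),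
      -- `e` is central and acts as `(-1) ^ d`
      (ShimuraCGroup.elementE G' T' P' hT'.1 ∈ Subgroup.center G' ∧
        ∀ x : V, r (ShimuraCGroup.elementE G' T' P' hT'.1) x = (-1 : ℂ) ^ d • x) ∧
      -- for a group `Γ` acting on the dual group and an extension `rL` of `r` to the `L`-group
      ∀ (Γ : Type*) [Group Γ] (act : Γ →* MulAut G')
        (_ : ShimuraCGroup.IsPinnedAction P' hT'.1 act)
        (rL : Representation ℂ (G' ⋊[act] Γ) V)
        (_ : ∀ g : G', rL (SemidirectProduct.inl g) = r g)
        (_ : ∀ γ : Γ, ∀ x ∈ ShimuraCGroup.weightSpace hT'.1 r (D.toChar μ),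
          rL (SemidirectProduct.inr γ) x = x),
        (∀ γ : Γ, act γ (ShimuraCGroup.elementE G' T' P' hT'.1) =
          ShimuraCGroup.elementE G' T' P' hT'.1) ∧
        -- the representation `rC` of the `C`-group exists, extends `rL`, and is unique
        ∃ rC : Representation ℂ
            (ShimuraCGroup.CGroup act (ShimuraCGroup.elementE G' T' P' hT'.1)) V,
          (∀ (g : G') (z : ℂˣ) (γ : Γ), rC (ShimuraCGroup.CGroup.mk act _ g z γ) =
            ((z ^ (-(d : ℤ)) : ℂˣ) : ℂ) • rL ⟨g, γ⟩) ∧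
          ∀ rC' : Representation ℂ
              (ShimuraCGroup.CGroup act (ShimuraCGroup.elementE G' T' P' hT'.1)) V,
            (∀ (g : G') (z : ℂˣ), rC' (ShimuraCGroup.CGroup.mk act _ g z 1) =
              ((z ^ (-(d : ℤ)) : ℂˣ) : ℂ) • r g) →
            (∀ γ : Γ, ∀ x ∈ ShimuraCGroup.weightSpace hT'.1 r (D.toChar μ),
              rC' (ShimuraCGroup.CGroup.mk act _ 1 1 γ) x = x) →
            rC' = rC := by
  have hK := hGX.isKilling
  have hχμ := ShimuraCGroup.pair_sumPosRoots_eq hGX hd hT hP hμ hμP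
  refine ⟨ShimuraCGroup.pairing_iff.2 hχμ, ?_⟩
  intro m G' hG' T' hT' P' hP' D V _ _ _ r _ hirr hext
  obtain ⟨v, hv, hv0⟩ := hext.1
  have hcen := ShimuraCGroup.elementE_mem_center hT hK hP hG' hT'.1 D
  have hev : r (ShimuraCGroup.elementE G' T' P' hT'.1) v = (-1 : ℂ) ^ d • v := by
    rw [ShimuraCGroup.elementE, hv, D.toChar_sumPosCoroots hP, hχμ]
    simp [← inv_pow]
  have hscalar : ∀ x : V, r (ShimuraCGroup.elementE G' T' P' hT'.1) x = (-1 : ℂ) ^ d • x :=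
    ShimuraCGroup.eq_smul_of_commute hirr _ (fun g x => by
      rw [← Module.End.mul_apply, ← map_mul, ← Subgroup.mem_center_iff.1 hcen g, map_mul,
        Module.End.mul_apply]) hv0 hev
  refine ⟨⟨hcen, hscalar⟩, ?_⟩
  intro Γ _ act hact rL hrL hrLμ
  have hfin : (ShimuraCGroup.posCoroots G' T' P').Finite := by
    rw [D.posCoroots_eq hP]
    exact (ShimuraCGroup.finite_positiveSystem hP).image _
  have he : ShimuraCGroup.twistRep rL (-(d : ℤ))
      (SemidirectProduct.inl (ShimuraCGroup.elementE G' T' P' hT'.1, -1)) = 1 := by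
    refine LinearMap.ext fun x => ?_
    change (((-1 : ℂˣ) ^ (-(d : ℤ)) : ℂˣ) : ℂ) •
      rL (SemidirectProduct.inl (ShimuraCGroup.elementE G' T' P' hT'.1)) x = x
    rw [hrL, hscalar, smul_smul]
    have h1 : (((-1 : ℂˣ) ^ (-(d : ℤ)) : ℂˣ) : ℂ) * (-1) ^ d = 1 := by
      rw [zpow_neg, zpow_natCast, Units.val_inv_eq_inv_val, Units.val_pow_eq_pow_val,
        Units.val_neg, Units.val_one]
      exact inv_mul_cancel₀ (pow_ne_zero _ (by norm_num))
    rw [h1, one_smul]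
  refine ⟨hact.act_elementE hP' hfin, ShimuraCGroup.cRep rL _ _ he,
    ShimuraCGroup.cRep_mk rL _ _ he, ?_⟩
  intro rC' hrC' hrCμ'
  refine MonoidHom.ext fun x => ?_
  obtain ⟨⟨⟨g, z⟩, γ⟩, rfl⟩ := QuotientGroup.mk_surjective x
  exact ShimuraCGroup.rep_CGroup_eq rL hirr hrL _ _ rC' hrC' hv0 (fun γ => hrLμ γ v hv)
    (fun γ => hrCμ' γ v hv) g z γ
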